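/- A \emph{switch graph} consists of a finite set $V$ of vertices and two maps $s_0, s_1 \colon V \to V$. Every vertex carries a switch, initially in state $0$. A train starts at a vertex $s$; whenever it is at a vertex $v$ whose switch is in state $i \in \{0,1\}$, it moves to $s_i(v)$ and the switch at $v$ is toggled. The problem $\textsc{Arrival}$ asks, given a switch graph and vertices $s, t$, whether the train starting at $s$ ever reaches $t$. A \emph{comparator circuit} consists of finitely many wires carrying constant input bits, a sequence of comparator gates, each acting on an ordered pair of wires and replacing the values $(x,y)$ on them by $(x \wedge y, x \vee y)$, and a designated output wire. Let $\mathsf{CC}$ be the class of languages that are log-space many-one reducible to the problem of deciding whether the output wire of a given comparator circuit ends with value $1$. Let $\mathsf{PL}$ be the class of languages $L$ for which there is a probabilistic Turing machine that uses logarithmic work space, halts in polynomial time on every input and every sequence of coin flips, and accepts an input $x$ with probability greater than $1/2$ if and only if $x \in L$. Then $\textsc{Arrival}$ is both $\mathsf{CC}$-hard and $\mathsf{PL}$-hard under log-space many-one reductions: every language in $\mathsf{CC}$ and every language in $\mathsf{PL}$ is log-space many-one reducible to $\textsc{Arrival}$. -/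

import Mathlib

namespace LogSpace

/-! ### Space-bounded Turing machines -/

/-- What the head on the read-only input tape sees: an end marker or an input bit. -/
inductive InputSymbol
  | leftEnd
  | bit (b : Bool)
  | rightEnd

/-- Head movements. -/
inductive Move
  | left
  | stay
  | right

/-- The effect of one step: new state, movement of the input head, for every work tape the symbol
written and the movement of its head, and at most one bit written on the output tape. -/
structure Action (State Symbol : Type) (k : ℕ) where
  state : State
  moveInput : Move
  write : Fin k → Symbol
  moveWork : Fin k → Move
  emit : Option Bool

/-- A Turing machine with a two-way read-only input tape, finitely many read-write work tapes
(infinite to the right) and a one-way write-only output tape. In each step that it makes it consumes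
one element of `C`: for `C = Unit` the machine is deterministic, for `C = Bool` it flips a fair
coin in each step. The machine halts where `trans` is `none`. -/
structure Machine (C : Type) where
  State : Type
  finite_state : Finite State
  Symbol : Type
  finite_symbol : Finite Symbol
  blank : Symbol
  tapes : ℕ
  start : State
  accept : Set State
  trans : State → InputSymbol → (Fin tapes → Symbol) → Option (C → Action State Symbol tapes)

/-- The content of cell `p` of the input tape for input `x`: the left end marker in cell `0`, the
bits of `x` in cells `1, …, |x|`, then the right end marker. -/
def inputSymbol (x : List Bool) (p : ℕ) : InputSymbol :=
  if p = 0 then .leftEnd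
  else match x[p - 1]? with
    | some b => .bit b
    | none => .rightEnd

/-- A head movement on the cells `0, 1, 2, …`; in cell `0` a move to the left has no effect. -/
def Move.apply : Move → ℕ → ℕ
  | .left, p => p - 1
  | .stay, p => p
  | .right, p => p + 1

namespace Machine

variable {C : Type}

/-- Configurations of a machine. -/
structure Cfg (M : Machine C) where
  state : M.State
  inputPos : ℕ
  work : Fin M.tapes → ℕ → M.Symbol
  workPos : Fin M.tapes → ℕ
  output : List Bool

/-- The initial configuration. -/
def init (M : Machine C) : M.Cfg where
  state := M.start
  inputPos := 0
  work := fun _ _ => M.blank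
  workPos := fun _ => 0
  output := []

/-- The transition that applies in the configuration `q` on input `x`, if any. -/
def next (M : Machine C) (x : List Bool) (q : M.Cfg) :
    Option (C → Action M.State M.Symbol M.tapes) :=
  M.trans q.state (inputSymbol x q.inputPos) (fun i => q.work i (q.workPos i))

/-- The machine has halted in the configuration `q`. -/
def Halted (M : Machine C) (x : List Bool) (q : M.Cfg) : Prop :=
  M.next x q = none

/-- One step with choice `c`; a halted machine stays where it is. The input head never leaves the
part of the tape between the two end markers. -/
def step (M : Machine C) (x : List Bool) (q : M.Cfg) (c : C) : M.Cfg :=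
  match M.next x q with
  | none => q
  | some f =>
    { state := (f c).state
      inputPos := min ((f c).moveInput.apply q.inputPos) (x.length + 1)
      work := fun i => Function.update (q.work i) (q.workPos i) ((f c).write i)
      workPos := fun i => ((f c).moveWork i).apply (q.workPos i)
      output := q.output ++ (f c).emit.toList }

/-- The configuration on input `x` after `r.length` steps with the successive choices `r`. -/
def run (M : Machine C) (x : List Bool) (r : List C) : M.Cfg :=
  r.foldl (M.step x) M.init

/-- On inputs of length `n` the machine uses only `O(log n)` cells of its work tapes, whatever the
choices are. -/
def UsesLogSpace (M : Machine C) : Prop :=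
  ∃ c : ℕ, ∀ (x : List Bool) (r : List C) (i : Fin M.tapes),
    (M.run x r).workPos i ≤ c * (Nat.log 2 x.length + 1)

/-- With the choices `r` the machine halts on input `x` in an accepting state. -/
def Accepts (M : Machine C) (x : List Bool) (r : List C) : Prop :=
  M.Halted x (M.run x r) ∧ (M.run x r).state ∈ M.accept

/-- The probability that a coin-flipping machine accepts `x` within `T` steps. -/
noncomputable def acceptProb (M : Machine Bool) (x : List Bool) (T : ℕ) : ℚ :=
  (Set.ncard {r : Fin T → Bool | M.Accepts x (List.ofFn r)} : ℚ) / 2 ^ T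

end Machine

/-! ### Log-space reductions and complexity classes -/

/-- `f` is computed by a deterministic log-space Turing machine. -/
def LogSpaceComputable (f : List Bool → List Bool) : Prop :=
  ∃ M : Machine Unit, M.UsesLogSpace ∧
    ∀ x, ∃ r : List Unit, M.Halted x (M.run x r) ∧ (M.run x r).output = f x

/-- Log-space many-one reducibility. -/
def LogSpaceReducible (K L : Language Bool) : Prop :=
  ∃ f : List Bool → List Bool, LogSpaceComputable f ∧ ∀ x, x ∈ K ↔ f x ∈ L

/-- `L` is hard for the class `𝒞` under log-space many-one reductions. -/
def IsHardFor (𝒞 : Set (Language Bool)) (L : Language Bool) : Prop :=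
  ∀ K ∈ 𝒞, LogSpaceReducible K L

/-- The class `PL`: languages recognized with unbounded error by a probabilistic Turing machine
that works in logarithmic space and polynomial time. -/
def PL : Set (Language Bool) :=
  {L | ∃ (M : Machine Bool) (p : Polynomial ℕ), M.UsesLogSpace ∧
    ∀ x : List Bool,
      (∀ r : List Bool, r.length = p.eval x.length → M.Halted x (M.run x r)) ∧
      (x ∈ L ↔ 1 / 2 < M.acceptProb x (p.eval x.length))}

/-- A list of natural numbers as a bit string: each `a` becomes `a` ones followed by a zero.
In all uses below the numbers are indices into explicitly listed data, so that writing them in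
unary changes the length of an instance only polynomially, and the translation from and to
binary can be done in logarithmic space. -/
def encodeNats (l : List ℕ) : List Bool :=
  l.flatMap fun a => List.replicate a true ++ [false]

/-! ### Comparator circuits -/

/-- A comparator circuit on `m` wires with constant inputs and a designated output wire. Each gate
is placed on an ordered pair of wires, so that there is no fan-out. -/
structure ComparatorCircuit where
  m : ℕ
  input : Fin m → Bool
  gates : List (Fin m × Fin m)
  out : Fin m

namespace ComparatorCircuit

/-- The comparator gate on the wires `g.1` and `g.2` sends their values `(x, y)` to
`(x ∧ y, x ∨ y)`. (A gate on twice the same wire has no effect.) -/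
def applyGate {m : ℕ} (v : Fin m → Bool) (g : Fin m × Fin m) : Fin m → Bool :=
  fun w => if w = g.1 then v g.1 && v g.2 else if w = g.2 then v g.1 || v g.2 else v w

/-- The value on the output wire after all the gates, in the order of the list. -/
def value (K : ComparatorCircuit) : Bool :=
  K.gates.foldl applyGate K.input K.out

/-- The bit string describing a comparator circuit. -/
def encode (K : ComparatorCircuit) : List Bool :=
  encodeNats ([K.m, (K.out : ℕ)] ++ (List.ofFn K.input).map Bool.toNat ++
    K.gates.flatMap fun g => [(g.1 : ℕ), (g.2 : ℕ)])

end ComparatorCircuit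

/-- The comparator circuit value problem. -/
def comparatorCircuitValue : Language Bool :=
  {x | ∃ K : ComparatorCircuit, x = K.encode ∧ K.value = true}

/-- The class `CC`: problems that are log-space reducible to the evaluation of comparator
circuits. -/
def CC : Set (Language Bool) :=
  {L | LogSpaceReducible L comparatorCircuitValue}

/-! ### The Arrival problem -/

/-- A switch graph on the vertex set `V`. -/
structure SwitchGraph (V : Type) where
  s₀ : V → V
  s₁ : V → V

namespace SwitchGraph

variable {V : Type} [DecidableEq V]

/-- One move of the train, given its position and the states of all switches (`false` is state `0`,
`true` is state `1`): it follows the current switch of its vertex, which is then toggled. -/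
def move (G : SwitchGraph V) (q : V × (V → Bool)) : V × (V → Bool) :=
  (if q.2 q.1 then G.s₁ q.1 else G.s₀ q.1, Function.update q.2 q.1 (!q.2 q.1))

/-- The position of the train after `k` moves from `s`, where all switches start in state `0`. -/
def train (G : SwitchGraph V) (s : V) (k : ℕ) : V :=
  (G.move^[k] (s, fun _ => false)).1

/-- The train that starts at `s` reaches `t` at some time. -/
def Reaches (G : SwitchGraph V) (s t : V) : Prop :=
  ∃ k : ℕ, G.train s k = t

end SwitchGraph

/-- An instance of Arrival: a finite switch graph, a starting vertex and a destination vertex. -/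
structure ArrivalInstance where
  n : ℕ
  graph : SwitchGraph (Fin n)
  start : Fin n
  dest : Fin n

/-- The bit string describing an instance of Arrival. -/
def ArrivalInstance.encode (I : ArrivalInstance) : List Bool :=
  encodeNats ([I.n, (I.start : ℕ), (I.dest : ℕ)] ++
    (List.finRange I.n).flatMap fun v => [(I.graph.s₀ v : ℕ), (I.graph.s₁ v : ℕ)])

/-- The Arrival problem. -/
def arrival : Language Bool :=
  {x | ∃ I : ArrivalInstance, x = I.encode ∧ I.graph.Reaches I.start I.dest}

end LogSpace

namespace LogSpace

/-! ### Register programs -/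

/-! A vertex that the train leaves `N` times sends it `⌈N/2⌉` times along `s₀` and `⌊N/2⌋` times
along `s₁`, so a run is a flow. A finite certificate shows that `t` is reached
(`SwitchGraph.reaches_of_inflow_le`): if departure numbers `A` cover the start plus the inflow that
`A` itself produces at each vertex other than `t`, then a train that avoids `t` can never exceed
`A`, which bounds the length of its run. That `t` is not reached is shown by certifying that a
different absorbing vertex is reached.

Both hardness results use one gadget, `Network`. A launching chain sends the train `2 ^ d` times
through a layered graph in which every point halves its traffic. Accepting traversals, together with
a fixed number `extra` of trains that the chain feeds in directly, run into a chain of vertices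
acting as a binary counter, whose top is the destination; the launching chain ends in a dead end.
With `W = acc + extra`, counter vertex `i` is entered `⌊W / 2 ^ i⌋` times, and explicit departure
numbers (`Network.departures`) certify one of the two ends. Hence the destination is reached iff `2
^ d ≤ acc + extra` (`Network.reaches_iff`). The choice of `extra` makes this mean `acc ≥ 1` or `acc
> 2 ^ (d - 1)`.

For `PL`, the layers are time steps and the points are configurations of the probabilistic machine;
switches act as coins. As `d` exceeds the number of steps, all halvings are exact, and `acc` is
twice the number of accepting coin sequences (`Network.acc_eq_card`). The threshold `acc > 2 ^ (d -
1)` is then strict majority.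

For `CC`, the points include the wires. The first layers spread the `2 ^ d` traversals one to each
point; a selecting layer keeps those on wires with input 1 and discards the others. A comparator on
`(A, B)` is two layers: `A` empties into `B`, then `B` splits as ceiling to `B` and floor to `A`,
which on counts 0 and 1 is OR and AND (`Network.cnt_add_two_of_gate`). The output wire has value 1
iff `acc ≥ 1`.

It remains to compute these graphs in logarithmic space. Numeric functions computed by register
programs with polynomially bounded registers (`LS`) are closed under substitution and polynomially
bounded primitive recursion; with registers stored as binary counters such programs become log-space
Turing machines (`LogSpaceComputable.of_exec`). Conversely, configurations of a log-space machine
are polynomially bounded numbers with an `LS` step function (`Machine.ls_stepCode`). This makes the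
layers for `PL` computable, and for `CC` it gives access to the numbers in the output of a reduction
without storing that output (`LogSpaceComputable.ls_count_num`). -/

/-- Structured programs on registers holding natural numbers, with an input head and an output. -/
inductive Stmt
  | inc (r : ℕ)
  | move (d : Move)
  | emit (b : Bool)
  | seq (a b : Stmt)
  | loop (r : ℕ) (a : Stmt)
  | test (p : InputSymbol → Bool) (a b : Stmt)

/-- The memory of a register program. -/
structure Mem where
  reg : ℕ → ℕ
  pos : ℕ
  out : List Bool

/-- `Exec x N P m m'`: on input `x` the program `P` leads from `m` to `m'` and no register is
ever raised above `N`. The statement `loop r a` means: while `r ≠ 0`, decrement `r` and do `a`. -/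
inductive Exec (x : List Bool) (N : ℕ) : Stmt → Mem → Mem → Prop
  | inc {m r} : m.reg r + 1 ≤ N →
      Exec x N (.inc r) m { m with reg := Function.update m.reg r (m.reg r + 1) }
  | move {m d} : Exec x N (.move d) m { m with pos := min (d.apply m.pos) (x.length + 1) }
  | emit {m b} : Exec x N (.emit b) m { m with out := m.out ++ [b] }
  | seq {a b m m' m''} : Exec x N a m m' → Exec x N b m' m'' → Exec x N (.seq a b) m m''
  | loop_zero {r a m} : m.reg r = 0 → Exec x N (.loop r a) m m
  | loop_succ {r a k m m' m''} : m.reg r = k + 1 →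
      Exec x N a { m with reg := Function.update m.reg r k } m' →
      Exec x N (.loop r a) m' m'' → Exec x N (.loop r a) m m''
  | test_true {p a b m m'} : p (inputSymbol x m.pos) = true → Exec x N a m m' →
      Exec x N (.test p a b) m m'
  | test_false {p a b m m'} : p (inputSymbol x m.pos) = false → Exec x N b m m' →
      Exec x N (.test p a b) m m'

/-- Only `inc` raises a register, and its rule carries the bound. This is what later turns a space
bound for a program into a bound for the value it computes. -/
theorem Exec.reg_le {x N P m m'} (h : Exec x N P m m') (hm : ∀ r, m.reg r ≤ N) :
    ∀ r, m'.reg r ≤ N := by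
  induction h with
  | @inc m r h =>
    intro i
    by_cases hi : i = r
    · subst hi; simpa using h
    · simpa [hi] using hm i
  | move => exact hm
  | emit => exact hm
  | seq _ _ ih1 ih2 => exact ih2 (ih1 hm)
  | loop_zero _ => exact hm
  | @loop_succ r a k m m' m'' h _ _ ih1 ih2 =>
    refine ih2 (ih1 fun i => ?_)
    by_cases hi : i = r
    · subst hi; have := hm i; simp; omega
    · simpa [hi] using hm i
  | test_true _ _ ih => exact ih hm
  | test_false _ _ ih => exact ih hm

theorem Exec.pos_le {x N P m m'} (h : Exec x N P m m') (hm : m.pos ≤ x.length + 1) :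
    m'.pos ≤ x.length + 1 := by
  induction h with
  | inc => exact hm
  | move => exact min_le_right _ _
  | emit => exact hm
  | seq _ _ ih1 ih2 => exact ih2 (ih1 hm)
  | loop_zero _ => exact hm
  | loop_succ h _ _ ih1 ih2 => exact ih2 (ih1 hm)
  | test_true _ _ ih => exact ih hm
  | test_false _ _ ih => exact ih hm

/-! ### Compilation to code with jumps -/

/-- Instructions with absolute jump addresses. -/
inductive Instr
  | inc (r : ℕ)
  | dec (r l : ℕ)
  | jmp (l : ℕ)
  | move (d : Move)
  | emit (b : Bool)
  | test (p : InputSymbol → Bool) (l : ℕ)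

/-- The register that an instruction works on. -/
def Instr.reg : Instr → ℕ
  | .inc r => r
  | .dec r _ => r
  | _ => 0

/-- The number of instructions of the compiled program. -/
def Stmt.size : Stmt → ℕ
  | .inc _ => 1
  | .move _ => 1
  | .emit _ => 1
  | .seq a b => a.size + b.size
  | .loop _ a => a.size + 2
  | .test _ a b => a.size + b.size + 2

/-- The code of a program, when placed at the address `o`. -/
def Stmt.compile : Stmt → ℕ → List Instr
  | .inc r, _ => [.inc r]
  | .move d, _ => [.move d]
  | .emit b, _ => [.emit b]
  | .seq a b, o => a.compile o ++ b.compile (o + a.size)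
  | .loop r a, o => .dec r (o + a.size + 2) :: (a.compile (o + 1) ++ [.jmp o])
  | .test p a b, o => .test p (o + a.size + 2) ::
      (a.compile (o + 1) ++ .jmp (o + a.size + b.size + 2) :: b.compile (o + a.size + 2))

@[simp] theorem Stmt.length_compile (P : Stmt) (o : ℕ) : (P.compile o).length = P.size := by
  induction P generalizing o <;> simp_all [compile, size]; omega

/-- The list `l` stands in `code` at the address `o`. -/
def CodeAt (code : List Instr) (o : ℕ) (l : List Instr) : Prop :=
  ∀ i < l.length, code[o + i]? = l[i]?

theorem CodeAt.left {code o l l'} (h : CodeAt code o (l ++ l')) : CodeAt code o l := by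
  intro i hi
  rw [h i (by simp; omega), List.getElem?_append_left hi]

theorem CodeAt.right {code o l l'} (h : CodeAt code o (l ++ l')) :
    CodeAt code (o + l.length) l' := by
  intro i hi
  rw [add_assoc, h (l.length + i) (by simp; omega), List.getElem?_append_right (by omega)]
  simp

theorem CodeAt.head {code o a l} (h : CodeAt code o (a :: l)) : code[o]? = some a := by
  simpa using h 0 (by simp)

theorem CodeAt.tail {code o a l} (h : CodeAt code o (a :: l)) : CodeAt code (o + 1) l := by
  intro i hi
  have := h (i + 1) (by simpa using hi)
  rw [show o + 1 + i = o + (i + 1) by omega, this]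
  simp

/-! ### Binary counters -/

/-- Symbols on the work tapes: cell `0` carries a mark, digits follow, the least one first. -/
inductive Sym
  | blank
  | mark
  | digit (b : Bool)
  deriving Fintype

/-- The tape with the digits `ds`. -/
def tapeOf (ds : List Bool) : ℕ → Sym
  | 0 => .mark
  | p + 1 => match ds[p]? with
    | some b => .digit b
    | none => .blank

/-- The number with the digits `ds`. -/
def val : List Bool → ℕ
  | [] => 0
  | b :: ds => b.toNat + 2 * val ds

/-- The digits of the successor. -/
def incr : List Bool → List Bool
  | [] => [true]
  | false :: ds => true :: ds
  | true :: ds => false :: incr ds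

/-- The digits of the predecessor of a positive number. -/
def decr : List Bool → List Bool
  | [] => []
  | false :: ds => true :: decr ds
  | true :: ds => false :: ds

theorem val_incr (ds : List Bool) : val (incr ds) = val ds + 1 := by
  induction ds with
  | nil => rfl
  | cons b ds ih =>
    cases b
    · simp [incr, val]; omega
    · simp [incr, val, ih]; omega

theorem val_decr (ds : List Bool) (h : val ds ≠ 0) : val (decr ds) = val ds - 1 := by
  induction ds with
  | nil => rfl
  | cons b ds ih =>
    cases b
    · have : val ds ≠ 0 := by simpa [val] using h
      simp [decr, val, ih this]; omega
    · simp [decr, val]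

theorem length_decr (ds : List Bool) : (decr ds).length = ds.length := by
  induction ds with
  | nil => rfl
  | cons b ds ih => cases b <;> simp [decr, ih]

/-- A new digit appears only when all digits are 1, and then the successor is exactly `2 ^
ds.length`. So the tape is lengthened only as far as the size of the number requires. -/
theorem two_pow_length_incr (ds : List Bool) :
    2 ^ (incr ds).length ≤ max (2 ^ ds.length) (2 * (val ds + 1)) := by
  induction ds with
  | nil => simp [incr, val]
  | cons b ds ih =>
    cases b
    · simp [incr]
    · simp only [incr, List.length_cons, val, Bool.toNat_true, pow_succ]
      omega

/-- Decrementing keeps the length, so leading zeros occur and zero is represented by any block of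
zeros. -/
theorem eq_replicate_of_val_eq_zero (ds : List Bool) (h : val ds = 0) :
    ds = List.replicate ds.length false := by
  induction ds with
  | nil => rfl
  | cons b ds ih =>
    cases b
    · simp only [val, Bool.toNat_false] at h
      simp [List.replicate_succ, ← ih (by omega)]
    · simp [val] at h

theorem tapeOf_append (pre : List Bool) (b : Bool) (suf : List Bool) :
    tapeOf (pre ++ b :: suf) (pre.length + 1) = .digit b := by
  simp [tapeOf]

theorem tapeOf_length (ds : List Bool) : tapeOf ds (ds.length + 1) = .blank := by
  simp [tapeOf]

theorem tapeOf_le_length {ds : List Bool} {h : ℕ} (hh : h + 1 ≤ ds.length) :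
    ∃ b, tapeOf ds (h + 1) = .digit b := by
  simp [tapeOf, List.getElem?_eq_getElem (show h < ds.length by omega)]

theorem update_tapeOf (pre : List Bool) (b c : Bool) (suf : List Bool) :
    Function.update (tapeOf (pre ++ b :: suf)) (pre.length + 1) (.digit c) =
      tapeOf (pre ++ c :: suf) := by
  funext p
  rcases p with _ | p
  · simp [tapeOf]
  · by_cases hp : p = pre.length
    · subst hp; simp [tapeOf]
    · rw [Function.update_of_ne (by omega)]
      rcases lt_or_gt_of_ne hp with h | h
      · simp [tapeOf, List.getElem?_append_left h]
      · obtain ⟨j, rfl⟩ : ∃ j, p = pre.length + (j + 1) := ⟨p - pre.length - 1, by omega⟩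
        simp [tapeOf, List.getElem?_append_right]

theorem update_tapeOf_end (pre : List Bool) (c : Bool) :
    Function.update (tapeOf pre) (pre.length + 1) (.digit c) = tapeOf (pre ++ [c]) := by
  funext p
  rcases p with _ | p
  · simp [tapeOf]
  · by_cases hp : p = pre.length
    · subst hp; simp [tapeOf]
    · rw [Function.update_of_ne (by omega)]
      rcases lt_or_gt_of_ne hp with h | h
      · simp [tapeOf, List.getElem?_append_left h]
      · obtain ⟨j, rfl⟩ : ∃ j, p = pre.length + (j + 1) := ⟨p - pre.length - 1, by omega⟩
        simp [tapeOf]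

/-! ### The machine of a program -/

namespace Machine

/-- A run on input `x` whose work heads stay within the cells `0, …, B`. -/
inductive Reach (M : Machine Unit) (x : List Bool) (B : ℕ) : M.Cfg → M.Cfg → Prop
  | refl {q} : (∀ i, q.workPos i ≤ B) → Reach M x B q q
  | head {q q'} : (∀ i, q.workPos i ≤ B) → Reach M x B (M.step x q ()) q' → Reach M x B q q'

theorem Reach.trans {M : Machine Unit} {x B q q' q''} (h : Reach M x B q q')
    (h' : Reach M x B q' q'') : Reach M x B q q'' := by
  induction h with
  | refl _ => exact h'
  | head hq _ ih => exact .head hq (ih h')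

theorem Reach.exists_foldl {M : Machine Unit} {x B q q'} (h : Reach M x B q q') :
    ∃ r : List Unit, r.foldl (M.step x) q = q' := by
  induction h with
  | refl _ => exact ⟨[], rfl⟩
  | head _ _ ih => obtain ⟨r, hr⟩ := ih; exact ⟨() :: r, hr⟩

theorem foldl_step_of_halted {C : Type} {M : Machine C} {x q} (h : M.Halted x q) (r : List C) :
    r.foldl (M.step x) q = q := by
  induction r with
  | nil => rfl
  | cons c r ih =>
    have : M.step x q c = q := by
      unfold step; unfold Halted at h; rw [h]
    rw [List.foldl_cons, this, ih]

/-- There is only one choice per step, so any other run is an initial piece of this one or continues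
it in the halting configuration. -/
theorem Reach.workPos_le {M : Machine Unit} {x B q q'} (h : Reach M x B q q')
    (hq : M.Halted x q') (r : List Unit) (i) : (r.foldl (M.step x) q).workPos i ≤ B := by
  induction h generalizing r with
  | refl h => rw [foldl_step_of_halted hq]; exact h i
  | head h _ ih =>
    cases r with
    | nil => exact h i
    | cons c r => exact ih hq r

end Machine

/-- What the machine of a program is doing. -/
inductive Phase
  | init
  | ready
  | carry
  | back
  | borrow
  | restore

instance : Finite Phase :=
  Finite.of_surjective ![.init, .ready, .carry, .back, .borrow, .restore] fun p => by
    cases p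
    exacts [⟨0, rfl⟩, ⟨1, rfl⟩, ⟨2, rfl⟩, ⟨3, rfl⟩, ⟨4, rfl⟩, ⟨5, rfl⟩]

/-- States of the machine of a program: an address and a phase. -/
abbrev PCState (code : List Instr) : Type := Fin (code.length + 1) × Phase

/-- The state at a given address; all addresses outside of the code are identified. -/
def pcState (code : List Instr) (pc : ℕ) (ph : Phase) : PCState code :=
  (⟨min pc code.length, by omega⟩, ph)

section ProgramMachine

variable {S : Type} {K : ℕ}

/-- The symbol under the head of tape `r`. -/
def readTape (w : Fin K → Sym) (r : ℕ) : Sym :=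
  if h : r < K then w ⟨r, h⟩ else .blank

/-- An action on the work tape `r`. -/
def tapeAct (w : Fin K → Sym) (r : ℕ) (st : S) (a : Sym) (d : Move) : Action S Sym K where
  state := st
  moveInput := .stay
  write := fun i => if (i : ℕ) = r then a else w i
  moveWork := fun i => if (i : ℕ) = r then d else .stay
  emit := none

/-- An action that leaves the work tapes alone. -/
def ctrlAct (w : Fin K → Sym) (st : S) (d : Move) (e : Option Bool) : Action S Sym K where
  state := st
  moveInput := d
  write := w
  moveWork := fun _ => .stay
  emit := e

/-- The transitions of the machine of a program. -/
def delta (code : List Instr) (K : ℕ) (s : PCState code) (i : InputSymbol) (w : Fin K → Sym) :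
    Option (Action (PCState code) Sym K) :=
  match s.2, code[(s.1 : ℕ)]? with
  | .init, _ => some
      { state := (s.1, .ready), moveInput := .stay, write := fun _ => .mark
        moveWork := fun _ => .stay, emit := none }
  | .ready, some (.inc r) => some (tapeAct w r (s.1, .carry) (readTape w r) .right)
  | .ready, some (.dec r _) => some (tapeAct w r (s.1, .borrow) (readTape w r) .right)
  | .ready, some (.jmp l) => some (ctrlAct w (pcState code l .ready) .stay none)
  | .ready, some (.move d) => some (ctrlAct w (pcState code (s.1 + 1) .ready) d none)
  | .ready, some (.emit b) => some (ctrlAct w (pcState code (s.1 + 1) .ready) .stay (some b))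
  | .ready, some (.test p l) =>
      some (ctrlAct w (pcState code (if p i then s.1 + 1 else l) .ready) .stay none)
  | .carry, some (.inc r) => match readTape w r with
    | .digit true => some (tapeAct w r (s.1, .carry) (.digit false) .right)
    | _ => some (tapeAct w r (s.1, .back) (.digit true) .left)
  | .back, some ins => match readTape w ins.reg with
    | .mark => some (tapeAct w ins.reg (pcState code (s.1 + 1) .ready) .mark .stay)
    | a => some (tapeAct w ins.reg (s.1, .back) a .left)
  | .borrow, some (.dec r _) => match readTape w r with
    | .digit false => some (tapeAct w r (s.1, .borrow) (.digit true) .right)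
    | .digit true => some (tapeAct w r (s.1, .back) (.digit false) .left)
    | a => some (tapeAct w r (s.1, .restore) a .left)
  | .restore, some (.dec r l) => match readTape w r with
    | .mark => some (tapeAct w r (pcState code l .ready) .mark .stay)
    | _ => some (tapeAct w r (s.1, .restore) (.digit false) .left)
  | _, _ => none

/-- The machine of a program. -/
abbrev progMachine (code : List Instr) (K : ℕ) : Machine Unit where
  State := PCState code
  finite_state := inferInstance
  Symbol := Sym
  finite_symbol := inferInstance
  blank := .blank
  tapes := K
  start := pcState code 0 .init
  accept := ∅
  trans := fun s i w => (delta code K s i w).map fun a _ => a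

/-- The configuration with content `t` and head position `h` on tape `r`, while the other tapes
contain `W` and their heads are in cell `0`. -/
def tapeCfg (code : List Instr) (K : ℕ) (st : PCState code) (pos : ℕ) (out : List Bool)
    (W : Fin K → ℕ → Sym) (r : Fin K) (t : ℕ → Sym) (h : ℕ) : (progMachine code K).Cfg where
  state := st
  inputPos := pos
  work := Function.update W r t
  workPos := Function.update (fun _ => 0) r h
  output := out

variable {code : List Instr} {x : List Bool} {B pc pos : ℕ} {out : List Bool}
  {W : Fin K → ℕ → Sym} {r : Fin K}

@[simp] theorem getElem?_pcState (code : List Instr) (pc : ℕ) (ph : Phase) :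
    code[((pcState code pc ph).1 : ℕ)]? = code[pc]? := by
  simp only [pcState]
  rcases le_total pc code.length with h | h
  · rw [min_eq_left h]
  · rw [min_eq_right h, List.getElem?_eq_none h, List.getElem?_eq_none le_rfl]

@[simp] theorem snd_pcState (code : List Instr) (pc : ℕ) (ph : Phase) :
    (pcState code pc ph).2 = ph := rfl

@[simp] theorem fst_pcState_mk (code : List Instr) (pc : ℕ) (ph ph' : Phase) :
    ((pcState code pc ph).1, ph') = pcState code pc ph' := rfl

@[simp] theorem pcState_succ (code : List Instr) (pc : ℕ) (ph ph' : Phase) :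
    pcState code ((pcState code pc ph).1 + 1) ph' = pcState code (pc + 1) ph' := by
  simp only [pcState, Prod.mk.injEq, Fin.mk.injEq, and_true]
  omega

theorem step_tapeCfg {st st' : PCState code} {t : ℕ → Sym} {h : ℕ} {a : Sym} {d : Move}
    (hpos : pos ≤ x.length + 1)
    (hd : ∀ w : Fin K → Sym, readTape w r = t h →
      delta code K st (inputSymbol x pos) w = some (tapeAct w r st' a d)) :
    (progMachine code K).step x (tapeCfg code K st pos out W r t h) () =
      tapeCfg code K st' pos out W r (Function.update t h a) (d.apply h) := by
  have hn : (progMachine code K).next x (tapeCfg code K st pos out W r t h) =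
      some fun _ => tapeAct (fun i => (tapeCfg code K st pos out W r t h).work i
        ((tapeCfg code K st pos out W r t h).workPos i)) r st' a d :=
    congrArg (Option.map fun a _ => a) (hd _ (by simp [readTape, tapeCfg]))
  unfold Machine.step
  rw [hn]
  simp only [tapeCfg, tapeAct, Move.apply, Option.toList_none, List.append_nil,
    Machine.Cfg.mk.injEq, true_and, and_true]
  refine ⟨min_eq_left hpos, ?_, ?_⟩
  · funext i
    by_cases hi : i = r
    · subst hi; simp
    · have : (i : ℕ) ≠ r := fun h => hi (Fin.ext h)
      simp [hi, this]
  · funext i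
    by_cases hi : i = r
    · subst hi; simp
    · have : (i : ℕ) ≠ r := fun h => hi (Fin.ext h)
      simp [hi, this]

theorem workPos_tapeCfg {st : PCState code} {t : ℕ → Sym} {h : ℕ} (hB : h ≤ B) (i) :
    (tapeCfg code K st pos out W r t h).workPos i ≤ B := by
  change Function.update (fun _ => 0) r h i ≤ B
  by_cases hi : i = r
  · subst hi; simpa
  · simp [hi]

theorem reach_step {st st' : PCState code} {t : ℕ → Sym} {h : ℕ} (a : Sym) (d : Move)
    {q : (progMachine code K).Cfg} (hpos : pos ≤ x.length + 1) (hB : h ≤ B)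
    (hd : ∀ w : Fin K → Sym, readTape w r = t h →
      delta code K st (inputSymbol x pos) w = some (tapeAct w r st' a d))
    (hq : (progMachine code K).Reach x B
      (tapeCfg code K st' pos out W r (Function.update t h a) (d.apply h)) q) :
    (progMachine code K).Reach x B (tapeCfg code K st pos out W r t h) q :=
  .head (workPos_tapeCfg hB) (by rwa [step_tapeCfg hpos hd])

theorem reach_back (hpos : pos ≤ x.length + 1) {ins : Instr} (hc : code[pc]? = some ins)
    (hr : ins.reg = r) (ds : List Bool) (h : ℕ) (hl : h ≤ ds.length) (hB : h ≤ B) :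
    (progMachine code K).Reach x B
      (tapeCfg code K (pcState code pc .back) pos out W r (tapeOf ds) h)
      (tapeCfg code K (pcState code (pc + 1) .ready) pos out W r (tapeOf ds) 0) := by
  induction h with
  | zero =>
    refine reach_step (tapeOf ds 0) .stay hpos hB (fun w hw => ?_)
      (by rw [Function.update_eq_self]; exact .refl (workPos_tapeCfg (Nat.zero_le _)))
    have : delta code K (pcState code pc .back) (inputSymbol x pos) w =
      some (tapeAct w ins.reg (pcState code ((pcState code pc .back).1 + 1) .ready) .mark .stay) := by
      simp [delta, hc, hr, hw, tapeOf]
    rw [this, hr, pcState_succ]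
    rfl
  | succ h ih =>
    refine reach_step (tapeOf ds (h + 1)) .left hpos hB (fun w hw => ?_)
      (by rw [Function.update_eq_self]; exact ih (by omega) (by omega))
    obtain ⟨b, hb⟩ := tapeOf_le_length hl
    simp [delta, hc, hr, hw, hb]

/-- Induction on the digits `suf` not yet visited, while `pre` collects the zeros that the carry
leaves behind; past the last digit the blank is overwritten by 1. -/
theorem reach_carry (hpos : pos ≤ x.length + 1) (hc : code[pc]? = some (.inc r))
    (suf : List Bool) : ∀ pre : List Bool, (pre ++ incr suf).length ≤ B →
    ∃ h ≤ (pre ++ incr suf).length, (progMachine code K).Reach x B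
      (tapeCfg code K (pcState code pc .carry) pos out W r (tapeOf (pre ++ suf)) (pre.length + 1))
      (tapeCfg code K (pcState code pc .back) pos out W r (tapeOf (pre ++ incr suf)) h) := by
  induction suf with
  | nil =>
    intro pre hB
    refine ⟨pre.length, by simp, ?_⟩
    simp only [incr, List.length_append, List.length_singleton] at hB
    refine reach_step (.digit true) .left hpos hB (fun w hw => ?_)
      (by
        rw [List.append_nil, update_tapeOf_end]
        exact .refl (workPos_tapeCfg (by simp [Move.apply]; omega)))
    simp [delta, hc, hw, tapeOf_length]
  | cons b suf ih =>
    intro pre hB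
    cases b
    · refine ⟨pre.length, by simp, ?_⟩
      simp only [incr, List.length_append, List.length_cons] at hB
      refine reach_step (.digit true) .left hpos (by omega) (fun w hw => ?_)
        (by rw [update_tapeOf]; exact .refl (workPos_tapeCfg (by simp [Move.apply]; omega)))
      simp [delta, hc, hw, tapeOf_append]
    · have hB' : ((pre ++ [false]) ++ incr suf).length ≤ B := by
        simpa [incr, add_assoc, add_comm, add_left_comm] using hB
      obtain ⟨h, hh, hr⟩ := ih (pre ++ [false]) hB'
      refine ⟨h, by simpa [incr, add_assoc, add_comm, add_left_comm] using hh, ?_⟩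
      simp only [incr, List.length_append, List.length_cons] at hB
      refine reach_step (.digit false) .right hpos (by omega) (fun w hw => ?_)
        (st' := pcState code pc .carry) ?_
      · simp [delta, hc, hw, tapeOf_append]
      · rw [update_tapeOf]
        simpa [incr, Move.apply] using hr

theorem reach_borrow (hpos : pos ≤ x.length + 1) {l : ℕ} (hc : code[pc]? = some (.dec r l))
    (suf : List Bool) (hs : val suf ≠ 0) : ∀ pre : List Bool, (pre ++ suf).length ≤ B →
    ∃ h ≤ (pre ++ suf).length, (progMachine code K).Reach x B
      (tapeCfg code K (pcState code pc .borrow) pos out W r (tapeOf (pre ++ suf)) (pre.length + 1))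
      (tapeCfg code K (pcState code pc .back) pos out W r (tapeOf (pre ++ decr suf)) h) := by
  induction suf with
  | nil => simp [val] at hs
  | cons b suf ih =>
    intro pre hB
    simp only [List.length_append, List.length_cons] at hB
    cases b
    · have hs' : val suf ≠ 0 := by simpa [val] using hs
      obtain ⟨h, hh, hr⟩ := ih hs' (pre ++ [true]) (by simp; omega)
      refine ⟨h, by simpa [add_assoc, add_comm, add_left_comm] using hh, ?_⟩
      refine reach_step (.digit true) .right hpos (by omega) (fun w hw => ?_)
        (st' := pcState code pc .borrow) ?_
      · simp [delta, hc, hw, tapeOf_append]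
      · rw [update_tapeOf]
        simpa [decr, Move.apply] using hr
    · refine ⟨pre.length, by simp, ?_⟩
      refine reach_step (.digit false) .left hpos (by omega) (fun w hw => ?_)
        (by rw [update_tapeOf]; exact .refl (workPos_tapeCfg (by simp [Move.apply]; omega)))
      simp [delta, hc, hw, tapeOf_append]

/-- On the number zero the borrow runs through all digits, turns them into ones and is detected only
at the blank behind them. The strict bound leaves room for that blank cell; `reach_restore` then
undoes the damage on the way back. -/
theorem reach_borrow_zero (hpos : pos ≤ x.length + 1) {l : ℕ}
    (hc : code[pc]? = some (.dec r l)) (k : ℕ) : ∀ j : ℕ, j + k < B →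
    (progMachine code K).Reach x B
      (tapeCfg code K (pcState code pc .borrow) pos out W r
        (tapeOf (List.replicate j true ++ List.replicate k false)) (j + 1))
      (tapeCfg code K (pcState code pc .restore) pos out W r
        (tapeOf (List.replicate (j + k) true)) (j + k)) := by
  induction k with
  | zero =>
    intro j hB
    refine reach_step .blank .left hpos (by omega) (fun w hw => ?_)
      (st' := pcState code pc .restore) ?_
    · have : tapeOf (List.replicate j true ++ List.replicate 0 false) (j + 1) = .blank := by
        simp [tapeOf]
      rw [this] at hw
      simp [delta, hc, hw]
    · have : Function.update (tapeOf (List.replicate j true ++ List.replicate 0 false)) (j + 1)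
          Sym.blank = tapeOf (List.replicate (j + 0) true) := by
        funext p
        rcases p with _ | p
        · simp [tapeOf]
        · by_cases hp : p = j
          · subst hp; simp [tapeOf]
          · simp [hp]
      rw [this]
      exact .refl (workPos_tapeCfg (by simp [Move.apply]; omega))
  | succ k ih =>
    intro j hB
    refine reach_step (.digit true) .right hpos (by omega) (fun w hw => ?_)
      (st' := pcState code pc .borrow) ?_
    · have h1 := tapeOf_append (List.replicate j true) false (List.replicate k false)
      rw [List.length_replicate] at h1
      rw [List.replicate_succ, h1] at hw
      simp [delta, hc, hw]
    · have h1 := update_tapeOf (List.replicate j true) false true (List.replicate k false)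
      rw [List.length_replicate] at h1
      rw [List.replicate_succ, h1]
      have h2 := ih (j + 1) (by omega)
      rw [List.replicate_succ', List.append_assoc, show j + 1 + k = j + (k + 1) by omega] at h2
      exact h2

theorem reach_restore (hpos : pos ≤ x.length + 1) {l : ℕ}
    (hc : code[pc]? = some (.dec r l)) (k : ℕ) : ∀ j : ℕ, k ≤ B →
    (progMachine code K).Reach x B
      (tapeCfg code K (pcState code pc .restore) pos out W r
        (tapeOf (List.replicate k true ++ List.replicate j false)) k)
      (tapeCfg code K (pcState code l .ready) pos out W r
        (tapeOf (List.replicate (k + j) false)) 0) := by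
  induction k with
  | zero =>
    intro j hB
    refine reach_step .mark .stay hpos hB (fun w hw => ?_)
      (st' := pcState code l .ready) ?_
    · simp [delta, hc, hw, tapeOf]
    · have : Function.update (tapeOf (List.replicate 0 true ++ List.replicate j false)) 0
          Sym.mark = tapeOf (List.replicate (0 + j) false) := by
        funext p
        rcases p with _ | p
        · simp [tapeOf]
        · simp
      rw [this]
      exact .refl (workPos_tapeCfg (by simp [Move.apply]))
  | succ k ih =>
    intro j hB
    have h1 := tapeOf_append (List.replicate k true) true (List.replicate j false)
    have h2 := update_tapeOf (List.replicate k true) true false (List.replicate j false)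
    rw [List.length_replicate] at h1 h2
    rw [List.replicate_succ', List.append_assoc]
    refine reach_step (.digit false) .left hpos hB (fun w hw => ?_)
      (st' := pcState code pc .restore) ?_
    · simp [delta, hc, hw, h1]
    · rw [List.singleton_append, h2]
      have h3 := ih (j + 1) (by omega)
      rw [show k + (j + 1) = k + 1 + j by omega] at h3
      exact h3

end ProgramMachine


/-- The configuration `q` of the machine represents the memory `m` at the address `pc`. -/
structure Rep (code : List Instr) (K N pc : ℕ) (m : Mem) (q : (progMachine code K).Cfg) :
    Prop where
  state : q.state = pcState code pc .ready
  pos : q.inputPos = m.pos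
  out : q.output = m.out
  workPos : ∀ i, q.workPos i = 0
  tape : ∀ i : Fin K, ∃ ds, q.work i = tapeOf ds ∧ val ds = m.reg i ∧ 2 ^ ds.length ≤ 2 * N

/-! ### Simulation of register programs by the Turing machine -/

section

variable {code : List Instr} {x : List Bool} {K N pc : ℕ} {m : Mem} {q : (progMachine code K).Cfg}

theorem Rep.eq_tapeCfg (h : Rep code K N pc m q) (r : Fin K) {ds : List Bool}
    (hds : q.work r = tapeOf ds) :
    q = tapeCfg code K (pcState code pc .ready) m.pos m.out q.work r (tapeOf ds) 0 := by
  obtain ⟨h1, h2, h3, h4, -⟩ := h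
  rcases q with ⟨s, p, w, wp, o⟩
  dsimp only at *
  have : wp = fun _ => 0 := funext h4
  subst h1 h2 h3 this
  simp only [tapeCfg, ← hds, Function.update_eq_self]

theorem Rep.reach_of (h : Rep code K N pc m q) (r : Fin K) {ds : List Bool} {B : ℕ}
    {q' : (progMachine code K).Cfg} (hds : q.work r = tapeOf ds)
    (hr : (progMachine code K).Reach x B (tapeCfg code K (pcState code pc .ready) m.pos m.out
      q.work r (tapeOf ds) 0) q') : (progMachine code K).Reach x B q q' := by
  rw [h.eq_tapeCfg r hds]
  exact hr

theorem Rep.update (h : Rep code K N pc m q) (r : Fin K) {ds : List Bool} {v pc' : ℕ}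
    (hv : val ds = v) (hl : 2 ^ ds.length ≤ 2 * N) :
    Rep code K N pc' { m with reg := Function.update m.reg r v }
      (tapeCfg code K (pcState code pc' .ready) m.pos m.out q.work r (tapeOf ds) 0) where
  state := rfl
  pos := rfl
  out := rfl
  workPos i := by
    change Function.update (fun _ => 0) r 0 i = 0
    by_cases hi : i = r
    · subst hi; simp
    · simp [hi]
  tape i := by
    change ∃ ds', Function.update q.work r (tapeOf ds) i = tapeOf ds' ∧ _
    by_cases hi : i = r
    · subst hi; exact ⟨ds, by simpa using ⟨hv, hl⟩⟩
    · have : (i : ℕ) ≠ r := fun h => hi (Fin.ext h)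
      simpa [hi, this] using h.tape i

/-- A bound for the positions of the work heads. -/
def headBound (N : ℕ) : ℕ := Nat.log 2 (2 * N) + 1

theorem length_lt_headBound {l : ℕ} (h : 2 ^ l ≤ 2 * N) : l < headBound N :=
  Nat.lt_succ_of_le (Nat.le_log_of_pow_le one_lt_two h)

/-- The counter is traversed as mark, carry, way back to the mark. The bound `2 * N` on `2 ^ length`
survives because the new value is at most `N`. -/
theorem Rep.inc (h : Rep code K N pc m q) (hp : m.pos ≤ x.length + 1) {r : ℕ}
    (hr : r < K) (hc : code[pc]? = some (.inc r)) (hm : m.reg r + 1 ≤ N) :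
    ∃ q', (progMachine code K).Reach x (headBound N) q q' ∧
      Rep code K N (pc + 1) { m with reg := Function.update m.reg r (m.reg r + 1) } q' := by
  lift r to Fin K using hr
  obtain ⟨ds, hds, hv, hl⟩ := h.tape r
  have hl' : 2 ^ (incr ds).length ≤ 2 * N :=
    (two_pow_length_incr ds).trans (max_le hl (by rw [hv]; omega))
  have hB := length_lt_headBound hl'
  refine ⟨_, ?_, h.update r ((val_incr ds).trans (by rw [hv])) hl'⟩
  refine h.reach_of r hds ?_
  obtain ⟨k, hk, hreach⟩ := reach_carry (x := x) (B := headBound N) (pos := m.pos) (out := m.out)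
    (W := q.work) hp hc ds [] (by simpa using hB.le)
  simp only [List.nil_append, List.length_nil] at hreach hk
  refine reach_step (tapeOf ds 0) .right (st' := pcState code pc .carry) hp (Nat.zero_le _)
    (fun w hw => by simp [delta, hc, hw]) ?_
  rw [Function.update_eq_self]
  exact hreach.trans (reach_back hp hc rfl _ _ hk (hk.trans hB.le))

theorem Rep.dec_succ (h : Rep code K N pc m q) (hp : m.pos ≤ x.length + 1) {r l : ℕ}
    (hr : r < K) (hc : code[pc]? = some (.dec r l)) {k : ℕ} (hm : m.reg r = k + 1) :
    ∃ q', (progMachine code K).Reach x (headBound N) q q' ∧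
      Rep code K N (pc + 1) { m with reg := Function.update m.reg r k } q' := by
  lift r to Fin K using hr
  obtain ⟨ds, hds, hv, hl⟩ := h.tape r
  have hB := length_lt_headBound hl
  have h0 : val ds ≠ 0 := by omega
  refine ⟨_, ?_, h.update r ((val_decr ds h0).trans (by rw [hv, hm]; rfl))
    (by rwa [length_decr])⟩
  refine h.reach_of r hds ?_
  obtain ⟨j, hj, hreach⟩ := reach_borrow (x := x) (B := headBound N) (pos := m.pos)
    (out := m.out) (W := q.work) hp hc ds h0 [] (by simpa using hB.le)
  simp only [List.nil_append, List.length_nil] at hreach hj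
  refine reach_step (tapeOf ds 0) .right (st' := pcState code pc .borrow) hp (Nat.zero_le _)
    (fun w hw => by simp [delta, hc, hw]) ?_
  rw [Function.update_eq_self]
  exact hreach.trans (reach_back hp hc rfl _ _ (by rwa [length_decr]) (hj.trans hB.le))

theorem Rep.dec_zero (h : Rep code K N pc m q) (hp : m.pos ≤ x.length + 1) {r l : ℕ}
    (hr : r < K) (hc : code[pc]? = some (.dec r l)) (hm : m.reg r = 0) :
    ∃ q', (progMachine code K).Reach x (headBound N) q q' ∧ Rep code K N l m q' := by
  lift r to Fin K using hr
  obtain ⟨ds, hds, hv, hl⟩ := h.tape r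
  have hB := length_lt_headBound hl
  have h0 := eq_replicate_of_val_eq_zero ds (by omega)
  have hm' : { m with reg := Function.update m.reg r 0 } = m := by
    rw [← hm, Function.update_eq_self]
  refine ⟨_, ?_, hm' ▸ h.update r (hv.trans hm) hl⟩
  refine h.reach_of r hds ?_
  have h1 := reach_borrow_zero (x := x) (B := headBound N) (pos := m.pos) (out := m.out)
    (W := q.work) hp hc ds.length 0 (by simpa using hB)
  have h2 := reach_restore (x := x) (B := headBound N) (pos := m.pos) (out := m.out)
    (W := q.work) hp hc ds.length 0 hB.le
  simp only [List.replicate_zero, List.nil_append, List.append_nil, zero_add, add_zero, ← h0]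
    at h1 h2
  refine reach_step (tapeOf ds 0) .right (st' := pcState code pc .borrow) hp (Nat.zero_le _)
    (fun w hw => by simp [delta, hc, hw]) ?_
  rw [Function.update_eq_self]
  exact h1.trans h2

theorem Rep.ctrl (h : Rep code K N pc m q) {pc' : ℕ} {d : Move} {e : Option Bool}
    (hd : ∀ w, delta code K (pcState code pc .ready) (inputSymbol x m.pos) w =
      some (ctrlAct w (pcState code pc' .ready) d e)) :
    ∃ q', (progMachine code K).Reach x (headBound N) q q' ∧
      Rep code K N pc' { m with pos := min (d.apply m.pos) (x.length + 1)
                                out := m.out ++ e.toList } q' := by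
  have hn : (progMachine code K).next x q =
      some fun _ => ctrlAct (fun i => q.work i (q.workPos i)) (pcState code pc' .ready) d e := by
    unfold Machine.next
    rw [h.state, h.pos]
    exact congrArg (Option.map fun a _ => a) (hd _)
  have hw : ∀ i, q.workPos i ≤ headBound N := fun i => by rw [h.workPos i]; exact Nat.zero_le _
  have hs : (progMachine code K).step x q () =
      { q with state := pcState code pc' .ready
               inputPos := min (d.apply m.pos) (x.length + 1)
               output := m.out ++ e.toList } := by
    unfold Machine.step
    rw [hn]
    simp [ctrlAct, h.pos, h.out, Move.apply]
  refine ⟨_, .head hw (.refl ?_), ?_⟩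
  · rw [hs]; exact hw
  · rw [hs]; exact ⟨rfl, rfl, rfl, h.workPos, h.tape⟩

/-- All registers of the code are among the first `K`. -/
def RegsLT (code : List Instr) (K : ℕ) : Prop := ∀ i ∈ code, i.reg < K

theorem RegsLT.reg_lt (hK : RegsLT code K) {i : Instr} (hc : code[pc]? = some i) : i.reg < K :=
  hK _ (List.mem_of_getElem? hc)

/-- Induction on the execution rather than on the program: after one round of a loop the jump
returns to the same address `o`, where the hypothesis for the remaining rounds applies. -/
theorem Exec.simulate (hK : RegsLT code K) {P : Stmt} {m m' : Mem}
    (he : Exec x N P m m') : ∀ (o : ℕ) (q : (progMachine code K).Cfg),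
    CodeAt code o (P.compile o) → m.pos ≤ x.length + 1 → Rep code K N o m q →
    ∃ q', (progMachine code K).Reach x (headBound N) q q' ∧
      Rep code K N (o + P.size) m' q' := by
  induction he with
  | inc h =>
    intro o q hc hp hq
    have hc := hc.head
    exact hq.inc hp (hK.reg_lt hc) hc h
  | move =>
    intro o q hc hp hq
    have hc := hc.head
    have := hq.ctrl (x := x) (fun w => by simp [delta, hc]; rfl)
    simpa [Stmt.size] using this
  | emit =>
    intro o q hc hp hq
    have hc := hc.head
    have := hq.ctrl (x := x) (fun w => by simp [delta, hc]; rfl)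
    simpa [Move.apply, hp, Stmt.size] using this
  | @seq a b m m' m'' h1 h2 ih1 ih2 =>
    intro o q hc hp hq
    obtain ⟨q1, hr1, hq1⟩ := ih1 o q hc.left hp hq
    obtain ⟨q2, hr2, hq2⟩ := ih2 _ q1 (by simpa using hc.right) (h1.pos_le hp) hq1
    exact ⟨q2, hr1.trans hr2, by simpa [Stmt.size, add_assoc] using hq2⟩
  | @loop_zero r a m h =>
    intro o q hc hp hq
    have hc0 := hc.head
    obtain ⟨q', hr, hq'⟩ := hq.dec_zero hp (hK.reg_lt hc0) hc0 h
    exact ⟨q', hr, by simpa [Stmt.size, add_assoc] using hq'⟩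
  | @loop_succ r a k m m' m'' h h1 h2 ih1 ih2 =>
    intro o q hc hp hq
    have hc0 := hc.head
    obtain ⟨q1, hr1, hq1⟩ := hq.dec_succ hp (hK.reg_lt hc0) hc0 h
    obtain ⟨q2, hr2, hq2⟩ := ih1 (o + 1) q1 hc.tail.left hp hq1
    have hc2 := hc.tail.right.head
    rw [Stmt.length_compile] at hc2
    have hp' := h1.pos_le hp
    obtain ⟨q3, hr3, hq3⟩ := hq2.ctrl (x := x) (fun w => by simp [delta, hc2]; rfl)
    have hm : ({ m' with pos := min (Move.stay.apply m'.pos) (x.length + 1)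
                         out := m'.out ++ (none : Option Bool).toList } : Mem) = m' := by
      simp [Move.apply, hp']
    rw [hm] at hq3
    obtain ⟨q4, hr4, hq4⟩ := ih2 o q3 hc hp' hq3
    exact ⟨q4, hr1.trans (hr2.trans (hr3.trans hr4)), hq4⟩
  | @test_true p a b m m' h h1 ih =>
    intro o q hc hp hq
    have hc0 := hc.head
    obtain ⟨q1, hr1, hq1⟩ := hq.ctrl (x := x) (pc' := o + 1) (d := .stay) (e := none)
      (fun w => by simp [delta, hc0, h])
    have hm : ({ m with pos := min (Move.stay.apply m.pos) (x.length + 1)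
                        out := m.out ++ (none : Option Bool).toList } : Mem) = m := by
      simp [Move.apply, hp]
    rw [hm] at hq1
    obtain ⟨q2, hr2, hq2⟩ := ih (o + 1) q1 hc.tail.left hp hq1
    have hc2 := hc.tail.right.head
    rw [Stmt.length_compile] at hc2
    obtain ⟨q3, hr3, hq3⟩ := hq2.ctrl (x := x) (fun w => by simp [delta, hc2]; rfl)
    refine ⟨q3, hr1.trans (hr2.trans hr3), ?_⟩
    have hp' := h1.pos_le hp
    simpa [Move.apply, hp', Stmt.size, add_assoc] using hq3
  | @test_false p a b m m' h h1 ih =>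
    intro o q hc hp hq
    have hc0 := hc.head
    obtain ⟨q1, hr1, hq1⟩ := hq.ctrl (x := x) (pc' := o + a.size + 2) (d := .stay) (e := none)
      (fun w => by simp [delta, hc0, h])
    have hm : ({ m with pos := min (Move.stay.apply m.pos) (x.length + 1)
                        out := m.out ++ (none : Option Bool).toList } : Mem) = m := by
      simp [Move.apply, hp]
    rw [hm] at hq1
    have hc2 := hc.tail.right.tail
    rw [Stmt.length_compile, show o + 1 + a.size + 1 = o + a.size + 2 by omega] at hc2
    obtain ⟨q2, hr2, hq2⟩ := ih _ q1 hc2 hp hq1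
    refine ⟨q2, hr1.trans hr2, ?_⟩
    rw [show o + (Stmt.test p a b).size = o + a.size + 2 + b.size by simp [Stmt.size]; omega]
    exact hq2

end

/-- A function is log-space computable if it is computed by a program whose registers are
polynomially bounded. -/
theorem LogSpaceComputable.of_exec {f : List Bool → List Bool} (P : Stmt) (c : ℕ)
    (h : ∀ x, ∃ m, Exec x ((x.length + 2) ^ c) P ⟨fun _ => 0, 0, []⟩ m ∧ m.out = f x) :
    LogSpaceComputable f := by
  let code := P.compile 0
  let K := (code.map Instr.reg).sum + 1
  have hK : RegsLT code K := fun i hi =>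
    Nat.lt_succ_of_le (List.le_sum_of_mem (List.mem_map_of_mem hi))
  have key : ∀ x, ∃ q, (progMachine code K).Reach x (headBound ((x.length + 2) ^ c))
      (progMachine code K).init q ∧ (progMachine code K).Halted x q ∧ q.output = f x := by
    intro x
    obtain ⟨m, hm, hf⟩ := h x
    have hN : 0 < (x.length + 2) ^ c := by positivity
    -- The first step writes the marks into cell 0 of all tapes, which turns blank tapes into
    -- counters with an empty list of digits.
    have hn : (progMachine code K).next x (progMachine code K).init =
        some fun _ => { state := pcState code 0 .ready, moveInput := .stay,
                        write := fun _ => Sym.mark, moveWork := fun _ => .stay, emit := none } := by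
      unfold Machine.next
      simp [Machine.init, delta]
    have hrep : Rep code K ((x.length + 2) ^ c) 0 ⟨fun _ => 0, 0, []⟩
        ((progMachine code K).step x (progMachine code K).init ()) := by
      unfold Machine.step
      rw [hn]
      refine ⟨rfl, ?_, rfl, fun _ => rfl, fun i => ⟨[], ?_, rfl, ?_⟩⟩
      · simp [Machine.init, Move.apply]
      · funext p
        rcases p with _ | p <;> simp [Machine.init, tapeOf]
      · simp only [List.length_nil, pow_zero]; omega
    obtain ⟨q, hr, hq⟩ := hm.simulate hK 0 _ (fun i _ => by rw [zero_add]) (Nat.zero_le _) hrep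
    refine ⟨q, .head (fun _ => Nat.zero_le _) hr, ?_, hq.out.trans hf⟩
    unfold Machine.Halted Machine.next
    rw [hq.state]
    -- The simulation ends at the first address behind the code, where no transition applies.
    have : code[0 + P.size]? = none := by simp [code]
    rw [zero_add] at this
    simp only [Option.map_eq_none_iff]
    simp [delta, this]
  -- The heads stay within `log (2 * (n + 2) ^ c) + 1`, and `n + 2 ≤ 2 ^ (log n + 2)` bounds this by
  -- `c * log n + 2 * c + 2`.
  refine ⟨progMachine code K, ⟨2 * c + 2, fun x r i => ?_⟩, fun x => ?_⟩
  · obtain ⟨q, hr, hq, -⟩ := key x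
    refine (hr.workPos_le hq r i).trans ?_
    have h1 : x.length + 2 ≤ 2 ^ (Nat.log 2 x.length + 2) := by
      have := Nat.lt_pow_succ_log_self one_lt_two x.length
      have h2 : 1 ≤ 2 ^ (Nat.log 2 x.length) := Nat.one_le_two_pow
      simp only [Nat.succ_eq_add_one, pow_succ] at this ⊢
      omega
    have h2 : 2 * (x.length + 2) ^ c ≤ 2 ^ (1 + (Nat.log 2 x.length + 2) * c) := by
      rw [pow_add, pow_one, pow_mul]
      exact Nat.mul_le_mul_left 2 (Nat.pow_le_pow_left h1 c)
    have h3 := Nat.log_mono_right (b := 2) h2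
    rw [Nat.log_pow one_lt_two] at h3
    unfold headBound
    nlinarith [Nat.zero_le (Nat.log 2 x.length), Nat.zero_le c,
      Nat.zero_le (Nat.log 2 x.length * c)]
  · obtain ⟨q, hr, hq, ho⟩ := key x
    obtain ⟨r, hr⟩ := hr.exists_foldl
    exact ⟨r, by unfold Machine.run; rwa [hr], by unfold Machine.run; rwa [hr]⟩


/-! ### Polynomially bounded functions -/

/-- Types whose elements consist of an input string and finitely many numbers. -/
class Ctx (α : Type) where
  arity : ℕ
  inp : α → List Bool
  var : α → Fin arity → ℕ

instance : Ctx (List Bool) := ⟨0, id, fun _ => Fin.elim0⟩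

instance {α : Type} [Ctx α] : Ctx (α × ℕ) :=
  ⟨Ctx.arity α + 1, fun p => Ctx.inp p.1, fun p => Fin.cons p.2 (Ctx.var p.1)⟩

section

variable {α : Type} [Ctx α]

/-- The size of an input together with some numbers. -/
def sz (a : α) : ℕ := (Ctx.inp a).length + ∑ i, Ctx.var a i

@[simp] theorem sz_list (x : List Bool) : sz x = x.length := by
  simp [sz, Ctx.inp, Ctx.arity]

@[simp] theorem sz_prod (p : α × ℕ) : sz p = sz p.1 + p.2 := by
  have : ∑ i, Ctx.var p i = p.2 + ∑ i, Ctx.var p.1 i := Fin.sum_univ_succ _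
  rw [sz, this, sz]
  change (Ctx.inp p.1).length + _ = _
  ring

theorem var_le_sz (a : α) (i) : Ctx.var a i ≤ sz a :=
  (Finset.single_le_sum (f := Ctx.var a) (fun _ _ => Nat.zero_le _) (Finset.mem_univ i)).trans
    (Nat.le_add_left _ _)

/-- `f` is bounded by a polynomial in the size. -/
def PolyBdd (f : α → ℕ) : Prop := ∃ c, ∀ a, f a ≤ (sz a + 2) ^ c

namespace PolyBdd

theorem mono {f g : α → ℕ} (hg : PolyBdd g) (h : ∀ a, f a ≤ g a) : PolyBdd f := by
  obtain ⟨c, hc⟩ := hg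
  exact ⟨c, fun a => (h a).trans (hc a)⟩

theorem const (n : ℕ) : PolyBdd (fun _ : α => n) :=
  ⟨n, fun a => (Nat.lt_two_pow_self).le.trans (Nat.pow_le_pow_left (by omega) n)⟩

theorem sz : PolyBdd (fun a : α => sz a) := ⟨1, fun a => by simp⟩

theorem mul {f g : α → ℕ} (hf : PolyBdd f) (hg : PolyBdd g) : PolyBdd (fun a => f a * g a) := by
  obtain ⟨c, hc⟩ := hf
  obtain ⟨d, hd⟩ := hg
  exact ⟨c + d, fun a => by rw [pow_add]; exact Nat.mul_le_mul (hc a) (hd a)⟩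

theorem add {f g : α → ℕ} (hf : PolyBdd f) (hg : PolyBdd g) : PolyBdd (fun a => f a + g a) := by
  obtain ⟨c, hc⟩ := hf
  obtain ⟨d, hd⟩ := hg
  refine ⟨c + d + 1, fun a => ?_⟩
  have h1 : (LogSpace.sz a + 2) ^ c ≤ (LogSpace.sz a + 2) ^ (c + d) :=
    Nat.pow_le_pow_right (by omega) (by omega)
  have h2 : (LogSpace.sz a + 2) ^ d ≤ (LogSpace.sz a + 2) ^ (c + d) :=
    Nat.pow_le_pow_right (by omega) (by omega)
  calc f a + g a ≤ (LogSpace.sz a + 2) ^ (c + d) * 2 := by have := hc a; have := hd a; omega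
    _ ≤ _ := by rw [pow_succ]; exact Nat.mul_le_mul_left _ (by omega)

theorem pow {f : α → ℕ} (hf : PolyBdd f) (n : ℕ) : PolyBdd (fun a => f a ^ n) := by
  obtain ⟨c, hc⟩ := hf
  exact ⟨c * n, fun a => by rw [pow_mul]; exact Nat.pow_le_pow_left (hc a) n⟩

theorem fst {f : α → ℕ} (hf : PolyBdd f) : PolyBdd (fun p : α × ℕ => f p.1) := by
  obtain ⟨c, hc⟩ := hf
  exact ⟨c, fun p => (hc p.1).trans (Nat.pow_le_pow_left (by simp) c)⟩

/-- The size of `(a, g a)` is `sz a + g a`, so polynomial bounds compose. -/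
theorem comp {f : α × ℕ → ℕ} {g : α → ℕ} (hf : PolyBdd f) (hg : PolyBdd g) :
    PolyBdd (fun a => f (a, g a)) := by
  obtain ⟨c, hc⟩ := hf
  refine (((PolyBdd.sz.add hg).add (const 2)).pow c).mono fun a => ?_
  simpa using hc (a, g a)

end PolyBdd

/-! ### Programs for clearing and copying registers -/

/-- Set a register to zero. -/
def Stmt.clear (r : ℕ) : Stmt := .loop r (.move .stay)

/-- Move the value of a register to another one. -/
def Stmt.transfer (r d : ℕ) : Stmt := .seq (.clear d) (.loop r (.inc d))

/-- Copy the value of a register to another one, with the auxiliary register `t`. -/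
def Stmt.copy (r d t : ℕ) : Stmt :=
  .seq (.clear d) (.seq (.clear t) (.seq (.loop r (.seq (.inc d) (.inc t))) (.loop t (.inc r))))

variable {x : List Bool} {N : ℕ} {p : ℕ} {o : List Bool}

theorem exec_clear (hp : p ≤ x.length + 1) (r : ℕ) (g : ℕ → ℕ) :
    Exec x N (.clear r) ⟨g, p, o⟩ ⟨Function.update g r 0, p, o⟩ := by
  obtain ⟨k, hk⟩ : ∃ k, g r = k := ⟨_, rfl⟩
  induction k generalizing g with
  | zero => rw [← hk, Function.update_eq_self]; exact .loop_zero hk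
  | succ k ih =>
    refine .loop_succ (m' := ⟨Function.update g r k, p, o⟩) hk ?_ ?_
    · have := @Exec.move x N ⟨Function.update g r k, p, o⟩ .stay
      simpa [Move.apply, hp] using this
    · have := ih (Function.update g r k) (by simp)
      rwa [Function.update_idem] at this

theorem exec_add {r d : ℕ} (hrd : r ≠ d) (g : ℕ → ℕ) (hN : g d + g r ≤ N) :
    Exec x N (.loop r (.inc d)) ⟨g, p, o⟩
      ⟨Function.update (Function.update g d (g d + g r)) r 0, p, o⟩ := by
  obtain ⟨k, hk⟩ : ∃ k, g r = k := ⟨_, rfl⟩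
  induction k generalizing g with
  | zero =>
    have : Function.update (Function.update g d (g d + g r)) r 0 = g := by
      funext i
      by_cases h1 : i = r
      · subst h1; simp [hk]
      · by_cases h2 : i = d
        · subst h2; simp [h1, hk]
        · simp [h1, h2]
    rw [this]; exact .loop_zero hk
  | succ k ih =>
    refine .loop_succ hk (.inc ?_) ?_
    · simp [hrd.symm]; omega
    · have h := ih (Function.update (Function.update g r k) d (g d + 1))
        (by simp [hrd]; omega) (by simp [hrd])
      convert h using 2
      · simp [hrd.symm]
      · funext i
        by_cases h1 : i = r
        · subst h1; simp
        · by_cases h2 : i = d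
          · subst h2; simp [h1, hk, hrd]; omega
          · simp [h1, h2]

theorem exec_transfer {r d : ℕ} (hrd : r ≠ d) (hp : p ≤ x.length + 1) (g : ℕ → ℕ)
    (hN : g r ≤ N) :
    Exec x N (.transfer r d) ⟨g, p, o⟩
      ⟨Function.update (Function.update g d (g r)) r 0, p, o⟩ := by
  refine .seq (exec_clear hp d g) ?_
  have := exec_add (x := x) (N := N) (p := p) (o := o) hrd (Function.update g d 0)
    (by simpa [hrd] using hN)
  simpa [hrd] using this

/-- The invariant rule for loops: `P k` is the invariant when `k` rounds are left. -/
theorem exec_loop {r : ℕ} {A : Stmt} (P : ℕ → Mem → Prop) (hr : ∀ k m, P k m → m.reg r = k)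
    (hs : ∀ k m, P (k + 1) m →
      ∃ m', Exec x N A { m with reg := Function.update m.reg r k } m' ∧ P k m') :
    ∀ n m, P n m → ∃ m', Exec x N (.loop r A) m m' ∧ P 0 m' := by
  intro n
  induction n with
  | zero => exact fun m h => ⟨m, .loop_zero (hr 0 m h), h⟩
  | succ n ih =>
    intro m h
    obtain ⟨m', h1, h2⟩ := hs n m h
    obtain ⟨m'', h3, h4⟩ := ih m' h2
    exact ⟨m'', .loop_succ (hr _ m h) h1 h3, h4⟩

theorem exec_copy {r d t : ℕ} (hrd : r ≠ d) (hrt : r ≠ t) (hdt : d ≠ t)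
    (hp : p ≤ x.length + 1) (g : ℕ → ℕ) (hN : g r ≤ N) :
    Exec x N (.copy r d t) ⟨g, p, o⟩
      ⟨Function.update (Function.update g d (g r)) t 0, p, o⟩ := by
  refine .seq (exec_clear hp d g) (.seq (exec_clear hp t _) ?_)
  obtain ⟨m, h1, h2⟩ := exec_loop (x := x) (N := N) (r := r) (A := .seq (.inc d) (.inc t))
    (fun k m => k ≤ g r ∧ m = ⟨Function.update (Function.update (Function.update g r k)
      d (g r - k)) t (g r - k), p, o⟩)
    (fun k m h => by simp [h.2, hrd, hrt])
    (fun k m h => by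
      obtain ⟨hk, rfl⟩ := h
      refine ⟨_, .seq (.inc ?_) (.inc ?_), by omega, ?_⟩
      · simp [hrd.symm, hdt]; omega
      · simp [hrt.symm, hdt.symm]; omega
      · simp only [Mem.mk.injEq, and_true]
        funext i
        by_cases h1 : i = t
        · subst h1; simp [hrt.symm, hdt.symm]; omega
        · by_cases h2 : i = d
          · subst h2; simp [h1, hrd.symm]; omega
          · by_cases h3 : i = r
            · subst h3; simp [h1, h2]
            · simp [h1, h2, h3])
    (g r) ⟨Function.update (Function.update g d 0) t 0, p, o⟩ ⟨le_rfl, by simp⟩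
  obtain ⟨-, rfl⟩ := h2
  refine .seq h1 ?_
  have h3 := exec_add (x := x) (N := N) (p := p) (o := o) hrt.symm (Function.update
    (Function.update (Function.update g r 0) d (g r - 0)) t (g r - 0))
    (by simp [hrt, hrd, hN])
  convert h3 using 2
  funext i
  by_cases j1 : i = t
  · subst j1; simp
  · by_cases j2 : i = d
    · subst j2; simp [j1, hrd.symm]
    · by_cases j3 : i = r
      · subst j3; simp [j1, j2]
      · simp [j1, j2, j3]

/-! ### Log-space computable numeric functions -/

/-- `f` is computed by a program with polynomially bounded registers: the arguments are expected
in the registers `ρ i`, the result appears in register `s`, the registers below `s` are left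
unchanged. -/
def LS (f : α → ℕ) : Prop :=
  ∃ B : α → ℕ, PolyBdd B ∧ ∀ (ρ : Fin (Ctx.arity α) → ℕ) (s : ℕ), (∀ i, ρ i < s) → ∃ P : Stmt,
    ∀ (a : α) (N : ℕ) (g : ℕ → ℕ) (o : List Bool), B a ≤ N → (∀ r, g r ≤ N) →
      (∀ i, g (ρ i) = Ctx.var a i) →
      ∃ g' : ℕ → ℕ, Exec (Ctx.inp a) N P ⟨g, 0, o⟩ ⟨g', 0, o⟩ ∧ g' s = f a ∧ ∀ r < s, g' r = g r

namespace LS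

/-- The result sits in a register, and no register exceeds `B a + sz a` when the program is run with
this bound from registers that hold only the arguments. Polynomial boundedness is thus automatic. -/
theorem polyBdd {f : α → ℕ} (hf : LS f) : PolyBdd f := by
  obtain ⟨B, hB, h⟩ := hf
  obtain ⟨P, hP⟩ := h (fun i => i) (Ctx.arity α) (fun i => i.2)
  refine (hB.add PolyBdd.sz).mono fun a => ?_
  have hg : ∀ r, (if h : r < Ctx.arity α then Ctx.var a ⟨r, h⟩ else 0) ≤ B a + sz a := by
    intro r
    split_ifs
    · exact (var_le_sz a _).trans (Nat.le_add_left _ _)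
    · exact Nat.zero_le _
  obtain ⟨g', h1, h2, -⟩ := hP a (B a + sz a)
    (fun r => if h : r < Ctx.arity α then Ctx.var a ⟨r, h⟩ else 0) [] (Nat.le_add_right _ _) hg
    (fun i => by simp)
  rw [← h2]
  exact h1.reg_le hg _

theorem zero : LS (fun _ : α => 0) :=
  ⟨fun _ => 0, .const 0, fun _ s _ => ⟨.clear s, fun _ _ g _ _ _ _ =>
    ⟨_, exec_clear (Nat.zero_le _) s g, by simp, fun r hr => by simp [hr.ne]⟩⟩⟩

theorem succ {f : α → ℕ} (hf : LS f) : LS (fun a => f a + 1) := by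
  have hb := hf.polyBdd
  obtain ⟨B, hB, h⟩ := hf
  refine ⟨fun a => B a + (f a + 1), hB.add (hb.add (.const 1)), fun ρ s hs => ?_⟩
  obtain ⟨P, hP⟩ := h ρ s hs
  refine ⟨.seq P (.inc s), fun a N g o hN hg hv => ?_⟩
  have hN' : B a + (f a + 1) ≤ N := hN
  obtain ⟨g', h1, h2, h3⟩ := hP a N g o (by omega) hg hv
  exact ⟨_, .seq h1 (.inc (by simp only [h2]; omega)), by simp [h2],
    fun r hr => by simp [hr.ne, h3 r hr]⟩

theorem const (n : ℕ) : LS (fun _ : α => n) := by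
  induction n with
  | zero => exact zero
  | succ n ih => exact ih.succ

theorem congr {f g : α → ℕ} (hf : LS f) (h : ∀ a, g a = f a) : LS g := by
  rwa [show g = f from funext h]

theorem snd : LS (fun p : α × ℕ => p.2) := by
  refine ⟨fun _ => 0, .const 0, fun ρ s hs => ?_⟩
  have h0 : ρ 0 < s := hs 0
  refine ⟨.copy (ρ 0) s (s + 1), fun a N g o _ hg hv => ?_⟩
  refine ⟨_, exec_copy (by omega) (by omega) (by omega) (Nat.zero_le _) g (hg _), ?_, fun r hr => ?_⟩
  · simp only [ne_eq, Nat.left_eq_add, one_ne_zero, not_false_eq_true, Function.update_of_ne,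
      Function.update_self]
    exact hv 0
  · simp [hr.ne, (show r ≠ s + 1 by omega)]

theorem fst {f : α → ℕ} (hf : LS f) : LS (fun p : α × ℕ => f p.1) := by
  obtain ⟨B, hB, h⟩ := hf
  refine ⟨fun p => B p.1, hB.fst, fun ρ s hs => ?_⟩
  obtain ⟨P, hP⟩ := h (fun i => ρ i.succ) s (fun i => hs _)
  exact ⟨P, fun a N g o hN hg hv => hP a.1 N g o hN hg fun i => hv i.succ⟩

/-- Substitution of a computable function for a variable. -/
theorem comp {f : α × ℕ → ℕ} {g : α → ℕ} (hf : LS f) (hg : LS g) :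
    LS (fun a => f (a, g a)) := by
  have hb := hg.polyBdd
  obtain ⟨Bf, hBf, hf⟩ := hf
  obtain ⟨Bg, hBg, hg⟩ := hg
  refine ⟨_, (hBf.comp hb).add hBg, fun ρ s hs => ?_⟩
  obtain ⟨Q, hQ⟩ := hg ρ s hs
  -- The value of `g` in register `s` serves as the first argument of `f`, whose own scratch space
  -- starts one register higher.
  obtain ⟨P, hP⟩ := hf (Fin.cons s ρ) (s + 1)
    (Fin.cases (by simp) fun i => by simpa using (hs i).trans (Nat.lt_succ_self s))
  refine ⟨.seq Q (.seq P (.transfer (s + 1) s)), fun a N r o hN hr hv => ?_⟩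
  obtain ⟨r1, h1, h2, h3⟩ := hQ a N r o (by omega) hr hv
  have hr1 := h1.reg_le hr
  obtain ⟨r2, h4, h5, h6⟩ := hP (a, g a) N r1 o (by omega) hr1 (Fin.cases (by simp only [Fin.cons_zero]; exact h2)
    fun i => by simp only [Fin.cons_succ, h3 _ (hs i)]; exact hv i)
  have hr2 := h4.reg_le hr1
  refine ⟨_, .seq h1 (.seq h4 (exec_transfer (by omega) (Nat.zero_le _) r2 (hr2 _))), ?_,
    fun i hi => ?_⟩
  · simp [h5]
  · simp [hi.ne, (show i ≠ s + 1 by omega), h6 i (by omega), h3 i hi]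

/-- Primitive recursion with polynomially bounded values. -/
theorem rec' {n g B : α → ℕ} {h : (α × ℕ) × ℕ → ℕ} (hn : LS n) (hg : LS g) (hh : LS h)
    (hB : PolyBdd B)
    (hle : ∀ a, ∀ i ≤ n a, Nat.rec (motive := fun _ => ℕ) (g a) (fun i r => h ((a, i), r)) i ≤ B a) :
    LS (fun a => Nat.rec (motive := fun _ => ℕ) (g a) (fun i r => h ((a, i), r)) (n a)) := by
  have hbn := hn.polyBdd
  have hbg := hg.polyBdd
  obtain ⟨Bn, hBn, hn⟩ := hn
  obtain ⟨Bg, hBg, hg⟩ := hg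
  obtain ⟨Bh, ⟨c, hc⟩, hh⟩ := hh
  let R : α → ℕ → ℕ := fun a i =>
    Nat.rec (motive := fun _ => ℕ) (g a) (fun i r => h ((a, i), r)) i
  -- The last summand is the space for `h` at `((a, i), r)` with `i ≤ n a` and `r ≤ B a`; the
  -- hypothesis `hle` guarantees that all intermediate values are of this kind.
  refine ⟨fun a => Bn a + Bg a + n a + (sz a + n a + B a + 2) ^ c, ((hBn.add hBg).add hbn).add
    ((((PolyBdd.sz.add hbn).add hB).add (.const 2)).pow c), fun ρ s hs => ?_⟩
  obtain ⟨Pn, hPn⟩ := hn ρ s hs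
  obtain ⟨Pg, hPg⟩ := hg ρ (s + 1) (fun i => (hs i).trans (Nat.lt_succ_self s))
  obtain ⟨Ph, hPh⟩ := hh (Fin.cons (s + 1) (Fin.cons (s + 2) ρ)) (s + 3)
    (Fin.cases (by simp) (Fin.cases (by simp) fun i => by
      have := hs i
      simp only [Fin.cons_succ]; omega))
  -- Register `s` counts the remaining rounds, `s + 1` holds the current value, `s + 2` the index of
  -- the round, and `s + 3` receives the new value.
  refine ⟨.seq Pn (.seq Pg (.seq (.clear (s + 2)) (.seq (.loop s (.seq Ph (.seq
    (.transfer (s + 3) (s + 1)) (.inc (s + 2))))) (.transfer (s + 1) s)))),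
    fun a N r o hN hr hv => ?_⟩
  have hN' : Bn a + Bg a + n a + (sz a + n a + B a + 2) ^ c ≤ N := hN
  obtain ⟨r1, h1, h2, h3⟩ := hPn a N r o (by omega) hr hv
  have hr1 := h1.reg_le hr
  obtain ⟨r2, h4, h5, h6⟩ := hPg a N r1 o (by omega) hr1 (fun i => by
    rw [h3 _ (hs i)]; exact hv i)
  have hr2 := h4.reg_le hr1
  obtain ⟨m, hm, hm'⟩ := exec_loop (x := Ctx.inp a) (N := N) (r := s)
    (A := .seq Ph (.seq (.transfer (s + 3) (s + 1)) (.inc (s + 2))))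
    (fun k m => m.pos = 0 ∧ m.out = o ∧ m.reg s = k ∧ k ≤ n a ∧ m.reg (s + 2) = n a - k ∧
      m.reg (s + 1) = R a (n a - k) ∧ (∀ i < s, m.reg i = r i) ∧ ∀ i, m.reg i ≤ N)
    (fun k m h => h.2.2.1)
    (fun k m hk => by
      obtain ⟨q, p, o'⟩ := m
      obtain ⟨rfl, rfl, h7, h8, h9, h10, h11, h12⟩ := hk
      dsimp only at *
      have hq : ∀ i, Function.update q s k i ≤ N := by
        intro i
        by_cases hi : i = s
        · subst hi; have := h12 i; simp; omega
        · simpa [hi] using h12 i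
      have hbound : Bh ((a, n a - (k + 1)), R a (n a - (k + 1))) ≤ N := by
        refine (hc _).trans (le_trans (Nat.pow_le_pow_left ?_ c) (le_trans (Nat.le_add_left _ _) hN'))
        have := hle a (n a - (k + 1)) (by omega)
        change R a (n a - (k + 1)) ≤ _ at this
        simp only [sz_prod]
        omega
      obtain ⟨q1, h13, h14, h15⟩ := hPh ((a, n a - (k + 1)), R a (n a - (k + 1))) N
        (Function.update q s k) o' hbound hq
        (Fin.cases (by simpa [Ctx.var] using h10) (Fin.cases (by simpa [Ctx.var] using h9)
          fun i => by simpa [Ctx.var, h11 _ (hs i), (hs i).ne] using hv i))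
      have hq1 := h13.reg_le hq
      have e1 : q1 (s + 2) = n a - (k + 1) := by
        rw [h15 _ (by omega)]; simpa using h9
      have e2 : n a - k = (n a - (k + 1)) + 1 := by omega
      refine ⟨_, .seq h13 (.seq (exec_transfer (by omega) (Nat.zero_le _) q1 (hq1 _))
        (.inc ?_)), ?_⟩
      · simp [e1]; omega
      · have hexec := @Exec.reg_le (Ctx.inp a) N _ _ _ (Exec.seq h13 (Exec.seq
          (exec_transfer (r := s + 3) (d := s + 1) (by omega) (Nat.zero_le _) q1 (hq1 _))
          (Exec.inc (r := s + 2) (by simp [e1]; omega)))) hq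
        refine ⟨rfl, rfl, ?_, by omega, ?_, ?_, ?_, hexec⟩
        · simp [h15 s (by omega)]
        · simp [e1]; omega
        · rw [e2]; simp [h14]; rfl
        · intro i hi
          simp [(show i ≠ s + 1 by omega), (show i ≠ s + 2 by omega), (show i ≠ s + 3 by omega),
            h15 i (by omega), hi.ne, h11 i hi])
    (n a) ⟨Function.update r2 (s + 2) 0, 0, o⟩
    ⟨rfl, rfl, by simp [h6 s (by omega), h2], le_rfl, by simp, by simp [h5, R],
      fun i hi => by simp [(show i ≠ s + 2 by omega), h6 i (by omega), h3 i hi],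
      (exec_clear (x := Ctx.inp a) (N := N) (p := 0) (o := o) (Nat.zero_le _) (s + 2) r2).reg_le
        hr2⟩
  obtain ⟨q, p, o'⟩ := m
  obtain ⟨rfl, rfl, h7, h8, h9, h10, h11, h12⟩ := hm'
  dsimp only at *
  refine ⟨_, .seq h1 (.seq h4 (.seq (exec_clear (Nat.zero_le _) (s + 2) r2) (.seq hm
    (exec_transfer (by omega) (Nat.zero_le _) q (h12 _))))), ?_, fun i hi => ?_⟩
  · simpa using h10
  · simp [hi.ne, (show i ≠ s + 1 by omega), h11 i hi]

theorem exec_moveRight (r : ℕ) (g : ℕ → ℕ) :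
    Exec x N (.loop r (.move .right)) ⟨g, 0, o⟩
      ⟨Function.update g r 0, min (g r) (x.length + 1), o⟩ := by
  obtain ⟨m, h1, h2⟩ := exec_loop (x := x) (N := N) (r := r) (A := .move .right)
    (fun k m => k ≤ g r ∧ m = ⟨Function.update g r k, min (g r - k) (x.length + 1), o⟩)
    (fun k m h => by simp [h.2])
    (fun k m h => by
      obtain ⟨hk, rfl⟩ := h
      refine ⟨_, .move, by omega, ?_⟩
      simp only [Function.update_idem, Move.apply, Mem.mk.injEq, true_and, and_true]
      omega)
    (g r) ⟨g, 0, o⟩ ⟨le_rfl, by simp⟩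
  obtain ⟨-, rfl⟩ := h2
  simpa using h1

theorem exec_moveLeft (r : ℕ) (g : ℕ → ℕ) (hp : p ≤ x.length + 1) :
    Exec x N (.loop r (.move .left)) ⟨g, p, o⟩ ⟨Function.update g r 0, p - g r, o⟩ := by
  obtain ⟨m, h1, h2⟩ := exec_loop (x := x) (N := N) (r := r) (A := .move .left)
    (fun k m => k ≤ g r ∧ m = ⟨Function.update g r k, p - (g r - k), o⟩)
    (fun k m h => by simp [h.2])
    (fun k m h => by
      obtain ⟨hk, rfl⟩ := h
      refine ⟨_, .move, by omega, ?_⟩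
      simp only [Function.update_idem, Move.apply, Mem.mk.injEq, true_and, and_true]
      omega)
    (g r) ⟨g, p, o⟩ ⟨le_rfl, by simp⟩
  obtain ⟨-, rfl⟩ := h2
  simpa using h1

theorem inputSymbol_min (x : List Bool) (n : ℕ) :
    inputSymbol x (min n (x.length + 1)) = inputSymbol x n := by
  rcases le_total n (x.length + 1) with h | h
  · rw [min_eq_left h]
  · rw [min_eq_right h]
    unfold inputSymbol
    rw [if_neg (by omega), if_neg (by omega), List.getElem?_eq_none (by omega),
      List.getElem?_eq_none (by omega)]

/-- Testing the input symbol at a given position. -/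
theorem test {f : α → ℕ} (hf : LS f) (t : InputSymbol → Bool) :
    LS (fun a => if t (inputSymbol (Ctx.inp a) (f a)) then 1 else 0) := by
  obtain ⟨B, hB, h⟩ := hf
  refine ⟨fun a => B a + 1, hB.add (.const 1), fun ρ s hs => ?_⟩
  obtain ⟨P, hP⟩ := h ρ s hs
  -- A copy of the position moves the head to the right; the original is kept for the way back. The
  -- head may have been stopped at the right end marker, but then too many moves to the left do no
  -- harm, as it stops in cell 0.
  refine ⟨.seq P (.seq (.copy s (s + 1) (s + 2)) (.seq (.loop (s + 1) (.move .right))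
    (.seq (.test t (.inc (s + 1)) (.move .stay)) (.seq (.loop s (.move .left))
    (.transfer (s + 1) s))))), fun a N r o hN hr hv => ?_⟩
  have hN' : B a + 1 ≤ N := hN
  obtain ⟨r1, h1, h2, h3⟩ := hP a N r o (by omega) hr hv
  have hr1 := h1.reg_le hr
  have h4 := exec_copy (x := Ctx.inp a) (N := N) (o := o) (r := s) (d := s + 1) (t := s + 2)
    (by omega) (by omega) (by omega) (Nat.zero_le _) r1 (hr1 _)
  have h5 := exec_moveRight (x := Ctx.inp a) (N := N) (o := o) (s + 1)
    (Function.update (Function.update r1 (s + 1) (r1 s)) (s + 2) 0)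
  simp only [ne_eq, Nat.add_left_cancel_iff, OfNat.one_ne_ofNat, not_false_eq_true,
    Function.update_of_ne, Function.update_self, h2] at h5
  have hpos : min (f a) ((Ctx.inp a).length + 1) ≤ (Ctx.inp a).length + 1 := min_le_right _ _
  generalize hu : Function.update (Function.update (Function.update r1 (s + 1) (f a)) (s + 2) 0)
    (s + 1) 0 = u at h5
  have h6 : Exec (Ctx.inp a) N (.test t (.inc (s + 1)) (.move .stay))
      ⟨u, min (f a) ((Ctx.inp a).length + 1), o⟩
      ⟨Function.update u (s + 1) (if t (inputSymbol (Ctx.inp a) (f a)) then 1 else 0),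
        min (f a) ((Ctx.inp a).length + 1), o⟩ := by
    cases ht : t (inputSymbol (Ctx.inp a) (f a))
    · refine .test_false (by rwa [inputSymbol_min]) ?_
      have := @Exec.move (Ctx.inp a) N ⟨u, min (f a) ((Ctx.inp a).length + 1), o⟩ .stay
      have hu' : Function.update u (s + 1) 0 = u := by rw [← hu]; simp
      simpa [Move.apply, hu'] using this
    · refine .test_true (by rwa [inputSymbol_min]) ?_
      have hu' : u (s + 1) = 0 := by rw [← hu]; simp
      have := @Exec.inc (Ctx.inp a) N ⟨u, min (f a) ((Ctx.inp a).length + 1), o⟩ (s + 1)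
        (by simp only [hu']; omega)
      simpa [hu'] using this
  have hus : u s = f a := by rw [← hu]; simp [h2]
  have h7 := exec_moveLeft (x := Ctx.inp a) (N := N) (o := o) s (Function.update u (s + 1)
    (if t (inputSymbol (Ctx.inp a) (f a)) then 1 else 0)) hpos
  have he : min (f a) ((Ctx.inp a).length + 1) - (Function.update u (s + 1)
    (if t (inputSymbol (Ctx.inp a) (f a)) then 1 else 0)) s = 0 := by
    simp [hus]
  rw [he] at h7
  rw [h2] at h4
  refine ⟨_, .seq h1 (.seq h4 (.seq h5 (.seq h6 (.seq h7
    (exec_transfer (by omega) (Nat.zero_le _) _ ?_))))), ?_, fun i hi => ?_⟩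
  · simp only [ne_eq, Nat.add_eq_left, one_ne_zero, not_false_eq_true, Function.update_of_ne,
      Function.update_self]
    split_ifs <;> omega
  · simp
  · rw [← hu]
    simp [hi.ne, (show i ≠ s + 1 by omega), (show i ≠ s + 2 by omega), h3 i hi]

end LS

end


/-! ### Arithmetic in logarithmic space -/

section

variable {α : Type} [Ctx α]

namespace LS

/-- A recursion whose step ignores both its arguments: no round yields `f`, any positive number of
rounds yields `g`. -/
theorem caseZero {n f g : α → ℕ} (hn : LS n) (hf : LS f) (hg : LS g) :
    LS (fun a => if n a = 0 then f a else g a) := by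
  refine (rec' (B := fun a => f a + g a) hn hf hg.fst.fst (hf.polyBdd.add hg.polyBdd)
    fun a i _ => ?_).congr fun a => ?_
  · cases i <;> simp
  · cases n a <;> simp

theorem add {f g : α → ℕ} (hf : LS f) (hg : LS g) : LS (fun a => f a + g a) := by
  have key : ∀ a i, Nat.rec (motive := fun _ => ℕ) (f a) (fun _ r => r + 1) i = f a + i := by
    intro a i
    induction i with
    | zero => rfl
    | succ i ih => simp only [ih]; rfl
  refine (rec' (h := fun p => p.2 + 1) (B := fun a => f a + g a) hg hf snd.succ
    (hf.polyBdd.add hg.polyBdd) fun a i hi => ?_).congr fun a => (key a _).symm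
  rw [key]; omega

theorem mul {f g : α → ℕ} (hf : LS f) (hg : LS g) : LS (fun a => f a * g a) := by
  have key : ∀ a i, Nat.rec (motive := fun _ => ℕ) 0 (fun _ r => r + f a) i = f a * i := by
    intro a i
    induction i with
    | zero => rfl
    | succ i ih => simp only [ih]; rfl
  refine (rec' (h := fun p => p.2 + f p.1.1) (B := fun a => f a * g a) hg zero
    (snd.add hf.fst.fst) (hf.polyBdd.mul hg.polyBdd) fun a i hi => ?_).congr
    fun a => (key a _).symm
  rw [key]; exact Nat.mul_le_mul_left _ hi

/-- The recursion step returns the index of its round, and the last round has index `f a - 1`. -/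
theorem pred {f : α → ℕ} (hf : LS f) : LS (fun a => f a - 1) := by
  have key : ∀ i, Nat.rec (motive := fun _ => ℕ) 0 (fun i _ => i) i = i - 1 := by
    intro i; cases i <;> rfl
  refine (rec' (h := fun p => p.1.2) (B := f) hf zero snd.fst hf.polyBdd
    fun a i hi => ?_).congr fun a => (key _).symm
  rw [key]; omega

theorem sub {f g : α → ℕ} (hf : LS f) (hg : LS g) : LS (fun a => f a - g a) := by
  have key : ∀ a i, Nat.rec (motive := fun _ => ℕ) (f a) (fun _ r => r - 1) i = f a - i := by
    intro a i
    induction i with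
    | zero => rfl
    | succ i ih => simp only [ih]; omega
  refine (rec' (h := fun p => p.2 - 1) (B := f) hg hf snd.pred
    hf.polyBdd fun a i hi => ?_).congr fun a => (key a _).symm
  rw [key]; omega

theorem sum {n : α → ℕ} {f : α × ℕ → ℕ} (hn : LS n) (hf : LS f) :
    LS (fun a => ∑ i ∈ Finset.range (n a), f (a, i)) := by
  have key : ∀ a i, Nat.rec (motive := fun _ => ℕ) 0 (fun i r => r + f (a, i)) i =
      ∑ i ∈ Finset.range i, f (a, i) := by
    intro a i
    induction i with
    | zero => rfl
    | succ i ih => rw [Finset.sum_range_succ, ← ih]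
  obtain ⟨c, hc⟩ := hf.polyBdd
  refine (rec' (h := fun p => p.2 + f p.1) (B := fun a => n a * (sz a + n a + 2) ^ c) hn zero
    (snd.add hf.fst) (hn.polyBdd.mul (((PolyBdd.sz.add hn.polyBdd).add (.const 2)).pow c))
    fun a i hi => ?_).congr fun a => (key a _).symm
  rw [key]
  refine (Finset.sum_le_card_nsmul _ _ ((sz a + n a + 2) ^ c) fun j hj => ?_).trans ?_
  · refine (hc _).trans (Nat.pow_le_pow_left ?_ c)
    have := Finset.mem_range.1 hj
    simp only [sz_prod]; omega
  · rw [Finset.card_range, smul_eq_mul]; exact Nat.mul_le_mul_right _ hi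

/-- Iteration with polynomially bounded values. -/
theorem iterate {n g B : α → ℕ} {h : α → ℕ → ℕ} (hn : LS n) (hg : LS g)
    (hh : LS fun p : (α × ℕ) × ℕ => h p.1.1 p.2) (hB : PolyBdd B)
    (hle : ∀ a, ∀ i ≤ n a, (h a)^[i] (g a) ≤ B a) : LS (fun a => (h a)^[n a] (g a)) := by
  have key : ∀ a i, Nat.rec (motive := fun _ => ℕ) (g a) (fun _ r => h a r) i =
      (h a)^[i] (g a) := by
    intro a i
    induction i with
    | zero => rfl
    | succ i ih => rw [Function.iterate_succ_apply', ← ih]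
  exact (rec' (h := fun p => h p.1.1 p.2) (B := B) hn hg hh hB fun a i hi => by
    rw [key]; exact hle a i hi).congr fun a => (key a _).symm

theorem pow {f : α → ℕ} (hf : LS f) (n : ℕ) : LS (fun a => f a ^ n) := by
  induction n with
  | zero => exact (const 1).congr fun a => by simp
  | succ n ih => exact (ih.mul hf).congr fun a => pow_succ _ _

end LS

/-! ### Predicates decidable in logarithmic space -/

open Classical in
/-- Decidability in logarithmic space. -/
def LSP (p : α → Prop) : Prop := LS (fun a => if p a then 1 else 0)

namespace LSP

theorem congr {p q : α → Prop} (hp : LSP p) (h : ∀ a, q a ↔ p a) : LSP q := by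
  rwa [show q = p from funext fun a => propext (h a)]

theorem not {p : α → Prop} (hp : LSP p) : LSP (fun a => ¬ p a) :=
  ((LS.const 1).sub hp).congr fun a => by by_cases h : p a <;> simp [h]

theorem and {p q : α → Prop} (hp : LSP p) (hq : LSP q) : LSP (fun a => p a ∧ q a) :=
  (hp.mul hq).congr fun a => by by_cases h : p a <;> by_cases h' : q a <;> simp [h, h']

theorem eq_zero {f : α → ℕ} (hf : LS f) : LSP (fun a => f a = 0) :=
  (hf.caseZero (LS.const 1) LS.zero).congr fun a => by simp

theorem le {f g : α → ℕ} (hf : LS f) (hg : LS g) : LSP (fun a => f a ≤ g a) :=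
  (eq_zero (hf.sub hg)).congr fun a => by simp [Nat.sub_eq_zero_iff_le]

theorem lt {f g : α → ℕ} (hf : LS f) (hg : LS g) : LSP (fun a => f a < g a) :=
  (le hf.succ hg).congr fun _ => Iff.rfl

theorem eq {f g : α → ℕ} (hf : LS f) (hg : LS g) : LSP (fun a => f a = g a) :=
  ((le hf hg).and (le hg hf)).congr fun _ => by omega

theorem fst {p : α → Prop} (hp : LSP p) : LSP (fun q : α × ℕ => p q.1) := LS.fst hp

theorem of_const (p : Prop) : LSP (fun _ : α => p) := by
  by_cases h : p
  · exact (LS.const 1).congr fun a => by simp [h]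
  · exact LS.zero.congr fun a => by simp [h]

theorem test {f : α → ℕ} (hf : LS f) (t : InputSymbol → Prop) :
    LSP (fun a => t (inputSymbol (Ctx.inp a) (f a))) := by
  classical
  exact (hf.test fun i => decide (t i)).congr fun a => by simp

end LSP

namespace LS

theorem ite {p : α → Prop} [∀ a, Decidable (p a)] {f g : α → ℕ} (hp : LSP p) (hf : LS f)
    (hg : LS g) : LS (fun a => if p a then f a else g a) :=
  (LS.caseZero hp hg hf).congr fun a => by by_cases h : p a <;> simp [h]

theorem indicator {p : α → Prop} [∀ a, Decidable (p a)] (hp : LSP p) :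
    LS (fun a => if p a then 1 else 0) := ite hp (const 1) zero

theorem natMin {f g : α → ℕ} (hf : LS f) (hg : LS g) : LS (fun a => min (f a) (g a)) :=
  (ite (LSP.le hf hg) hf hg).congr fun a => by simp [min_def]

theorem natMax {f g : α → ℕ} (hf : LS f) (hg : LS g) : LS (fun a => max (f a) (g a)) :=
  (ite (LSP.le hf hg) hg hf).congr fun a => by simp [max_def]

end LS

/-- The number of counterexamples is a computable sum, to be compared with zero. -/
theorem LSP.forall_lt {n : α → ℕ} {p : α × ℕ → Prop} (hn : LS n) (hp : LSP p) :
    LSP (fun a => ∀ i < n a, p (a, i)) := by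
  classical
  exact (LSP.eq_zero (LS.sum hn hp.not)).congr fun a => by simp

/-! ### Input length, division, square roots and pairing -/

namespace LS

theorem inputSymbol_succ_of_le {x : List Bool} {j : ℕ} (h : x.length ≤ j) :
    inputSymbol x (j + 1) = .rightEnd := by
  unfold inputSymbol
  rw [if_neg (by omega), List.getElem?_eq_none (by omega)]

theorem inputSymbol_succ_of_lt {x : List Bool} {j : ℕ} (h : j < x.length) :
    inputSymbol x (j + 1) = .bit x[j] := by
  unfold inputSymbol
  rw [if_neg (by omega), Nat.add_sub_cancel, List.getElem?_eq_getElem h]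

/-- Register `s + 1` is a flag: the loop clears it at the start of each round, and the body sets it
again unless the right end marker has been met. Here `k` is the number of bits still ahead. -/
theorem exec_length (s : ℕ) {x : List Bool} {N : ℕ} {o : List Bool} (hN : x.length + 1 ≤ N)
    (t : InputSymbol → Bool) (ht : ∀ i, t i = true ↔ i = .rightEnd) (k : ℕ) :
    ∀ (g : ℕ → ℕ) (j : ℕ), j + k = x.length → g s = j → g (s + 1) = 1 →
    Exec x N (.loop (s + 1) (.seq (.move .right) (.test t (.move .stay)
      (.seq (.inc s) (.inc (s + 1)))))) ⟨g, j, o⟩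
      ⟨Function.update (Function.update g (s + 1) 0) s x.length, x.length + 1, o⟩ := by
  induction k with
  | zero =>
    intro g j hj hs h1
    refine .loop_succ (k := 0) h1 (.seq .move (.test_true ((ht _).2 ?_) .move)) ?_
    · change inputSymbol x (min (j + 1) (x.length + 1)) = _
      rw [min_eq_left (by omega), inputSymbol_succ_of_le (by omega)]
    · simp only [Move.apply]
      have e : Function.update (Function.update g (s + 1) 0) s x.length =
          Function.update g (s + 1) 0 := by
        rw [Function.update_eq_self_iff]
        simp; omega
      rw [e, show min (min (j + 1) (x.length + 1)) (x.length + 1) = x.length + 1 by omega]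
      exact .loop_zero (by simp)
  | succ k ih =>
    intro g j hj hs h1
    have hlt : j < x.length := by omega
    refine .loop_succ (k := 0) h1 (.seq .move (.test_false ?_ (.seq (.inc ?_) (.inc ?_)))) ?_
    · change t (inputSymbol x (min (j + 1) (x.length + 1))) = _
      rw [Bool.eq_false_iff, ne_eq, ht, min_eq_left (by omega), inputSymbol_succ_of_lt hlt]
      simp
    · simp; omega
    · simp; omega
    · have h2 := ih (Function.update (Function.update g s (j + 1)) (s + 1) 1) (j + 1) (by omega)
        (by simp) (by simp)
      simp only [Move.apply, min_eq_left (show j + 1 ≤ x.length + 1 by omega)]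
      convert h2 using 2
      · funext i
        by_cases e1 : i = s + 1
        · subst e1; simp
        · by_cases e2 : i = s
          · subst e2; simp [hs]
          · simp [e1, e2]
      · funext i
        by_cases e1 : i = s
        · subst e1; simp
        · by_cases e2 : i = s + 1
          · subst e2; simp
          · simp [e1, e2]

theorem length : LS (fun a : α => (Ctx.inp a).length) := by
  classical
  refine ⟨fun a => sz a + 1, PolyBdd.sz.add (.const 1), fun ρ s hs => ⟨.seq (.clear s)
    (.seq (.clear (s + 1)) (.seq (.inc (s + 1)) (.seq (.loop (s + 1) (.seq (.move .right)
    (.test (fun i => decide (i = .rightEnd)) (.move .stay) (.seq (.inc s) (.inc (s + 1))))))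
    (.seq (.copy s (s + 1) (s + 2)) (.seq (.inc (s + 1)) (.loop (s + 1) (.move .left))))))),
    fun a N g o hN hg hv => ?_⟩⟩
  have hN' : (Ctx.inp a).length + 1 ≤ N := by
    refine le_trans ?_ hN
    simp [sz]
  have h1 := exec_clear (x := Ctx.inp a) (N := N) (o := o) (Nat.zero_le _) s g
  have h2 := exec_clear (x := Ctx.inp a) (N := N) (o := o) (Nat.zero_le _) (s + 1)
    (Function.update g s 0)
  have h4 := exec_length s (x := Ctx.inp a) (N := N) (o := o) hN'
    (fun i => decide (i = .rightEnd)) (fun i => by simp) (Ctx.inp a).length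
    (Function.update (Function.update g s 0) (s + 1) 1) 0 (by simp) (by simp) (by simp)
  have h5 := exec_copy (x := Ctx.inp a) (N := N) (o := o) (r := s) (d := s + 1) (t := s + 2)
    (by omega) (by omega) (by omega) le_rfl
    (Function.update (Function.update (Function.update (Function.update g s 0) (s + 1) 1)
      (s + 1) 0) s (Ctx.inp a).length) (by simp; omega)
  refine ⟨Function.update (Function.update (Function.update g (s + 2) 0) (s + 1) 0) s
    (Ctx.inp a).length,
    .seq h1 (.seq h2 (.seq (.inc ?_) (.seq ?_ (.seq h5 (.seq (.inc ?_) ?_))))), ?_, ?_⟩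
  · simp; omega
  · simpa using h4
  · simpa using hN'
  · have h7 := exec_moveLeft (x := Ctx.inp a) (N := N) (o := o) (p := (Ctx.inp a).length + 1)
      (s + 1) (Function.update (Function.update (Function.update (Function.update
      (Function.update g s 0) (s + 1) 0) s (Ctx.inp a).length) (s + 2) 0) (s + 1)
      ((Ctx.inp a).length + 1)) le_rfl
    simp only [Function.update_self, Nat.sub_self] at h7
    convert h7 using 2
    all_goals
      funext i
      by_cases e1 : i = s + 1
      · subst e1; simp
      · by_cases e2 : i = s
        · subst e2; simp
        · by_cases e3 : i = s + 2
          · subst e3; simp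
          · simp [e1, e2, e3]
  · simp
  · intro r hr
    simp [hr.ne, (show r ≠ s + 1 by omega), (show r ≠ s + 2 by omega)]

/-- The quotient is the number of `i < f a` with `(i + 1) * g a ≤ f a`. Counting also yields the
square root, which is what the inverse of the pairing function needs. -/
theorem div {f g : α → ℕ} (hf : LS f) (hg : LS g) : LS (fun a => f a / g a) := by
  classical
  refine (ite (LSP.eq_zero hg) zero (sum (f := fun p => if (p.2 + 1) * g p.1 ≤ f p.1 then 1 else 0)
    hf (indicator (LSP.le (snd.succ.mul hg.fst) hf.fst)))).congr fun a => ?_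
  by_cases h0 : g a = 0
  · simp [h0]
  · have hpos := Nat.pos_of_ne_zero h0
    rw [if_neg h0, ← Finset.card_filter]
    have : (Finset.range (f a)).filter (fun i => (i + 1) * g a ≤ f a) =
        Finset.range (f a / g a) := by
      ext i
      simp only [Finset.mem_filter, Finset.mem_range]
      rw [← Nat.le_div_iff_mul_le hpos]
      constructor
      · rintro ⟨-, h⟩; omega
      · intro h
        exact ⟨lt_of_lt_of_le h (Nat.div_le_self _ _), h⟩
    rw [this, Finset.card_range]

theorem mod {f g : α → ℕ} (hf : LS f) (hg : LS g) : LS (fun a => f a % g a) :=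
  (hf.sub (hg.mul (hf.div hg))).congr fun a => by
    have := Nat.mod_add_div (f a) (g a); omega

theorem sqrt {f : α → ℕ} (hf : LS f) : LS (fun a => Nat.sqrt (f a)) := by
  classical
  refine (sum (f := fun p => if (p.2 + 1) * (p.2 + 1) ≤ f p.1 then 1 else 0)
    hf (indicator (LSP.le (snd.succ.mul snd.succ) hf.fst))).congr fun a => ?_
  rw [← Finset.card_filter]
  have : (Finset.range (f a)).filter (fun i => (i + 1) * (i + 1) ≤ f a) =
      Finset.range (Nat.sqrt (f a)) := by
    ext i
    simp only [Finset.mem_filter, Finset.mem_range]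
    rw [← Nat.le_sqrt]
    constructor
    · rintro ⟨-, h⟩; omega
    · intro h
      exact ⟨lt_of_lt_of_le h (Nat.sqrt_le_self _), h⟩
  rw [this, Finset.card_range]

theorem pair {f g : α → ℕ} (hf : LS f) (hg : LS g) : LS (fun a => Nat.pair (f a) (g a)) :=
  ite (LSP.lt hf hg) ((hg.mul hg).add hf) (((hf.mul hf).add hf).add hg)

theorem unpair_fst {f : α → ℕ} (hf : LS f) : LS (fun a => (Nat.unpair (f a)).1) := by
  have h := hf.sub (hf.sqrt.mul hf.sqrt)
  refine (ite (LSP.lt h hf.sqrt) h hf.sqrt).congr fun a => ?_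
  simp only [Nat.unpair]
  split_ifs <;> rfl

theorem unpair_snd {f : α → ℕ} (hf : LS f) : LS (fun a => (Nat.unpair (f a)).2) := by
  have h := hf.sub (hf.sqrt.mul hf.sqrt)
  refine (ite (LSP.lt h hf.sqrt) hf.sqrt (h.sub hf.sqrt)).congr fun a => ?_
  simp only [Nat.unpair]
  split_ifs <;> rfl

end LS

end

/-! ### Writing lists of numbers -/

theorem exec_emit {x : List Bool} {N r : ℕ} (g : ℕ → ℕ) (o : List Bool) :
    Exec x N (.loop r (.emit true)) ⟨g, 0, o⟩
      ⟨Function.update g r 0, 0, o ++ List.replicate (g r) true⟩ := by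
  obtain ⟨m, h1, h2⟩ := exec_loop (x := x) (N := N) (r := r) (A := .emit true)
    (fun k m => k ≤ g r ∧ m = ⟨Function.update g r k, 0, o ++ List.replicate (g r - k) true⟩)
    (fun k m h => by simp [h.2])
    (fun k m h => by
      obtain ⟨hk, rfl⟩ := h
      refine ⟨_, .emit, by omega, ?_⟩
      simp [List.replicate_succ', (show g r - k = g r - (k + 1) + 1 by omega)])
    (g r) ⟨g, 0, o⟩ ⟨le_rfl, by simp⟩
  obtain ⟨-, rfl⟩ := h2
  simpa using h1

/-- Lists of numbers with computable length and computable entries can be written in logarithmic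
space. -/
theorem LS.logSpaceComputable {L : List Bool → ℕ} {e : List Bool × ℕ → ℕ} (hL : LS L)
    (he : LS e) :
    LogSpaceComputable fun x => encodeNats ((List.range (L x)).map fun i => e (x, i)) := by
  have hbL := hL.polyBdd
  obtain ⟨BL, hBL, hL⟩ := hL
  obtain ⟨Be, ⟨c, hc⟩, he⟩ := he
  obtain ⟨d, hd⟩ := (hBL.add hbL).add (((PolyBdd.sz.add hbL).add (.const 2)).pow c)
  obtain ⟨PL, hPL⟩ := hL Fin.elim0 0 (fun i => i.elim0)
  obtain ⟨Pe, hPe⟩ := he (Fin.cons 1 Fin.elim0) 2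
    (Fin.cases (by simp) fun i => i.elim0)
  refine .of_exec (.seq PL (.seq (.clear 1) (.loop 0 (.seq Pe (.seq (.loop 2 (.emit true))
    (.seq (.emit false) (.inc 1))))))) d fun x => ?_
  have hd' : BL x + L x + (sz x + L x + 2) ^ c ≤ (sz x + 2) ^ d := hd x
  rw [sz_list] at hd'
  generalize (x.length + 2) ^ d = N at hd'
  obtain ⟨r1, h1, h2, h3⟩ := hPL x N (fun _ => 0) [] (by omega) (fun _ => Nat.zero_le _)
    (fun i => i.elim0)
  have hr1 := h1.reg_le (fun _ => Nat.zero_le _)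
  have h4 := exec_clear (x := x) (N := N) (o := []) (Nat.zero_le _) 1 r1
  have hr2 := h4.reg_le hr1
  obtain ⟨m, hm, hm'⟩ := exec_loop (x := x) (N := N) (r := 0)
    (A := .seq Pe (.seq (.loop 2 (.emit true)) (.seq (.emit false) (.inc 1))))
    (fun k m => m.pos = 0 ∧ m.reg 0 = k ∧ k ≤ L x ∧ m.reg 1 = L x - k ∧
      m.out = encodeNats ((List.range (L x - k)).map fun i => e (x, i)) ∧ ∀ i, m.reg i ≤ N)
    (fun k m h => h.2.1)
    (fun k m hk => by
      obtain ⟨q, p, o⟩ := m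
      obtain ⟨rfl, h6, h7, h8, h9, h10⟩ := hk
      dsimp only at *
      have hq : ∀ i, Function.update q 0 k i ≤ N := by
        intro i
        by_cases hi : i = 0
        · subst hi; have := h10 0; simp; omega
        · simpa [hi] using h10 i
      have hbound : Be (x, L x - (k + 1)) ≤ N := by
        refine (hc _).trans (le_trans (Nat.pow_le_pow_left ?_ c)
          (le_trans (Nat.le_add_left _ _) hd'))
        simp only [sz_prod, sz_list]
        omega
      obtain ⟨q1, h13, h14, h15⟩ := hPe (x, L x - (k + 1)) N (Function.update q 0 k) o hbound hq
        (Fin.cases (by simp only [Fin.cons_zero]; exact h8) fun i => i.elim0)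
      have e1 : q1 1 = L x - (k + 1) := by
        rw [h15 _ (by omega)]; simpa using h8
      have e2 : L x - k = (L x - (k + 1)) + 1 := by omega
      have hinc : Function.update q1 2 0 1 + 1 ≤ N := by simp [e1]; omega
      have h16 : Exec x N Pe ⟨Function.update q 0 k, 0, o⟩ ⟨q1, 0, o⟩ := h13
      have hexec := Exec.seq h16 (Exec.seq (exec_emit (r := 2) q1 o)
        (Exec.seq (Exec.emit (b := false)) (.inc (r := 1) hinc)))
      refine ⟨_, hexec, rfl, ?_, by omega, ?_, ?_, hexec.reg_le hq⟩
      · simp [h15 0 (by omega)]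
      · simp [e1]; omega
      · rw [e2, List.range_succ, List.map_append, encodeNats, List.flatMap_append]
        simp only [h14, h9, encodeNats]
        simp)
    (L x) ⟨Function.update r1 1 0, 0, []⟩
    ⟨rfl, by simpa using h2, le_rfl, by simp, by simp [encodeNats], hr2⟩
  exact ⟨m, .seq h1 (.seq h4 hm), by simpa using hm'.2.2.2.2.1⟩


/-! ### Functions with finitely many values -/

section

variable {α : Type} [Ctx α]

theorem LS.finset_sum {ι : Type} (S : Finset ι) {f : ι → α → ℕ} (hf : ∀ i, LS (f i)) :
    LS (fun a => ∑ i ∈ S, f i a) := by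
  classical
  induction S using Finset.induction_on with
  | empty => exact LS.zero.congr fun a => by simp
  | insert i S hi ih => exact ((hf i).add ih).congr fun a => Finset.sum_insert hi

theorem LSP.forall_fin {k : ℕ} {p : Fin k → α → Prop} (hp : ∀ i, LSP (p i)) :
    LSP (fun a => ∀ i, p i a) := by
  induction k with
  | zero => exact (LSP.of_const True).congr fun a => by simp
  | succ k ih =>
    exact ((hp 0).and (ih fun i => hp i.succ)).congr fun a => Fin.forall_fin_succ

/-- A function with finitely many values is computable in logarithmic space. -/
def LSF {A : Type} (g : α → A) : Prop := ∀ b, LSP (fun a => g a = b)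

namespace LSF

variable {A B : Type}

/-- A case distinction is a finite sum of products with indicators. Finite control of a machine
enters all later computations in this way. -/
theorem cases [Finite A] {g : α → A} (hg : LSF g) {F : A → α → ℕ} (hF : ∀ b, LS (F b)) :
    LS (fun a => F (g a) a) := by
  classical
  have := Fintype.ofFinite A
  refine (LS.finset_sum Finset.univ fun b => (LS.indicator (hg b)).mul (hF b)).congr fun a => ?_
  simp

theorem comp [Finite A] {g : α → A} (hg : LSF g) (φ : A → B) : LSF (fun a => φ (g a)) := by
  classical
  intro b
  exact hg.cases (F := fun c _ => if φ c = b then 1 else 0) fun c => LS.const _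

theorem prod {g : α → A} {h : α → B} (hg : LSF g) (hh : LSF h) : LSF (fun a => (g a, h a)) :=
  fun b => ((hg b.1).and (hh b.2)).congr fun _ => Prod.ext_iff

theorem pi {k : ℕ} {g : α → Fin k → A} (hg : ∀ i, LSF (fun a => g a i)) : LSF g :=
  fun b => (LSP.forall_fin fun i => hg i (b i)).congr fun _ => funext_iff

theorem of_lt {f : α → ℕ} (hf : LS f) {n : ℕ} (hn : ∀ a, f a < n) (φ : ℕ → A) :
    LSF (fun a => φ (f a)) := by
  have h : LSF (fun a => (⟨f a, hn a⟩ : Fin n)) := fun b =>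
    (LSP.eq hf (LS.const b)).congr fun a => Fin.ext_iff
  exact h.comp fun i => φ i

theorem inputSymbol {f : α → ℕ} (hf : LS f) : LSF (fun a => inputSymbol (Ctx.inp a) (f a)) :=
  fun b => LSP.test hf (fun i => i = b)

theorem holds [Finite A] {g : α → A} (hg : LSF g) (p : A → Prop) : LSP (fun a => p (g a)) := by
  classical
  exact hg.cases (F := fun c _ => if p c then 1 else 0) fun c => LS.const _

end LSF

end

instance : Finite InputSymbol :=
  Finite.of_surjective ![.leftEnd, .bit true, .bit false, .rightEnd] fun p => by
    rcases p with _ | (_ | _) | _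
    exacts [⟨0, rfl⟩, ⟨2, rfl⟩, ⟨1, rfl⟩, ⟨3, rfl⟩]

/-! ### Tuples -/

/-- A tuple as a number. -/
def tup : (m : ℕ) → (Fin m → ℕ) → ℕ
  | 0, _ => 0
  | m + 1, v => Nat.pair (v 0) (tup m fun i => v i.succ)

/-- The entries of a tuple. -/
def entry : ℕ → ℕ → ℕ
  | 0, c => (Nat.unpair c).1
  | i + 1, c => entry i (Nat.unpair c).2

theorem entry_tup {m : ℕ} (v : Fin m → ℕ) (i : Fin m) : entry i (tup m v) = v i := by
  induction m with
  | zero => exact i.elim0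
  | succ m ih =>
    refine Fin.cases ?_ (fun i => ?_) i
    · simp [entry, tup]
    · simp [entry, tup, ih]

/-- A bound for tuples. -/
def tupBound : ℕ → ℕ → ℕ
  | 0, _ => 0
  | m + 1, B => (B + tupBound m B + 1) ^ 2

theorem pair_le (a b : ℕ) : Nat.pair a b ≤ (a + b + 1) ^ 2 :=
  (Nat.pair_lt_max_add_one_sq a b).le.trans (Nat.pow_le_pow_left (by omega) 2)

theorem tup_le {m B : ℕ} (v : Fin m → ℕ) (hv : ∀ i, v i ≤ B) : tup m v ≤ tupBound m B := by
  induction m with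
  | zero => exact le_rfl
  | succ m ih =>
    refine (pair_le _ _).trans (Nat.pow_le_pow_left ?_ 2)
    have := ih (fun i => v i.succ) fun i => hv _
    have := hv 0
    omega

section

variable {α : Type} [Ctx α]

theorem LS.entry {f : α → ℕ} (hf : LS f) (i : ℕ) : LS (fun a => entry i (f a)) := by
  induction i generalizing f with
  | zero => exact hf.unpair_fst
  | succ i ih => exact ih hf.unpair_snd

theorem LS.tup {m : ℕ} {f : Fin m → α → ℕ} (hf : ∀ i, LS (f i)) :
    LS (fun a => tup m fun i => f i a) := by
  induction m with
  | zero => exact LS.zero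
  | succ m ih => exact (hf 0).pair (ih fun i => hf i.succ)

theorem PolyBdd.tupBound {f : α → ℕ} (hf : PolyBdd f) (m : ℕ) :
    PolyBdd (fun a => tupBound m (f a)) := by
  induction m with
  | zero => exact .const 0
  | succ m ih => exact ((hf.add ih).add (.const 1)).pow 2

end

/-! ### Digits -/

/-- The number with the digits `d 0, …, d (l - 1)` in base `b`. -/
def digitSum (b l : ℕ) (d : ℕ → ℕ) : ℕ := ∑ p ∈ Finset.range l, d p * b ^ p

theorem digitSum_lt {b l : ℕ} {d : ℕ → ℕ} (hd : ∀ p, d p < b) : digitSum b l d < b ^ l := by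
  induction l with
  | zero => simp [digitSum]
  | succ l ih =>
    unfold digitSum at ih ⊢
    rw [Finset.sum_range_succ, pow_succ']
    have : (d l + 1) * b ^ l ≤ b * b ^ l := Nat.mul_le_mul_right _ (hd l)
    rw [add_mul] at this
    omega

/-- The digits below `j` form a number less than `b ^ j` and disappear in the division; those above
contribute a multiple of `b`. -/
theorem digitSum_div_mod {b l j : ℕ} {d : ℕ → ℕ} (hd : ∀ p, d p < b) (hj : j < l) :
    digitSum b l d / b ^ j % b = d j := by
  have hb : 0 < b := (Nat.zero_le _).trans_lt (hd 0)
  obtain ⟨k, rfl⟩ : ∃ k, l = j + 1 + k := ⟨l - (j + 1), by omega⟩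
  have : digitSum b (j + 1 + k) d =
      digitSum b j d + b ^ j * (d j + b * ∑ p ∈ Finset.range k, d (j + 1 + p) * b ^ p) := by
    unfold digitSum
    rw [Finset.sum_range_add, Finset.sum_range_succ, mul_add, Finset.mul_sum, Finset.mul_sum,
      add_assoc, mul_comm (d j)]
    congr 2
    refine Finset.sum_congr rfl fun p _ => ?_
    ring
  rw [this, Nat.add_mul_div_left _ _ (pow_pos hb j), Nat.div_eq_of_lt (digitSum_lt hd), zero_add,
    Nat.add_mul_mod_self_left, Nat.mod_eq_of_lt (hd j)]

/-- The new digit is added before the old one is removed, so that the truncated subtraction is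
exact. -/
theorem digitSum_update {b l j : ℕ} {d : ℕ → ℕ} (v : ℕ) (hj : j < l) :
    digitSum b l (Function.update d j v) = digitSum b l d + v * b ^ j - d j * b ^ j := by
  unfold digitSum
  have hm := Finset.mem_range.2 hj
  rw [← Finset.add_sum_erase _ _ hm, ← Finset.add_sum_erase _ (fun p => d p * b ^ p) hm]
  have : ∑ p ∈ (Finset.range l).erase j, Function.update d j v p * b ^ p =
      ∑ p ∈ (Finset.range l).erase j, d p * b ^ p :=
    Finset.sum_congr rfl fun p hp => by rw [Function.update_of_ne (Finset.ne_of_mem_erase hp)]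
  rw [this, Function.update_self]
  omega

/-! ### Configurations as numbers -/

/-- A numbering of a finite type such that a given element has the number `0`. -/
structure FinCode (A : Type) (a₀ : A) where
  n : ℕ
  enc : A → ℕ
  dec : ℕ → A
  dec_enc : ∀ a, dec (enc a) = a
  enc_lt : ∀ a, enc a < n
  enc_zero : enc a₀ = 0

/-- The number 0 is reserved for `a₀`, and an arbitrary enumeration of the others is shifted by one.
-/
theorem FinCode.exists (A : Type) [Finite A] (a₀ : A) : Nonempty (FinCode A a₀) := by
  classical
  obtain ⟨n, ⟨e⟩⟩ := Finite.exists_equiv_fin A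
  have hinj : Function.Injective fun a => if a = a₀ then 0 else (e a : ℕ) + 1 := by
    intro a b h
    dsimp only at h
    split_ifs at h with h1 h2 h2
    · rw [h1, h2]
    · exact e.injective (Fin.ext (by omega))
  have : Nonempty A := ⟨a₀⟩
  refine ⟨⟨n + 1, fun a => if a = a₀ then 0 else (e a : ℕ) + 1, Function.invFun _,
    Function.leftInverse_invFun hinj, fun a => ?_, by simp⟩⟩
  have := (e a).2
  split_ifs <;> omega

namespace Machine

variable {C : Type} (M : Machine C)

/-- What a machine sees in one step. -/
abbrev View : Type := M.State × InputSymbol × (Fin M.tapes → M.Symbol)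

/-- What the machine sees in the configuration `q`. -/
def view (x : List Bool) (q : M.Cfg) : M.View :=
  (q.state, inputSymbol x q.inputPos, fun i => q.work i (q.workPos i))

variable {M} (E : FinCode M.State M.start) (S : FinCode M.Symbol M.blank)

/-- The number of a configuration, where `l` cells of each tape are taken into account. -/
def cfgCode (l : ℕ) (q : M.Cfg) : ℕ :=
  Nat.pair (E.enc q.state) (Nat.pair q.inputPos (Nat.pair
    (tup M.tapes fun i => digitSum (S.n + 1) l fun p => S.enc (q.work i p))
    (tup M.tapes fun i => (S.n + 1) ^ q.workPos i)))

/-- The code of the position of the input head. -/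
def posCode (c : ℕ) : ℕ := (Nat.unpair (Nat.unpair c).2).1

/-- The code of the content of tape `i`. -/
def contentCode (c i : ℕ) : ℕ := entry i (Nat.unpair (Nat.unpair (Nat.unpair c).2).2).1

/-- The power of the base that stands for the head position on tape `i`. -/
def powCode (c i : ℕ) : ℕ := entry i (Nat.unpair (Nat.unpair (Nat.unpair c).2).2).2

/-- What the machine sees in the configuration with code `c`. -/
def viewCode (x : List Bool) (c : ℕ) : M.View :=
  (E.dec ((Nat.unpair c).1 % E.n), inputSymbol x (posCode c),
    fun i => S.dec (contentCode c i / powCode c i % (S.n + 1)))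

/-- The power of the base `b` after a head movement. -/
def movePow (b : ℕ) : Move → ℕ → ℕ
  | .left, P => max (P / b) 1
  | .stay, P => P
  | .right, P => P * b

/-- The code of the configuration after an action. -/
def actCode (x : List Bool) (A : Action M.State M.Symbol M.tapes) (w : Fin M.tapes → M.Symbol)
    (c : ℕ) : ℕ :=
  Nat.pair (E.enc A.state) (Nat.pair (min (A.moveInput.apply (posCode c)) (x.length + 1)) (Nat.pair
    (tup M.tapes fun i => contentCode c i + S.enc (A.write i) * powCode c i -
      S.enc (w i) * powCode c i)
    (tup M.tapes fun i => movePow (S.n + 1) (A.moveWork i) (powCode c i))))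

/-- The code of the next configuration when the machine sees `v`. -/
def nextCode (d : C) (x : List Bool) (v : M.View) (c : ℕ) : ℕ :=
  match M.trans v.1 v.2.1 v.2.2 with
  | none => c
  | some f => actCode E S x (f d) v.2.2 c

/-- The code of the next configuration. -/
def stepCode (d : C) (x : List Bool) (c : ℕ) : ℕ := nextCode E S d x (viewCode E S x c) c

theorem viewCode_cfgCode (x : List Bool) {l : ℕ} {q : M.Cfg} (hq : ∀ i, q.workPos i < l) :
    viewCode E S x (cfgCode E S l q) = M.view x q := by
  unfold viewCode view posCode contentCode powCode cfgCode
  simp only [Nat.unpair_pair, entry_tup]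
  congr
  · rw [Nat.mod_eq_of_lt (E.enc_lt _), E.dec_enc]
  · funext i
    rw [digitSum_div_mod (fun p => (S.enc_lt _).trans (Nat.lt_succ_self _)) (hq i), S.dec_enc]

theorem movePow_pow {b : ℕ} (hb : 0 < b) (d : Move) (p : ℕ) :
    movePow b d (b ^ p) = b ^ d.apply p := by
  cases d
  · simp only [movePow, Move.apply]
    rcases p with _ | p
    · simp only [pow_zero, zero_tsub, sup_eq_right]
      exact Nat.div_le_self 1 b
    · rw [pow_succ, Nat.mul_div_cancel _ hb, Nat.add_sub_cancel]
      exact max_eq_left (Nat.one_le_pow _ _ hb)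
  · rfl
  · exact (pow_succ _ _).symm

/-- Since the code stores a power of the base for each head, reading a cell is division and
remainder, writing is one update of a digit, and moving multiplies or divides the power. This is
correct as long as the heads are within the `l` cells that are recorded. -/
theorem stepCode_cfgCode (d : C) (x : List Bool) {l : ℕ} {q : M.Cfg}
    (hq : ∀ i, q.workPos i < l) :
    stepCode E S d x (cfgCode E S l q) = cfgCode E S l (M.step x q d) := by
  unfold stepCode
  rw [viewCode_cfgCode E S x hq]
  unfold nextCode step next view
  dsimp only
  cases M.trans q.state (inputSymbol x q.inputPos) (fun i => q.work i (q.workPos i)) with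
  | none => rfl
  | some f =>
    dsimp only
    unfold actCode posCode contentCode powCode cfgCode
    simp only [Nat.unpair_pair, entry_tup]
    congr
    · funext i
      rw [← digitSum_update _ (hq i)]
      congr
      funext p
      by_cases hp : p = q.workPos i
      · subst hp; simp
      · simp [hp]
    · funext i
      exact movePow_pow (Nat.succ_pos _) _ _

/-! ### Computability of the step on codes -/

section

variable {α : Type} [Ctx α]

theorem ls_posCode {f : α → ℕ} (hf : LS f) : LS (fun a => posCode (f a)) :=
  hf.unpair_snd.unpair_fst

theorem ls_contentCode {f : α → ℕ} (hf : LS f) (i : ℕ) : LS (fun a => contentCode (f a) i) :=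
  hf.unpair_snd.unpair_snd.unpair_fst.entry i

theorem ls_powCode {f : α → ℕ} (hf : LS f) (i : ℕ) : LS (fun a => powCode (f a) i) :=
  hf.unpair_snd.unpair_snd.unpair_snd.entry i

theorem ls_viewCode {f : α → ℕ} (hf : LS f) : LSF (fun a => viewCode E S (Ctx.inp a) (f a)) := by
  refine .prod ?_ (.prod ?_ (.pi fun i => ?_))
  · exact .of_lt (hf.unpair_fst.mod (.const E.n))
      (fun a => Nat.mod_lt _ ((Nat.zero_le _).trans_lt (E.enc_lt M.start))) E.dec
  · exact .inputSymbol (ls_posCode hf)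
  · exact .of_lt (((ls_contentCode hf i).div (ls_powCode hf i)).mod (.const (S.n + 1)))
      (fun a => Nat.mod_lt _ (Nat.succ_pos _)) S.dec

theorem ls_move {f : α → ℕ} (hf : LS f) (d : Move) : LS (fun a => d.apply (f a)) := by
  cases d
  exacts [hf.pred, hf, hf.succ]

theorem ls_movePow {f : α → ℕ} (hf : LS f) (b : ℕ) (d : Move) :
    LS (fun a => movePow b d (f a)) := by
  cases d
  exacts [(hf.div (.const b)).natMax (.const 1), hf, hf.mul (.const b)]

instance : Finite M.State := M.finite_state

instance : Finite M.Symbol := M.finite_symbol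

theorem ls_stepCode (d : C) {f : α → ℕ} (hf : LS f) :
    LS (fun a => stepCode E S d (Ctx.inp a) (f a)) := by
  refine (ls_viewCode E S hf).cases (F := fun v a => nextCode E S d (Ctx.inp a) v (f a))
    fun v => ?_
  unfold nextCode
  cases M.trans v.1 v.2.1 v.2.2 with
  | none => exact hf
  | some g =>
    exact (LS.const _).pair (((ls_move (ls_posCode hf) _).natMin LS.length.succ).pair
      ((LS.tup fun i => ((ls_contentCode hf i).add ((LS.const _).mul (ls_powCode hf i))).sub
        ((LS.const _).mul (ls_powCode hf i))).pair
      (LS.tup fun i => ls_movePow (ls_powCode hf i) _ _)))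

end

/-- The start state and the blank have number 0 and every head stands at `b ^ 0`, so the code is a
constant, independent of `l`; the number of cells never has to be computed. -/
theorem cfgCode_init (l : ℕ) : cfgCode E S l M.init = Nat.pair 0 (Nat.pair 0 (Nat.pair
    (tup M.tapes fun _ => 0) (tup M.tapes fun _ => 1))) := by
  simp [cfgCode, init, E.enc_zero, S.enc_zero, digitSum]

theorem inputPos_run_le (x : List Bool) (r : List C) : (M.run x r).inputPos ≤ x.length + 1 := by
  induction r using List.reverseRecOn with
  | nil => simp [run, init]
  | append_singleton r c ih =>
    unfold run at ih ⊢
    rw [List.foldl_append]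
    simp only [List.foldl_cons, List.foldl_nil, step]
    split
    · exact ih
    · exact min_le_right _ _

/-- The number of cells that are taken into account on inputs of length `n`. -/
def cells (c n : ℕ) : ℕ := c * (Nat.log 2 n + 1) + 1

/-- A constant to a power `O(log n)` is polynomial in `n`: replace `b` by `2 ^ b` and use `2 ^ log n
≤ n + 1`. -/
theorem polyBdd_pow_cells (b c : ℕ) :
    PolyBdd (fun x : List Bool => b ^ cells c x.length) := by
  refine (((PolyBdd.sz.add (.const 1)).pow (b * c)).mul (.const (2 ^ (b * c + b)))).mono
    fun x => ?_
  rw [sz_list]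
  have h1 : 2 ^ Nat.log 2 x.length ≤ x.length + 1 := by
    rcases Nat.eq_zero_or_pos x.length with h | h
    · simp [h]
    · exact (Nat.pow_log_le_self 2 h.ne').trans (Nat.le_succ _)
  calc b ^ cells c x.length ≤ (2 ^ b) ^ cells c x.length :=
        Nat.pow_le_pow_left (Nat.lt_two_pow_self).le _
    _ = (2 ^ Nat.log 2 x.length) ^ (b * c) * 2 ^ (b * c + b) := by
        rw [← pow_mul, ← pow_mul, ← pow_add]; congr 1; unfold cells; ring
    _ ≤ _ := Nat.mul_le_mul_right _ (Nat.pow_le_pow_left h1 _)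

/-- Each tape content and each head power is at most the base to the number of cells, hence
polynomial, and pairing is polynomial as well. -/
theorem exists_cfgCode_lt {c : ℕ} (hc : ∀ (x : List Bool) (r : List C) (i : Fin M.tapes),
    (M.run x r).workPos i ≤ c * (Nat.log 2 x.length + 1)) :
    ∃ e, ∀ x r, cfgCode E S (cells c x.length) (M.run x r) < (x.length + 2) ^ e := by
  have hB := polyBdd_pow_cells (S.n + 1) c
  have hl : PolyBdd (fun x : List Bool => x.length) := PolyBdd.sz.mono fun x => by simp
  let P : ℕ → ℕ → ℕ := fun a b => (a + b + 1) ^ 2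
  have hP : ∀ {f g : List Bool → ℕ}, PolyBdd f → PolyBdd g → PolyBdd fun x => P (f x) (g x) :=
    fun hf hg => ((hf.add hg).add (.const 1)).pow 2
  have hmono : ∀ {a b a' b'}, a ≤ a' → b ≤ b' → Nat.pair a b ≤ P a' b' := fun h h' =>
    (pair_le _ _).trans (Nat.pow_le_pow_left (by omega) 2)
  obtain ⟨e, he⟩ := (hP (.const E.n) (hP (hl.add (.const 1)) (hP (hB.tupBound M.tapes)
    (hB.tupBound M.tapes)))).add (.const 1)
  refine ⟨e, fun x r => ?_⟩
  have he' := he x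
  rw [sz_list] at he'
  refine lt_of_lt_of_le (Nat.lt_succ_of_le ?_) he'
  refine hmono (E.enc_lt _).le (hmono (inputPos_run_le x r) (hmono (tup_le _ fun i => ?_)
    (tup_le _ fun i => ?_)))
  · exact (digitSum_lt fun p => (S.enc_lt _).trans (Nat.lt_succ_self _)).le
  · exact Nat.pow_le_pow_right (Nat.succ_pos _) ((hc x r i).trans (Nat.le_succ _))

theorem run_append (x : List Bool) (r : List C) (d : C) :
    M.run x (r ++ [d]) = M.step x (M.run x r) d := by
  simp [run]

end Machine


/-! ### Switching flows -/

namespace SwitchGraph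

theorem move_eq {V : Type} [DecidableEq V] (G : SwitchGraph V) (q : V × (V → Bool)) :
    G.move q = (if q.2 q.1 then G.s₁ q.1 else G.s₀ q.1, Function.update q.2 q.1 (!q.2 q.1)) := rfl

section

variable {V : Type} [DecidableEq V] [Fintype V] (G : SwitchGraph V)

/-- How often the train enters `v` if it leaves every vertex `u` exactly `N u` times. -/
def inflow (N : V → ℕ) (v : V) : ℕ :=
  ∑ u, ((if G.s₀ u = v then (N u + 1) / 2 else 0) + (if G.s₁ u = v then N u / 2 else 0))

theorem inflow_mono {N A : V → ℕ} (h : ∀ u, N u ≤ A u) (v : V) :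
    G.inflow N v ≤ G.inflow A v := by
  refine Finset.sum_le_sum fun u _ => ?_
  have := h u
  split_ifs <;> omega

/-- The parity of the number of earlier departures is the state of the switch, which decides which
of the two halves grows. -/
theorem inflow_update (N : V → ℕ) (p v : V) :
    G.inflow (Function.update N p (N p + 1)) v =
      G.inflow N v + if (if N p % 2 = 1 then G.s₁ p else G.s₀ p) = v then 1 else 0 := by
  unfold inflow
  rw [← Finset.add_sum_erase _ _ (Finset.mem_univ p),
    ← Finset.add_sum_erase (a := p) _ (fun u => (if G.s₀ u = v then (N u + 1) / 2 else 0) +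
      (if G.s₁ u = v then N u / 2 else 0)) (Finset.mem_univ p)]
  have : ∀ u ∈ Finset.univ.erase p, Function.update N p (N p + 1) u = N u := fun u hu => by
    rw [Function.update_of_ne (Finset.ne_of_mem_erase hu)]
  rw [Finset.sum_congr rfl fun u hu => by rw [this u hu]]
  simp only [Function.update_self]
  split_ifs <;> omega

/-- If numbers of departures are given such that every vertex other than `t` is left at least as
often as it is entered, then the train reaches `t`. -/
theorem reaches_of_inflow_le {s t : V} (A : V → ℕ)
    (hA : ∀ v ≠ t, (if s = v then 1 else 0) + G.inflow A v ≤ A v) : G.Reaches s t := by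
  by_contra hr
  -- `N` counts the departures during the first `k` moves. Its parities are the switch states, and
  -- the last clause is conservation of the flow.
  have key : ∀ k : ℕ, ∃ N : V → ℕ, ∑ u, N u = k ∧ (∀ u, N u ≤ A u) ∧
      (∀ u, (G.move^[k] (s, fun _ => false)).2 u = decide (N u % 2 = 1)) ∧
      ∀ v, N v + (if G.train s k = v then 1 else 0) =
        (if s = v then 1 else 0) + G.inflow N v := by
    intro k
    induction k with
    | zero => exact ⟨fun _ => 0, by simp, by simp, by simp, fun v => by
      change 0 + (if s = v then 1 else 0) = _
      simp [inflow]⟩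
    | succ k ih =>
      obtain ⟨N, h1, h2, h3, h4⟩ := ih
      have hp : G.train s k ≠ t := fun h => hr ⟨k, h⟩
      have htr : G.train s (k + 1) =
          if N (G.train s k) % 2 = 1 then G.s₁ (G.train s k) else G.s₀ (G.train s k) := by
        unfold train
        rw [Function.iterate_succ_apply']
        rw [move_eq, h3]
        simp
      generalize hpp : G.train s k = p at *
      refine ⟨Function.update N p (N p + 1), ?_, fun u => ?_, fun u => ?_, fun v => ?_⟩
      · rw [Finset.sum_update_of_mem (Finset.mem_univ p), ← h1,
          ← Finset.add_sum_erase _ _ (Finset.mem_univ p), Finset.sdiff_singleton_eq_erase]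
        omega
      -- The train is now at `p`, so conservation gives `N p + 1` as start plus inflow of `N`; by
      -- monotonicity this is at most start plus inflow of `A`, hence at most `A p`. The hypothesis
      -- at `p` is available because `p ≠ t`.
      · by_cases hu : u = p
        · subst hu
          have h5 := h4 u
          have h6 := hA u hp
          have h7 := G.inflow_mono h2 u
          simp only [if_true] at h5
          simp only [Function.update_self]
          omega
        · simpa [hu] using h2 u
      · rw [Function.iterate_succ_apply']
        have hpos : (G.move^[k] (s, fun _ => false)).1 = p := hpp
        rw [move_eq, hpos]
        by_cases hu : u = p
        · subst hu
          simp only [Function.update_self, h3]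
          by_cases hN : N u % 2 = 1
          · simp [hN, show (N u + 1) % 2 = 0 by omega]
          · simp [hN, show (N u + 1) % 2 = 1 by omega]
        · simp [hu, h3]
      · rw [inflow_update, htr, ← add_assoc, ← h4 v]
        by_cases hv : v = p
        · subst hv; simp
        · simp [hv, Ne.symm hv]
  -- One move more than `A` allows in total.
  obtain ⟨N, h1, h2, -⟩ := key (∑ u, A u + 1)
  have := Finset.sum_le_sum fun u (_ : u ∈ Finset.univ) => h2 u
  omega

end

section

variable {V : Type} [DecidableEq V] {G : SwitchGraph V}

theorem train_add_of_absorbing {s t : V} {k : ℕ} (h0 : G.s₀ t = t) (h1 : G.s₁ t = t)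
    (hk : G.train s k = t) (j : ℕ) : G.train s (k + j) = t := by
  induction j with
  | zero => exact hk
  | succ j ih =>
    unfold train at ih ⊢
    rw [← add_assoc, Function.iterate_succ_apply']
    rw [move_eq, ih, h0, h1, ite_self]

/-- A train that reached both absorbing vertices, at times `k` and `k'`, would be at both of them at
time `k + k'`. -/
theorem not_reaches_of_reaches {s t t' : V} (htt : t ≠ t') (h0 : G.s₀ t = t) (h1 : G.s₁ t = t)
    (h0' : G.s₀ t' = t') (h1' : G.s₁ t' = t') (h : G.Reaches s t) : ¬ G.Reaches s t' := by
  rintro ⟨k', hk'⟩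
  obtain ⟨k, hk⟩ := h
  have e1 := train_add_of_absorbing h0 h1 hk k'
  have e2 := train_add_of_absorbing h0' h1' hk' k
  rw [add_comm] at e2
  exact htt (e1.symm.trans e2)

/-- An injective map that commutes with the switches preserves reachability. -/
theorem reaches_map_iff {W : Type} [DecidableEq W] {H : SwitchGraph W} {φ : V → W}
    (hφ : Function.Injective φ) (h0 : ∀ v, H.s₀ (φ v) = φ (G.s₀ v))
    (h1 : ∀ v, H.s₁ (φ v) = φ (G.s₁ v)) (s t : V) : H.Reaches (φ s) (φ t) ↔ G.Reaches s t := by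
  have key : ∀ k, (H.move^[k] (φ s, fun _ => false)).1 = φ (G.move^[k] (s, fun _ => false)).1 ∧
      ∀ v, (H.move^[k] (φ s, fun _ => false)).2 (φ v) =
        (G.move^[k] (s, fun _ => false)).2 v := by
    intro k
    induction k with
    | zero => simp
    | succ k ih =>
      obtain ⟨i1, i2⟩ := ih
      simp only [Function.iterate_succ_apply', move_eq, i1, i2, h0, h1]
      refine ⟨by split_ifs <;> rfl, fun v => ?_⟩
      by_cases hv : v = (G.move^[k] (s, fun _ => false)).1
      · subst hv; simp
      · rw [Function.update_of_ne hv, Function.update_of_ne (hφ.ne hv), i2]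
  unfold Reaches train
  simp only [(key _).1, hφ.eq_iff]

end

end SwitchGraph

/-! ### Layered networks -/

/-- A layered network: in layer `j` one passes from `c` to `f j b c`, where `b` is the state of the
switch at `c`. In the last layer `T` the elements of `F` are accepting. The network is traversed
`2 ^ d` times. -/
structure Network (X : Type) where
  f : ℕ → Bool → X → X
  x₀ : X
  F : X → Bool
  T : ℕ
  d : ℕ
  /-- whether all but one of the traversals count as accepting anyway, or only almost half -/
  e : Bool

namespace Network

variable {X : Type} (𝒩 : Network X)

/-- The vertices of the switch graph of a network: the points of the layers, the launching chain,
whose last vertex is a dead end, and the counter of the accepting traversals, whose last vertex is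
the destination. -/
abbrev Vertex : Type := (Fin (𝒩.T + 1) × X) ⊕ Fin (𝒩.d + 2) ⊕ Fin (𝒩.d + 1)

/-- A vertex of a layer. -/
abbrev node (p : Fin (𝒩.T + 1) × X) : 𝒩.Vertex := .inl p

/-- A vertex of the launching chain. -/
abbrev launch (i : Fin (𝒩.d + 2)) : 𝒩.Vertex := .inr (.inl i)

/-- A vertex of the counter. -/
abbrev count (i : Fin (𝒩.d + 1)) : 𝒩.Vertex := .inr (.inr i)

theorem launch_inj {i j : Fin (𝒩.d + 2)} : 𝒩.launch i = 𝒩.launch j ↔ (i : ℕ) = j :=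
  ⟨fun h => congrArg Fin.val (Sum.inl.inj (Sum.inr.inj h)), fun h => by rw [Fin.ext h]⟩

theorem count_inj {i j : Fin (𝒩.d + 1)} : 𝒩.count i = 𝒩.count j ↔ (i : ℕ) = j :=
  ⟨fun h => congrArg Fin.val (Sum.inr.inj (Sum.inr.inj h)), fun h => by rw [Fin.ext h]⟩

theorem count_cases (i : Fin (𝒩.d + 1)) : i = 0 ∨ ∃ j : Fin 𝒩.d, i = j.succ :=
  i.cases (Or.inl rfl) fun j => Or.inr ⟨j, rfl⟩

/-- The successor of a vertex of a layer. -/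
def nodeSucc (b : Bool) (p : Fin (𝒩.T + 1) × X) : 𝒩.Vertex :=
  if h : (p.1 : ℕ) < 𝒩.T then 𝒩.node (⟨p.1 + 1, by omega⟩, 𝒩.f p.1 b p.2)
  else if 𝒩.F p.2 then 𝒩.count 0 else 𝒩.launch 0

/-- The successor of a vertex of the launching chain. -/
def launchSucc (b : Bool) (i : Fin (𝒩.d + 2)) : 𝒩.Vertex :=
  if h : (i : ℕ) ≤ 𝒩.d then
    if b then 𝒩.launch ⟨i + 1, by omega⟩
    else if (i : ℕ) = 0 then 𝒩.node (0, 𝒩.x₀)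
    else if (i : ℕ) = 1 ∧ 𝒩.e = false then 𝒩.launch 0
    else 𝒩.count 0
  else 𝒩.launch i

/-- The successor of a vertex of the counter. -/
def countSucc (b : Bool) (i : Fin (𝒩.d + 1)) : 𝒩.Vertex :=
  if h : (i : ℕ) < 𝒩.d then if b then 𝒩.count ⟨i + 1, by omega⟩ else 𝒩.launch 0
  else 𝒩.count i

/-- The successor of a vertex for a given state of the switch. -/
def next (b : Bool) : 𝒩.Vertex → 𝒩.Vertex :=
  Sum.elim (𝒩.nodeSucc b) (Sum.elim (𝒩.launchSucc b) (𝒩.countSucc b))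

/-- The switch graph of a network. -/
def graph : SwitchGraph 𝒩.Vertex where
  s₀ := 𝒩.next false
  s₁ := 𝒩.next true

/-! ### Flow through a network -/

variable [Fintype X] [DecidableEq X]

/-- The number of traversals through a given point. -/
def cnt : ℕ → X → ℕ
  | 0, c => if c = 𝒩.x₀ then 2 ^ 𝒩.d else 0
  | j + 1, c' => ∑ c, ((if 𝒩.f j false c = c' then (cnt j c + 1) / 2 else 0) +
      (if 𝒩.f j true c = c' then cnt j c / 2 else 0))

/-- The number of accepting traversals. -/
def acc : ℕ := ∑ c, if 𝒩.F c then 𝒩.cnt 𝒩.T c else 0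

/-- The flow tested against a function `φ` on the points. It gives conservation of the traversals
for `φ = 1`, and later the comparison with random computations. -/
theorem sum_cnt_mul (j : ℕ) (φ : X → ℕ) : ∑ c, 𝒩.cnt (j + 1) c * φ c =
    ∑ c, ((𝒩.cnt j c + 1) / 2 * φ (𝒩.f j false c) + 𝒩.cnt j c / 2 * φ (𝒩.f j true c)) := by
  simp only [cnt, Finset.sum_mul]
  rw [Finset.sum_comm]
  refine Finset.sum_congr rfl fun c _ => ?_
  simp only [add_mul, ite_mul, zero_mul, Finset.sum_add_distrib, Finset.sum_ite_eq,
    Finset.mem_univ, if_true]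

theorem sum_cnt (j : ℕ) : ∑ c, 𝒩.cnt j c = 2 ^ 𝒩.d := by
  induction j with
  | zero => simp [cnt]
  | succ j ih =>
    have := 𝒩.sum_cnt_mul j fun _ => 1
    simp only [mul_one] at this
    rw [this, ← ih]
    refine Finset.sum_congr rfl fun c _ => ?_
    omega

theorem acc_add : (∑ c, if 𝒩.F c then 0 else 𝒩.cnt 𝒩.T c) + 𝒩.acc = 2 ^ 𝒩.d := by
  rw [acc, ← Finset.sum_add_distrib, ← 𝒩.sum_cnt 𝒩.T]
  refine Finset.sum_congr rfl fun c _ => ?_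
  split_ifs <;> simp

/-- The number of traversals that are counted as accepting anyway. -/
def extra : ℕ := if 𝒩.e then 2 ^ 𝒩.d - 1 else 2 ^ (𝒩.d - 1) - 1

/-- The number of departures from the vertices; `y` is `1` if the destination is reached, and `0`
otherwise. -/
def departures (y : ℕ) : 𝒩.Vertex → ℕ :=
  Sum.elim (fun p => 𝒩.cnt p.1 p.2) (Sum.elim (fun i => 2 ^ (𝒩.d + 1 - i) - y)
    (fun i => (𝒩.acc + 𝒩.extra) / 2 ^ (i : ℕ)))

/-- Of the trains that enter a counter vertex, the larger half is sent back and the smaller half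
continues; the sum telescopes. -/
theorem sum_div_two_pow (W k : ℕ) :
    ∑ i ∈ Finset.range k, (W / 2 ^ i + 1) / 2 + W / 2 ^ k = W := by
  induction k with
  | zero => simp
  | succ k ih =>
    rw [Finset.sum_range_succ, pow_succ, ← Nat.div_div_eq_div_mul]
    omega

theorem inflow_departures (y : ℕ) (v : 𝒩.Vertex) : 𝒩.graph.inflow (𝒩.departures y) v =
    (∑ p : Fin (𝒩.T + 1) × X, ((if 𝒩.nodeSucc false p = v then (𝒩.cnt p.1 p.2 + 1) / 2 else 0) +
      (if 𝒩.nodeSucc true p = v then 𝒩.cnt p.1 p.2 / 2 else 0))) +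
    ((∑ i : Fin (𝒩.d + 2),
      ((if 𝒩.launchSucc false i = v then (2 ^ (𝒩.d + 1 - i) - y + 1) / 2 else 0) +
      (if 𝒩.launchSucc true i = v then (2 ^ (𝒩.d + 1 - i) - y) / 2 else 0))) +
    (∑ i : Fin (𝒩.d + 1),
      ((if 𝒩.countSucc false i = v then ((𝒩.acc + 𝒩.extra) / 2 ^ (i : ℕ) + 1) / 2 else 0) +
      (if 𝒩.countSucc true i = v then (𝒩.acc + 𝒩.extra) / 2 ^ (i : ℕ) / 2 else 0)))) := by
  unfold SwitchGraph.inflow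
  rw [Fintype.sum_sum_type, Fintype.sum_sum_type]
  rfl

/-- Layer 0 is entered only from `launch 0`, and layer `j + 1` only from layer `j`, as in the
recursion for `cnt`. -/
theorem inflow_node {y : ℕ} (hy : y ≤ 1) (p : Fin (𝒩.T + 1) × X) :
    𝒩.graph.inflow (𝒩.departures y) (𝒩.node p) = 𝒩.cnt p.1 p.2 := by
  rw [inflow_departures]
  have h3 : ∀ b i, 𝒩.countSucc b i ≠ 𝒩.node p := by
    intro b i; unfold countSucc; split_ifs <;> simp
  have h2 : ∀ i, 𝒩.launchSucc true i ≠ 𝒩.node p := by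
    intro i; unfold launchSucc; simp only [if_true]; split_ifs <;> simp
  have h2' : ∀ i, 𝒩.launchSucc false i = 𝒩.node p ↔ i = 0 ∧ p = (0, 𝒩.x₀) := by
    intro i; unfold launchSucc
    simp only [Bool.false_eq_true, if_false]
    split_ifs with h4 h5 h6
    · exact ⟨fun h => ⟨Fin.ext h5, (Sum.inl.inj h).symm⟩, fun h => by rw [h.2]⟩
    · exact ⟨fun h => by simp at h, fun h => absurd (congrArg Fin.val h.1) h5⟩
    · exact ⟨fun h => by simp at h, fun h => absurd (congrArg Fin.val h.1) h5⟩
    · exact ⟨fun h => by simp at h, fun h => absurd (by rw [h.1]; exact Nat.zero_le _) h4⟩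
  -- The larger half is unaffected by `y`: both certificates launch `2 ^ d` traversals.
  have e2 : (2 ^ (𝒩.d + 1) - y + 1) / 2 = 2 ^ 𝒩.d := by
    have : 0 < 2 ^ 𝒩.d := by positivity
    rw [pow_succ]; omega
  simp only [h3, h2, h2', if_false, add_zero, Finset.sum_const_zero]
  obtain ⟨j, c⟩ := p
  rcases j with ⟨_ | j, hj⟩
  · have h1 : ∀ b q, 𝒩.nodeSucc b q ≠ 𝒩.node (⟨0, hj⟩, c) := by
      intro b q; unfold nodeSucc; split_ifs <;> simp
    simp only [h1, if_false, add_zero, Finset.sum_const_zero, zero_add]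
    rw [Finset.sum_eq_single 0]
    · simp [cnt, e2, Prod.ext_iff]
    · intro i _ hi; simp [hi]
    · simp
  · have h1 : ∀ b q, 𝒩.nodeSucc b q = 𝒩.node (⟨j + 1, hj⟩, c) ↔
        q.1 = ⟨j, by omega⟩ ∧ 𝒩.f j b q.2 = c := by
      rintro b ⟨⟨q, hq⟩, c'⟩
      unfold nodeSucc
      split_ifs with h4 h5
      · simp only [Sum.inl.injEq, Prod.mk.injEq, Fin.mk.injEq, Nat.add_right_cancel_iff]
        constructor
        · rintro ⟨rfl, h⟩; exact ⟨rfl, h⟩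
        · rintro ⟨rfl, h⟩; exact ⟨rfl, h⟩
      · simp only [false_iff, not_and, Fin.mk.injEq]
        rintro rfl; simp at h4; omega
      · simp only [false_iff, not_and, Fin.mk.injEq]
        rintro rfl; simp at h4; omega
    have h0 : ¬ (((⟨j + 1, hj⟩, c) : Fin (𝒩.T + 1) × X) = (0, 𝒩.x₀)) := fun h =>
      absurd (congrArg (fun q => (q.1 : ℕ)) h) (Nat.succ_ne_zero j)
    simp only [h1, h0, and_false, if_false, Finset.sum_const_zero, add_zero]
    rw [Fintype.sum_prod_type, Finset.sum_eq_single ⟨j, by omega⟩]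
    · simp only [cnt, true_and]
    · intro i _ hi; simp [hi]
    · simp

theorem sum_nodeSucc_of_ne (v : 𝒩.Vertex) (hv : ∀ p, v ≠ 𝒩.node p) :
    (∑ p : Fin (𝒩.T + 1) × X, ((if 𝒩.nodeSucc false p = v then (𝒩.cnt p.1 p.2 + 1) / 2 else 0) +
      (if 𝒩.nodeSucc true p = v then 𝒩.cnt p.1 p.2 / 2 else 0))) =
    ∑ c, if (if 𝒩.F c then 𝒩.count 0 else 𝒩.launch 0) = v then 𝒩.cnt 𝒩.T c else 0 := by
  rw [Fintype.sum_prod_type, Finset.sum_eq_single (Fin.last 𝒩.T)]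
  · refine Finset.sum_congr rfl fun c _ => ?_
    simp only [nodeSucc, Fin.val_last, lt_irrefl, dite_false]
    split_ifs <;> omega
  · intro i _ hi
    have hi' : (i : ℕ) < 𝒩.T := Fin.val_lt_last hi
    refine Finset.sum_eq_zero fun c _ => ?_
    simp only [nodeSucc, hi', dite_true]
    rw [if_neg (hv _).symm, if_neg (hv _).symm, add_zero]
  · simp

/-- Trains come back from rejecting traversals, from `launch 1` if `e` is false, and from the
counter vertices below the top. The counter keeps only `(acc + extra) / 2 ^ d` trains, and the
accepting traversals cancel. -/
theorem inflow_launch_zero {y : ℕ} (hy : y ≤ 1) (hd : 0 < 𝒩.d) :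
    𝒩.graph.inflow (𝒩.departures y) (𝒩.launch 0) + 1 + (𝒩.acc + 𝒩.extra) / 2 ^ 𝒩.d =
      2 ^ (𝒩.d + 1) := by
  obtain ⟨d, hd'⟩ : ∃ d, 𝒩.d = d + 1 := ⟨𝒩.d - 1, by omega⟩
  rw [inflow_departures, sum_nodeSucc_of_ne _ _ (by simp)]
  have e1 : (∑ c, if (if 𝒩.F c then 𝒩.count 0 else 𝒩.launch 0) = 𝒩.launch 0 then 𝒩.cnt 𝒩.T c
      else 0) = ∑ c, if 𝒩.F c then 0 else 𝒩.cnt 𝒩.T c :=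
    Finset.sum_congr rfl fun c _ => by cases 𝒩.F c <;> simp
  have h2 : ∀ i, 𝒩.launchSucc true i ≠ 𝒩.launch 0 := by
    intro i; unfold launchSucc; simp only [if_true]
    split_ifs with h
    · exact fun h' => Nat.succ_ne_zero _ (𝒩.launch_inj.1 h')
    · simp only [ne_eq, Sum.inr.injEq, Sum.inl.injEq]
      rintro rfl; exact h (Nat.zero_le _)
  have h2' : ∀ i, 𝒩.launchSucc false i = 𝒩.launch 0 ↔ i = 1 ∧ 𝒩.e = false := by
    intro i; unfold launchSucc
    simp only [Bool.false_eq_true, if_false]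
    have hv : (i = 1) ↔ (i : ℕ) = 1 := by rw [Fin.ext_iff]; rfl
    split_ifs with h4 h5 h6
    · exact ⟨fun h => by simp at h, fun h => by have := hv.1 h.1; omega⟩
    · exact ⟨fun _ => ⟨hv.2 h6.1, h6.2⟩, fun _ => rfl⟩
    · exact ⟨fun h => by simp at h, fun h => absurd ⟨hv.1 h.1, h.2⟩ h6⟩
    · refine ⟨fun h => ?_, fun h => by have := hv.1 h.1; omega⟩
      simp only [Sum.inr.injEq, Sum.inl.injEq] at h
      subst h; exact absurd (Nat.zero_le _) h4
  have h3 : ∀ i, 𝒩.countSucc true i ≠ 𝒩.launch 0 := by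
    intro i; unfold countSucc; simp only [if_true]; split_ifs <;> simp
  have h3' : ∀ i, 𝒩.countSucc false i = 𝒩.launch 0 ↔ (i : ℕ) < 𝒩.d := by
    intro i; unfold countSucc; simp only [Bool.false_eq_true, if_false]
    split_ifs with h <;> simp [h]
  have e2 : (∑ i : Fin (𝒩.d + 2), if i = 1 ∧ 𝒩.e = false then
      (2 ^ (𝒩.d + 1 - (i : ℕ)) - y + 1) / 2 else 0) = if 𝒩.e then 0 else 2 ^ (𝒩.d - 1) := by
    rw [Finset.sum_eq_single 1]
    · cases 𝒩.e
      · have h4 : ((1 : Fin (𝒩.d + 2)) : ℕ) = 1 := rfl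
        have : 0 < 2 ^ d := by positivity
        simp only [h4, hd', Nat.add_sub_cancel, and_self, if_true, pow_succ,
          Bool.false_eq_true, if_false]
        omega
      · simp
    · intro i _ hi; simp [hi]
    · simp
  have e3 : (∑ i : Fin (𝒩.d + 1), if (i : ℕ) < 𝒩.d then
      ((𝒩.acc + 𝒩.extra) / 2 ^ (i : ℕ) + 1) / 2 else 0) + (𝒩.acc + 𝒩.extra) / 2 ^ 𝒩.d =
      𝒩.acc + 𝒩.extra := by
    rw [Fin.sum_univ_castSucc]
    simp only [Fin.val_castSucc, Fin.is_lt, if_true, Fin.val_last, lt_irrefl, if_false, add_zero]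
    rw [Fin.sum_univ_eq_sum_range (fun i => ((𝒩.acc + 𝒩.extra) / 2 ^ i + 1) / 2),
      sum_div_two_pow]
  simp only [e1, h2, h2', h3, h3', if_false, add_zero, e2]
  have h5 := 𝒩.acc_add
  -- Together the chain vertices from `launch 1` to `launch d` divert `2 ^ d - 1` trains, to the
  -- counter or, for `e` false, partly back to `launch 0`.
  have h6 : 𝒩.extra + (if 𝒩.e then 0 else 2 ^ (𝒩.d - 1)) + 1 = 2 ^ 𝒩.d := by
    have : 0 < 2 ^ d := by positivity
    unfold extra
    rw [hd', Nat.add_sub_cancel, pow_succ]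
    split_ifs <;> omega
  rw [pow_succ]
  omega

theorem sum_nodeSucc_launch (i : Fin (𝒩.d + 2)) (hi : i ≠ 0) :
    (∑ c, if (if 𝒩.F c then 𝒩.count 0 else 𝒩.launch 0) = 𝒩.launch i then 𝒩.cnt 𝒩.T c
      else 0) = 0 :=
  Finset.sum_eq_zero fun c _ => by cases 𝒩.F c <;> simp [hi.symm]

/-- The dead end is its own successor. For `i = d` the hypothesis `y = 1` makes its number of
departures 0, so the loop contributes nothing. -/
theorem inflow_launch_succ {y : ℕ} (i : Fin (𝒩.d + 1)) (hi : (i : ℕ) = 𝒩.d → y = 1) :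
    𝒩.graph.inflow (𝒩.departures y) (𝒩.launch i.succ) = (2 ^ (𝒩.d + 1 - i) - y) / 2 := by
  rw [inflow_departures, sum_nodeSucc_of_ne _ _ (by simp), sum_nodeSucc_launch _ _ (by simp)]
  have h0 : 𝒩.launch 0 ≠ 𝒩.launch i.succ := fun h' =>
    Nat.succ_ne_zero _ (𝒩.launch_inj.1 h').symm
  have h3 : ∀ b j, 𝒩.countSucc b j ≠ 𝒩.launch i.succ := by
    intro b j; unfold countSucc; split_ifs <;> first | exact h0 | simp
  have h2 : ∀ j, 𝒩.launchSucc false j = 𝒩.launch i.succ ↔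
      j = i.succ ∧ j = Fin.last (𝒩.d + 1) := by
    intro j; unfold launchSucc
    simp only [Bool.false_eq_true, if_false]
    have hj := j.2
    have hl : j = Fin.last (𝒩.d + 1) ↔ (j : ℕ) = 𝒩.d + 1 := by rw [Fin.ext_iff, Fin.val_last]
    split_ifs with h4 h5 h6
    · simp [hl]; omega
    · exact ⟨fun h => absurd h h0, fun h => by have := hl.1 h.2; omega⟩
    · simp [hl]; omega
    · rw [launch_inj, hl, Fin.ext_iff]; omega
  have h2' : ∀ j, 𝒩.launchSucc true j = 𝒩.launch i.succ ↔
      j = i.castSucc ∨ (j = i.succ ∧ j = Fin.last (𝒩.d + 1)) := by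
    intro j; unfold launchSucc
    simp only [if_true]
    have hj := j.2
    have hi := i.2
    split_ifs with h4
    · simp [Fin.ext_iff]; omega
    · simp [Fin.ext_iff]; omega
  simp only [h3, h2, h2', if_false, Finset.sum_const_zero, add_zero, zero_add]
  rw [Finset.sum_eq_single i.castSucc]
  · have : i.castSucc ≠ i.succ := (Fin.castSucc_lt_succ).ne
    simp [this]
  · intro j _ hj
    by_cases h : j = i.succ ∧ j = Fin.last (𝒩.d + 1)
    · have hd : (i : ℕ) = 𝒩.d := by
        have h1 := congrArg Fin.val h.1
        have h2 := congrArg Fin.val h.2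
        simp at h1 h2; omega
      have h2 : (j : ℕ) = 𝒩.d + 1 := by rw [h.2]; simp
      rw [if_pos h, if_pos (Or.inr h), hi hd, h2]; simp
    · simp [h, hj]
  · simp

/-- Besides the accepting traversals, the launching chain contributes a geometric series with sum
`extra`, in which the term of `launch 1` is missing if `e` is false. -/
theorem inflow_count_zero {y : ℕ} (hy : y ≤ 1) (hd : 0 < 𝒩.d) :
    𝒩.graph.inflow (𝒩.departures y) (𝒩.count 0) = 𝒩.acc + 𝒩.extra := by
  obtain ⟨d, hd'⟩ : ∃ d, 𝒩.d = d + 1 := ⟨𝒩.d - 1, by omega⟩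
  rw [inflow_departures, sum_nodeSucc_of_ne _ _ (by simp)]
  have e1 : (∑ c, if (if 𝒩.F c then 𝒩.count 0 else 𝒩.launch 0) = 𝒩.count 0 then 𝒩.cnt 𝒩.T c
      else 0) = 𝒩.acc :=
    Finset.sum_congr rfl fun c _ => by cases 𝒩.F c <;> simp
  have h2 : ∀ i, 𝒩.launchSucc true i ≠ 𝒩.count 0 := by
    intro i; unfold launchSucc; simp only [if_true]; split_ifs <;> simp
  have h2' : ∀ i, 𝒩.launchSucc false i = 𝒩.count 0 ↔
      (i : ℕ) ≤ 𝒩.d ∧ (i : ℕ) ≠ 0 ∧ ¬ ((i : ℕ) = 1 ∧ 𝒩.e = false) := by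
    intro i; unfold launchSucc
    simp only [Bool.false_eq_true, if_false]
    split_ifs with h4 h5 h6 <;> simp_all
  have h3 : ∀ b i, 𝒩.countSucc b i ≠ 𝒩.count 0 := by
    intro b i; unfold countSucc
    split_ifs with h
    · exact fun h' => Nat.succ_ne_zero _ (𝒩.count_inj.1 h')
    · simp
    · exact fun h' => by have : (i : ℕ) = 0 := 𝒩.count_inj.1 h'; omega
  simp only [e1, h2, h2', h3, if_false, add_zero, Finset.sum_const_zero, Nat.add_left_cancel_iff]
  rw [Fin.sum_univ_eq_sum_range (fun i => if i ≤ 𝒩.d ∧ i ≠ 0 ∧ ¬ (i = 1 ∧ 𝒩.e = false) then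
    (2 ^ (𝒩.d + 1 - i) - y + 1) / 2 else 0), hd', Finset.sum_range_succ]
  -- Partial sums of the series; `2 ^ (d - k)` is what remains of it, including the train that ends
  -- up in the dead end.
  have hgeo : ∀ k ≤ d, ∑ i ∈ Finset.range (k + 2), (if i ≤ d + 1 ∧ i ≠ 0 ∧
      ¬ (i = 1 ∧ 𝒩.e = false) then (2 ^ (d + 1 + 1 - i) - y + 1) / 2 else 0) +
      (if 𝒩.e then 0 else 2 ^ d) + 2 ^ (d - k) = 2 ^ (d + 1) := by
    intro k hk
    induction k with
    | zero =>
      have : 0 < 2 ^ d := by positivity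
      rw [Finset.sum_range_succ, Finset.sum_range_succ, Finset.sum_range_zero]
      cases 𝒩.e
      · simp [pow_succ]; omega
      · simp [pow_succ]; omega
    | succ k ih =>
      have ih := ih (by omega)
      rw [Finset.sum_range_succ, if_pos (by omega)]
      have h7 : d + 1 + 1 - (k + 2) = (d - (k + 1)) + 1 := by omega
      have h8 : d - k = d - (k + 1) + 1 := by omega
      have : 0 < 2 ^ (d - (k + 1)) := by positivity
      rw [h7]
      rw [h8, pow_succ] at ih
      rw [pow_succ 2 (d - (k + 1))]
      omega
  have h9 := hgeo d le_rfl
  rw [if_neg (by omega), add_zero]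
  unfold extra
  rw [hd', Nat.add_sub_cancel]
  simp only [Nat.sub_self, pow_zero] at h9
  have : 0 < 2 ^ d := by positivity
  rw [pow_succ] at h9 ⊢
  split_ifs at h9 ⊢ <;> omega

/-- As in the launching chain, the loop at the top of the counter must contribute nothing, which is
what the hypothesis on the quotient provides. -/
theorem inflow_count_succ {y : ℕ} (i : Fin 𝒩.d)
    (hi : (i : ℕ) + 1 = 𝒩.d → (𝒩.acc + 𝒩.extra) / 2 ^ 𝒩.d = 0) :
    𝒩.graph.inflow (𝒩.departures y) (𝒩.count i.succ) =
      (𝒩.acc + 𝒩.extra) / 2 ^ ((i : ℕ) + 1) := by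
  rw [inflow_departures, sum_nodeSucc_of_ne _ _ (by simp)]
  have e1 : (∑ c, if (if 𝒩.F c then 𝒩.count 0 else 𝒩.launch 0) = 𝒩.count i.succ then 𝒩.cnt 𝒩.T c
      else 0) = 0 :=
    Finset.sum_eq_zero fun c _ => by cases 𝒩.F c <;> simp [Fin.ext_iff]
  have h2 : ∀ b j, 𝒩.launchSucc b j ≠ 𝒩.count i.succ := by
    intro b j; unfold launchSucc; split_ifs <;> simp [Fin.ext_iff]
  have h3 : ∀ j, 𝒩.countSucc false j = 𝒩.count i.succ ↔ j = i.succ ∧ j = Fin.last 𝒩.d := by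
    intro j; unfold countSucc
    simp only [Bool.false_eq_true, if_false]
    have hj := j.2
    split_ifs with h4
    · simp [Fin.ext_iff]; omega
    · simp [Fin.ext_iff]; omega
  have h3' : ∀ j, 𝒩.countSucc true j = 𝒩.count i.succ ↔
      j = i.castSucc ∨ (j = i.succ ∧ j = Fin.last 𝒩.d) := by
    intro j; unfold countSucc
    simp only [if_true]
    have hj := j.2
    have hi := i.2
    split_ifs with h4
    · simp [Fin.ext_iff]; omega
    · simp [Fin.ext_iff]; omega
  simp only [e1, h2, h3, h3', if_false, Finset.sum_const_zero, add_zero, zero_add]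
  rw [Finset.sum_eq_single i.castSucc]
  · have : i.castSucc ≠ i.succ := (Fin.castSucc_lt_succ).ne
    simp [this, Nat.div_div_eq_div_mul, pow_succ]
  · intro j _ hj
    by_cases h : j = i.succ ∧ j = Fin.last 𝒩.d
    · have hd : (i : ℕ) + 1 = 𝒩.d := by
        have h1 := congrArg Fin.val h.1
        have h2 := congrArg Fin.val h.2
        simp at h1 h2; omega
      have h2 : (j : ℕ) = 𝒩.d := by rw [h.2]; simp
      rw [if_pos h, if_pos (Or.inr h), h2, hi hd]; rfl
    · simp [h, hj]
  · simp

/-- The train reaches the destination if and only if sufficiently many traversals are accepting. -/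
theorem reaches_iff (hd : 0 < 𝒩.d) : 𝒩.graph.Reaches (𝒩.launch 0) (𝒩.count (Fin.last 𝒩.d)) ↔
    2 ^ 𝒩.d ≤ 𝒩.acc + 𝒩.extra := by
  have h2d : 0 < 2 ^ 𝒩.d := by positivity
  constructor
  · refine not_imp_not.1 fun h => ?_
    -- The counter never fills up, so the numbers with `y = 0` are balanced everywhere except at the
    -- dead end and certify that the train runs into it.
    have hW : (𝒩.acc + 𝒩.extra) / 2 ^ 𝒩.d = 0 := Nat.div_eq_of_lt (by omega)
    refine SwitchGraph.not_reaches_of_reaches (t := 𝒩.launch (Fin.last _)) (by simp)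
      (by simp [graph, next, launchSucc]) (by simp [graph, next, launchSucc])
      (by simp [graph, next, countSucc]) (by simp [graph, next, countSucc])
      (SwitchGraph.reaches_of_inflow_le _ (𝒩.departures 0) ?_)
    rintro (p | i | i) hv
    · rw [𝒩.inflow_node (Nat.zero_le _) p]; simp [departures]
    · rcases Fin.eq_zero_or_eq_succ i with rfl | ⟨i, rfl⟩
      · have := 𝒩.inflow_launch_zero (y := 0) (Nat.zero_le _) hd
        rw [hW] at this
        rw [if_pos rfl]
        change 1 + 𝒩.graph.inflow (𝒩.departures 0) (𝒩.launch 0) ≤ 2 ^ (𝒩.d + 1) - 0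
        omega
      · have hi : (i : ℕ) ≠ 𝒩.d := by
          intro hi; apply hv; simp [Fin.ext_iff, hi]
        rw [𝒩.inflow_launch_succ i (fun h => absurd h hi)]
        have h1 : 𝒩.d + 1 - (i : ℕ) = 𝒩.d - i + 1 := by have := i.2; omega
        rw [if_neg fun h => Nat.succ_ne_zero _ (𝒩.launch_inj.1 h).symm]
        change 0 + (2 ^ (𝒩.d + 1 - (i : ℕ)) - 0) / 2 ≤ 2 ^ (𝒩.d + 1 - ((i : ℕ) + 1)) - 0
        rw [h1, pow_succ, Nat.add_sub_add_right]; omega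
    · rcases 𝒩.count_cases i with rfl | ⟨i, rfl⟩
      · rw [𝒩.inflow_count_zero (Nat.zero_le _) hd]; simp [departures]
      · rw [𝒩.inflow_count_succ i (fun _ => hW)]; simp [departures]
  · intro h
    -- At least one train stays at the top of the counter, which frees one departure at `launch 0`:
    -- the numbers with `y = 1` suffice, and no condition is needed at the destination.
    have hW : 1 ≤ (𝒩.acc + 𝒩.extra) / 2 ^ 𝒩.d := (Nat.le_div_iff_mul_le h2d).2 (by omega)
    refine SwitchGraph.reaches_of_inflow_le _ (𝒩.departures 1) ?_
    rintro (p | i | i) hv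
    · rw [𝒩.inflow_node le_rfl p]; simp [departures]
    · rcases Fin.eq_zero_or_eq_succ i with rfl | ⟨i, rfl⟩
      · have := 𝒩.inflow_launch_zero (y := 1) le_rfl hd
        rw [if_pos rfl]
        change 1 + 𝒩.graph.inflow (𝒩.departures 1) (𝒩.launch 0) ≤ 2 ^ (𝒩.d + 1) - 1
        omega
      · rw [𝒩.inflow_launch_succ i (fun h => rfl)]
        have h1 : 𝒩.d + 1 - (i : ℕ) = 𝒩.d - i + 1 := by have := i.2; omega
        have h2 : 0 < 2 ^ (𝒩.d - i) := by positivity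
        rw [if_neg fun h => Nat.succ_ne_zero _ (𝒩.launch_inj.1 h).symm]
        change 0 + (2 ^ (𝒩.d + 1 - (i : ℕ)) - 1) / 2 ≤ 2 ^ (𝒩.d + 1 - ((i : ℕ) + 1)) - 1
        rw [h1, pow_succ, Nat.add_sub_add_right]; omega
    · rcases 𝒩.count_cases i with rfl | ⟨i, rfl⟩
      · rw [𝒩.inflow_count_zero le_rfl hd]; simp [departures]
      · rw [𝒩.inflow_count_succ i (fun hi => ?_)]
        · simp [departures]
        · exact absurd (by simp [Fin.ext_iff, hi]) hv

end Network


/-! ### Decoding -/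

/-- The `i`-th number of a list, read off from its encoding. -/
def num : List Bool → ℕ → ℕ
  | [], _ => 0
  | true :: y, i => (if i = 0 then 1 else 0) + num y i
  | false :: y, i => if i = 0 then 0 else num y (i - 1)

/-- Describes `num` of a string that is written bit by bit: a new 1 counts for the block whose index
is the number of zeros written before. -/
theorem num_append_singleton (y : List Bool) (b : Bool) (i : ℕ) :
    num (y ++ [b]) i = num y i + if b = true ∧ y.count false = i then 1 else 0 := by
  induction y generalizing i with
  | nil => cases b <;> cases i <;> simp [num]
  | cons a y ih =>
    cases a
    · cases i with
      | zero => simp [num]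
      | succ i => simp [num, ih]
    · simp [num, ih, add_assoc]

@[simp] theorem encodeNats_nil : encodeNats [] = [] := rfl

theorem encodeNats_cons (a : ℕ) (l : List ℕ) :
    encodeNats (a :: l) = List.replicate a true ++ false :: encodeNats l := by
  simp [encodeNats]

theorem num_replicate_append (a : ℕ) (y : List Bool) (i : ℕ) :
    num (List.replicate a true ++ y) i = (if i = 0 then a else 0) + num y i := by
  induction a with
  | zero => simp
  | succ a ih =>
    rw [List.replicate_succ, List.cons_append, num, ih]
    split_ifs <;> omega

theorem num_encodeNats (l : List ℕ) (i : ℕ) : num (encodeNats l) i = l.getD i 0 := by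
  induction l generalizing i with
  | nil => simp [num]
  | cons a l ih =>
    rw [encodeNats_cons, num_replicate_append, num]
    cases i <;> simp [ih]

theorem count_encodeNats (l : List ℕ) : (encodeNats l).count false = l.length := by
  induction l with
  | nil => rfl
  | cons a l ih => rw [encodeNats_cons]; simp [ih, List.count_replicate]

theorem encodeNats_injective : Function.Injective encodeNats := by
  intro l l' h
  have hl : l.length = l'.length := by rw [← count_encodeNats, h, count_encodeNats]
  refine List.ext_getElem hl fun i h1 h2 => ?_
  have := num_encodeNats l i
  rw [h, num_encodeNats, List.getD_eq_getElem _ _ h1, List.getD_eq_getElem _ _ h2] at this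
  exact this.symm

/-- Any bit string is the encoding of a list followed by ones without a closing zero, so being an
encoding only means that this last block is empty. -/
theorem eq_encodeNats_append (y : List Bool) :
    y = encodeNats ((List.range (y.count false)).map (num y)) ++
      List.replicate (num y (y.count false)) true := by
  induction y with
  | nil => rfl
  | cons b y ih =>
    cases b
    · conv_lhs => rw [ih]
      simp only [List.count_cons_self, List.range_succ_eq_map, List.map_cons, List.map_map,
        encodeNats_cons, num]
      simp [Function.comp_def]
    · conv_lhs => rw [ih]
      simp only [List.count_cons, num]
      rcases h : y.count false with _ | k
      · simp only [List.range_zero, List.map_nil, encodeNats_nil, List.nil_append, if_true,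
          Bool.true_beq, Bool.false_eq_true, if_false, add_zero, add_comm 1]
        rw [← List.replicate_succ, List.replicate_succ']
      · simp [List.range_succ_eq_map, encodeNats_cons, add_comm 1, List.replicate_succ,
          Function.comp_def]

section Pairs

variable {A : Type*} (l : List A) (f g : A → ℕ)

theorem length_flatMap_pair : (l.flatMap fun a => [f a, g a]).length = 2 * l.length := by
  simp [mul_comm]

theorem getD_flatMap_pair {i : ℕ} (hi : i < l.length) :
    (l.flatMap fun a => [f a, g a]).getD (2 * i) 0 = f l[i] ∧
      (l.flatMap fun a => [f a, g a]).getD (2 * i + 1) 0 = g l[i] := by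
  induction l generalizing i with
  | nil => simp at hi
  | cons a l ih =>
    cases i with
    | zero => simp
    | succ i =>
      have := ih (i := i) (by simpa using hi)
      simpa [mul_add, List.flatMap_cons] using this

end Pairs

/-! ### Instances of Arrival -/

namespace ArrivalInstance

variable (I : ArrivalInstance)

/-- The numbers that describe an instance. -/
def code : List ℕ := [I.n, (I.start : ℕ), (I.dest : ℕ)] ++
  (List.finRange I.n).flatMap fun v => [(I.graph.s₀ v : ℕ), (I.graph.s₁ v : ℕ)]

theorem encode_eq : I.encode = encodeNats I.code := rfl

theorem length_code : I.code.length = 3 + 2 * I.n := by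
  rw [code, List.length_append, length_flatMap_pair, List.length_finRange]; rfl

theorem getD_code (v : Fin I.n) : I.code.getD (3 + 2 * v) 0 = I.graph.s₀ v ∧
    I.code.getD (3 + 2 * v + 1) 0 = I.graph.s₁ v := by
  have := getD_flatMap_pair (List.finRange I.n) (fun v => (I.graph.s₀ v : ℕ))
    (fun v => (I.graph.s₁ v : ℕ)) (i := v) (by simp)
  simpa [code, add_assoc, add_comm 3] using this

theorem encode_injective : Function.Injective encode := by
  rintro ⟨n, ⟨s₀, s₁⟩, a, t⟩ ⟨n', ⟨s₀', s₁'⟩, a', t'⟩ h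
  have h := encodeNats_injective h
  obtain rfl : n = n' := (List.cons.inj h).1
  have ha : a = a' := Fin.ext (List.cons.inj (List.cons.inj h).2).1
  have ht : t = t' := Fin.ext (List.cons.inj (List.cons.inj (List.cons.inj h).2).2).1
  have hs := fun v : Fin n => getD_code ⟨n, ⟨s₀, s₁⟩, a, t⟩ v
  have hs' := fun v : Fin n => getD_code ⟨n, ⟨s₀', s₁'⟩, a', t'⟩ v
  have hc : code ⟨n, ⟨s₀, s₁⟩, a, t⟩ = code ⟨n, ⟨s₀', s₁'⟩, a', t'⟩ := h
  simp only [hc] at hs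
  have h0 : s₀ = s₀' := funext fun v => Fin.ext ((hs v).1.symm.trans (hs' v).1)
  have h1 : s₁ = s₁' := funext fun v => Fin.ext ((hs v).2.symm.trans (hs' v).2)
  rw [ha, ht, h0, h1]

theorem encode_mem_arrival : I.encode ∈ arrival ↔ I.graph.Reaches I.start I.dest :=
  ⟨fun ⟨J, hJ, h⟩ => by rwa [encode_injective hJ], fun h => ⟨I, rfl, h⟩⟩

/-- The numbers that describe an instance given by functions on natural numbers. -/
def entryOf (n a t : ℕ) (s : Bool → ℕ → ℕ) (i : ℕ) : ℕ :=
  if i = 0 then n else if i = 1 then a else if i = 2 then t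
  else if (i - 3) % 2 = 0 then s false ((i - 3) / 2) else s true ((i - 3) / 2)

theorem code_eq_map (s : Bool → ℕ → ℕ) (h0 : ∀ v, (I.graph.s₀ v : ℕ) = s false v)
    (h1 : ∀ v, (I.graph.s₁ v : ℕ) = s true v) :
    I.code = (List.range (3 + 2 * I.n)).map (entryOf I.n I.start I.dest s) := by
  refine List.ext_getElem (by rw [length_code]; simp) fun i hi _ => ?_
  rw [List.getElem_map, List.getElem_range]
  rw [← List.getD_eq_getElem _ 0 hi]
  rw [length_code] at hi
  rcases i with _ | _ | _ | i
  · rfl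
  · rfl
  · rfl
  · have hv : i / 2 < I.n := by omega
    have := I.getD_code ⟨i / 2, hv⟩
    simp only [entryOf]
    rw [if_neg (by omega), if_neg (by omega), if_neg (by omega)]
    have e3 : i + 1 + 1 + 1 - 3 = i := by omega
    rw [e3]
    split_ifs with h
    · rw [← h0 ⟨i / 2, hv⟩, ← this.1]; congr 1; simp only; omega
    · rw [← h1 ⟨i / 2, hv⟩, ← this.2]; congr 1; simp only; omega

end ArrivalInstance

section

variable {α β : Type} [Ctx α] [Ctx β]

/-- Renaming of variables. -/
theorem LS.rename {f : β → ℕ} (hf : LS f) (σ : α → β)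
    (τ : Fin (Ctx.arity β) → Fin (Ctx.arity α)) (hi : ∀ a, Ctx.inp (σ a) = Ctx.inp a)
    (hv : ∀ a i, Ctx.var (σ a) i = Ctx.var a (τ i)) (hs : ∀ a, sz (σ a) ≤ sz a) :
    LS (fun a => f (σ a)) := by
  obtain ⟨B, ⟨c, hc⟩, h⟩ := hf
  refine ⟨fun a => B (σ a), ⟨c, fun a => (hc _).trans
    (Nat.pow_le_pow_left (Nat.add_le_add_right (hs a) 2) c)⟩, fun ρ s hρ => ?_⟩
  obtain ⟨P, hP⟩ := h (fun i => ρ (τ i)) s fun i => hρ _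
  refine ⟨P, fun a N g o hN hg hv' => ?_⟩
  have := hP (σ a) N g o hN hg fun i => by rw [hv, hv']
  rwa [hi] at this

theorem inp_length_le_sz (a : α) : (Ctx.inp a).length ≤ sz a := Nat.le_add_right _ _

/-- Each context carries the input string, so a function of the input and one number can be used in
every context. -/
theorem LS.ofInput₁ {f : List Bool × ℕ → ℕ} (hf : LS f) {g : α → ℕ} (hg : LS g) :
    LS (fun a : α => f (Ctx.inp a, g a)) :=
  LS.comp (f := fun p : α × ℕ => f (Ctx.inp p.1, p.2)) (hf.rename (fun p : α × ℕ => (Ctx.inp p.1, p.2))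
    (fun _ => 0) (fun _ => rfl) (fun a i => by
      have : i = 0 := Subsingleton.elim (α := Fin 1) i 0
      subst this; rfl) fun a => by
    have := inp_length_le_sz a.1
    simp only [sz_prod, sz_list]; omega) hg

theorem LS.ofInput₂ {f : (List Bool × ℕ) × ℕ → ℕ} (hf : LS f) {g h : α → ℕ} (hg : LS g)
    (hh : LS h) : LS (fun a : α => f ((Ctx.inp a, g a), h a)) :=
  LS.comp (f := fun p : α × ℕ => f ((Ctx.inp p.1, g p.1), p.2))
    (LS.comp (f := fun p : (α × ℕ) × ℕ => f ((Ctx.inp p.1.1, p.2), p.1.2))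
      (hf.rename (fun p : (α × ℕ) × ℕ => ((Ctx.inp p.1.1, p.2), p.1.2)) ![1, 0] (fun _ => rfl) (fun a i => by
        revert i
        change ∀ i : Fin 2, _
        intro i
        fin_cases i <;> rfl) fun a => by
      have := inp_length_le_sz a.1.1
      simp only [sz_prod, sz_list]; omega) hg.fst) hh

end

/-- A language that is reduced to Arrival by numbers computable in logarithmic space. -/
theorem logSpaceReducible_arrival {K : Language Bool} {n a t : List Bool → ℕ}
    {s : Bool → List Bool × ℕ → ℕ} (hn : LS n) (ha : LS a) (ht : LS t) (hs : ∀ b, LS (s b))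
    (I : List Bool → ArrivalInstance) (hIn : ∀ x, (I x).n = n x)
    (hIa : ∀ x, ((I x).start : ℕ) = a x) (hIt : ∀ x, ((I x).dest : ℕ) = t x)
    (h0 : ∀ x v, ((I x).graph.s₀ v : ℕ) = s false (x, v))
    (h1 : ∀ x v, ((I x).graph.s₁ v : ℕ) = s true (x, v))
    (hK : ∀ x, x ∈ K ↔ (I x).graph.Reaches (I x).start (I x).dest) :
    LogSpaceReducible K arrival := by
  have he : LS (fun p : List Bool × ℕ =>
      ArrivalInstance.entryOf (n p.1) (a p.1) (t p.1) (fun b v => s b (p.1, v)) p.2) := by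
    have h3 := LS.sub LS.snd (LS.const (α := List Bool × ℕ) 3)
    have hv := h3.div (LS.const 2)
    exact .ite (.eq .snd (.const 0)) hn.fst (.ite (.eq .snd (.const 1)) ha.fst
      (.ite (.eq .snd (.const 2)) ht.fst (.ite (.eq (h3.mod (.const 2)) (.const 0))
        ((hs false).ofInput₁ hv) ((hs true).ofInput₁ hv))))
  refine ⟨_, ((LS.const 3).add ((LS.const 2).mul hn)).logSpaceComputable he, fun x => ?_⟩
  rw [hK, ← ArrivalInstance.encode_mem_arrival, ArrivalInstance.encode_eq,
    ArrivalInstance.code_eq_map (I x) (fun b v => s b (x, v)) (h0 x) (h1 x)]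
  simp only [hIn, hIa, hIt]

/-! ### Networks as instances of Arrival -/

namespace Network

variable {M : ℕ} (𝒩 : Network (Fin M))

/-- The number of a vertex. -/
def num : 𝒩.Vertex → ℕ :=
  Sum.elim (fun p => 3 * Nat.pair p.1 p.2) (Sum.elim (fun i => 3 * i + 1) fun i => 3 * i + 2)

/-- The number of vertices in the numbering. -/
def size : ℕ := 3 * (𝒩.T + M + 𝒩.d + 3) ^ 2

theorem num_lt (v : 𝒩.Vertex) : 𝒩.num v < 𝒩.size := by
  have h1 : 𝒩.T + M + 𝒩.d + 3 ≤ (𝒩.T + M + 𝒩.d + 3) ^ 2 := Nat.le_self_pow two_ne_zero _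
  rcases v with ⟨j, c⟩ | i | i
  · have h2 := Nat.pair_lt_max_add_one_sq j c
    have h3 : (max (j : ℕ) c + 1) ^ 2 ≤ (𝒩.T + M + 𝒩.d + 3) ^ 2 :=
      Nat.pow_le_pow_left (by have := j.2; have := c.2; omega) 2
    change 3 * Nat.pair j c < 3 * _
    omega
  · have := i.2
    change 3 * (i : ℕ) + 1 < 3 * _
    omega
  · have := i.2
    change 3 * (i : ℕ) + 2 < 3 * _
    omega

theorem num_injective : Function.Injective 𝒩.num := by
  rintro (⟨j, c⟩ | i | i) (⟨j', c'⟩ | i' | i') h <;>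
    simp only [num, Sum.elim_inl, Sum.elim_inr] at h
  · have := Nat.pair_eq_pair.1 (show Nat.pair j c = Nat.pair j' c' by omega)
    rw [Fin.ext this.1, Fin.ext this.2]
  · omega
  · omega
  · omega
  · rw [Fin.ext (show (i : ℕ) = i' by omega)]
  · omega
  · omega
  · omega
  · rw [Fin.ext (show (i : ℕ) = i' by omega)]

/-- The number of the successor of the vertex with a given number; `f` and `F` describe the
transitions and the accepting points. -/
def succNum (T d x₀ : ℕ) (e : Bool) (f : ℕ → ℕ → ℕ) (F : ℕ → Prop) [DecidablePred F] (b : Bool)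
    (v : ℕ) : ℕ :=
  if v % 3 = 0 then
    if (v / 3).unpair.1 < T then 3 * Nat.pair ((v / 3).unpair.1 + 1)
      (f (v / 3).unpair.1 (v / 3).unpair.2)
    else if F (v / 3).unpair.2 then 2 else 1
  else if v % 3 = 1 then
    if v / 3 ≤ d then
      if b = true then v + 3 else if v / 3 = 0 then 3 * Nat.pair 0 x₀
      else if v / 3 = 1 ∧ e = false then 1 else 2
    else v
  else if v / 3 < d then if b = true then v + 3 else 1 else v

theorem num_next {f : ℕ → ℕ → ℕ} {F : ℕ → Prop} [DecidablePred F] {b : Bool}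
    (hf : ∀ j c, (𝒩.f j b c : ℕ) = f j c) (hF : ∀ c, 𝒩.F c = true ↔ F c) (v : 𝒩.Vertex) :
    𝒩.num (𝒩.next b v) = succNum 𝒩.T 𝒩.d 𝒩.x₀ 𝒩.e f F b (𝒩.num v) := by
  rcases v with ⟨j, c⟩ | i | i
  · have e1 : 𝒩.num (Sum.inl (j, c)) % 3 = 0 := Nat.mul_mod_right _ _
    have e2 : 𝒩.num (Sum.inl (j, c)) / 3 = Nat.pair j c := Nat.mul_div_cancel_left _ (by omega)
    rw [succNum, if_pos e1, e2, Nat.unpair_pair, ← hf]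
    simp only [next, Sum.elim_inl, nodeSucc]
    by_cases h : (j : ℕ) < 𝒩.T
    · simp only [h, dite_true, if_true]; rfl
    · simp only [h, dite_false, if_false, ← hF]
      split_ifs <;> rfl
  · have e1 : 𝒩.num (Sum.inr (Sum.inl i)) = 3 * i + 1 := rfl
    have e2 : (3 * (i : ℕ) + 1) % 3 = 1 := by omega
    have e3 : (3 * (i : ℕ) + 1) / 3 = i := by omega
    rw [succNum, e1, e2, e3, if_neg one_ne_zero, if_pos rfl]
    simp only [next, Sum.elim_inr, Sum.elim_inl, launchSucc]
    by_cases h : (i : ℕ) ≤ 𝒩.d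
    · simp only [h, dite_true, if_true]
      split_ifs
      · change 3 * ((i : ℕ) + 1) + 1 = _; ring
      · rfl
      · rfl
      · rfl
    · simp only [h, dite_false, if_false]; rfl
  · have e1 : 𝒩.num (Sum.inr (Sum.inr i)) = 3 * i + 2 := rfl
    have e2 : (3 * (i : ℕ) + 2) % 3 = 2 := by omega
    have e3 : (3 * (i : ℕ) + 2) / 3 = i := by omega
    rw [succNum, e1, e2, e3, if_neg two_ne_zero, if_neg (by decide)]
    simp only [next, Sum.elim_inr, countSucc]
    by_cases h : (i : ℕ) < 𝒩.d
    · simp only [h, dite_true, if_true]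
      split_ifs
      · change 3 * ((i : ℕ) + 1) + 2 = _; ring
      · rfl
    · simp only [h, dite_false, if_false]; rfl

/-- The instance of Arrival given by a network. -/
def toArrival (s : Bool → ℕ → ℕ) : ArrivalInstance where
  n := 𝒩.size
  graph := ⟨fun v => ⟨if s false v < 𝒩.size then s false v else 0,
      by split_ifs; assumption; exact (Nat.zero_le _).trans_lt v.2⟩,
    fun v => ⟨if s true v < 𝒩.size then s true v else 0,
      by split_ifs; assumption; exact (Nat.zero_le _).trans_lt v.2⟩⟩
  start := ⟨𝒩.num (𝒩.launch 0), 𝒩.num_lt _⟩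
  dest := ⟨𝒩.num (𝒩.count (Fin.last 𝒩.d)), 𝒩.num_lt _⟩

/-- Numbers that belong to no vertex of the network only add superfluous vertices: the numbering is
injective and commutes with the switches. -/
theorem toArrival_reaches {s : Bool → ℕ → ℕ} (hs : ∀ b v, s b (𝒩.num v) = 𝒩.num (𝒩.next b v))
    (hd : 0 < 𝒩.d) :
    (𝒩.toArrival s).graph.Reaches (𝒩.toArrival s).start (𝒩.toArrival s).dest ↔
      2 ^ 𝒩.d ≤ 𝒩.acc + 𝒩.extra := by
  rw [← 𝒩.reaches_iff hd]
  refine SwitchGraph.reaches_map_iff (G := 𝒩.graph) (H := (𝒩.toArrival s).graph)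
    (φ := fun v => (⟨𝒩.num v, 𝒩.num_lt v⟩ : Fin 𝒩.size)) (fun v w h => 𝒩.num_injective
      (congrArg Fin.val h)) (fun v => Fin.ext ?_) (fun v => Fin.ext ?_) _ _
  · change (if s false (𝒩.num v) < _ then s false (𝒩.num v) else 0) = 𝒩.num (𝒩.next false v)
    rw [hs, if_pos (𝒩.num_lt _)]
  · change (if s true (𝒩.num v) < _ then s true (𝒩.num v) else 0) = 𝒩.num (𝒩.next true v)
    rw [hs, if_pos (𝒩.num_lt _)]

theorem logSpaceReducible {K : Language Bool} {M : List Bool → ℕ} (𝒩 : ∀ x, Network (Fin (M x)))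
    {e : Bool} (he : ∀ x, (𝒩 x).e = e) (hd : ∀ x, 0 < (𝒩 x).d) (hM : LS M)
    (hT : LS fun x => (𝒩 x).T) (hd' : LS fun x => (𝒩 x).d) (hx₀ : LS fun x => ((𝒩 x).x₀ : ℕ))
    {f : Bool → (List Bool × ℕ) × ℕ → ℕ} (hf : ∀ b, LS (f b))
    (hf' : ∀ x b j c, ((𝒩 x).f j b c : ℕ) = f b ((x, j), c))
    {F : List Bool × ℕ → Prop} (hF : LSP F) (hF' : ∀ x c, (𝒩 x).F c = true ↔ F (x, c))
    (hK : ∀ x, x ∈ K ↔ 2 ^ (𝒩 x).d ≤ (𝒩 x).acc + (𝒩 x).extra) :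
    LogSpaceReducible K arrival := by
  classical
  let s : Bool → List Bool × ℕ → ℕ := fun b p => succNum (𝒩 p.1).T (𝒩 p.1).d (𝒩 p.1).x₀ e
    (fun j c => f b ((p.1, j), c)) (fun c => F (p.1, c)) b p.2
  have hsize : LS fun x => (𝒩 x).size :=
    (LS.const 3).mul ((((hT.add hM).add hd').add (.const 3)).pow 2)
  have hs : ∀ b, LS (s b) := by
    intro b
    have hk : LS fun p : List Bool × ℕ => p.2 / 3 := LS.snd.div (.const 3)
    have hm : LS fun p : List Bool × ℕ => p.2 % 3 := LS.snd.mod (.const 3)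
    have hFk : LSP fun p : List Bool × ℕ => F (p.1, (p.2 / 3).unpair.2) :=
      LS.ofInput₁ hF hk.unpair_snd
    refine .ite (.eq hm (.const 0)) (.ite (.lt hk.unpair_fst hT.fst)
      ((LS.const 3).mul (hk.unpair_fst.succ.pair ((hf b).ofInput₂ hk.unpair_fst hk.unpair_snd)))
      (.ite hFk (.const 2) (.const 1))) (.ite (.eq hm (.const 1)) (.ite (.le hk hd'.fst)
        (.ite (.of_const _) (LS.snd.add (.const 3)) (.ite (.eq hk (.const 0))
          ((LS.const 3).mul (LS.zero.pair hx₀.fst))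
          (.ite ((LSP.eq hk (.const 1)).and (.of_const _)) (.const 1) (.const 2)))) .snd)
        (.ite (.lt hk hd'.fst) (.ite (.of_const _) (LS.snd.add (.const 3)) (.const 1)) .snd))
  have hsn : ∀ x b v, s b (x, (𝒩 x).num v) = (𝒩 x).num ((𝒩 x).next b v) := fun x b v => by
    rw [num_next (𝒩 x) (f := fun j c => f b ((x, j), c)) (F := fun c => F (x, c))
      (fun j c => hf' x b j c) (hF' x), he]
  refine logSpaceReducible_arrival (n := fun x => (𝒩 x).size) (a := fun _ => 1)
    (t := fun x => 3 * (𝒩 x).d + 2)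
    (s := fun b p => if s b p < (𝒩 p.1).size then s b p else 0) hsize (.const 1)
    (((LS.const 3).mul hd').add (.const 2))
    (fun b => .ite (.lt (hs b) hsize.fst) (hs b) .zero)
    (fun x => (𝒩 x).toArrival fun b v => s b (x, v)) (fun _ => rfl) (fun _ => rfl) (fun _ => rfl)
    (fun _ _ => rfl) (fun _ _ => rfl) fun x => ?_
  rw [hK, toArrival_reaches _ (hsn x) (hd x)]

end Network


theorem LS.polynomial_eval {α : Type} [Ctx α] {f : α → ℕ} (hf : LS f) (p : Polynomial ℕ) :
    LS (fun a => p.eval (f a)) :=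
  (LS.finset_sum (Finset.range (p.natDegree + 1)) fun i => (LS.const (p.coeff i)).mul
    (hf.pow i)).congr fun _ => Polynomial.eval_eq_sum_range _

/-! ### Probabilistic computations as networks -/

theorem sum_bool_snoc {j : ℕ} (φ : List Bool → ℕ) :
    ∑ r : Fin (j + 1) → Bool, φ (List.ofFn r) =
      ∑ r : Fin j → Bool, (φ (List.ofFn r ++ [false]) + φ (List.ofFn r ++ [true])) := by
  rw [← (Fin.snocEquiv fun _ : Fin (j + 1) => Bool).sum_comp, Fintype.sum_prod_type,
    Fintype.sum_bool, add_comm, ← Finset.sum_add_distrib]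
  refine Finset.sum_congr rfl fun r _ => ?_
  have h : ∀ b : Bool, List.ofFn (Fin.snoc r b : Fin (j + 1) → Bool) = List.ofFn r ++ [b] :=
    fun b => by rw [List.ofFn_succ']; simp
  exact congrArg₂ _ (congrArg φ (h false)) (congrArg φ (h true))

namespace Network

variable {X : Type} [Fintype X] [DecidableEq X] (𝒩 : Network X)

/-- Each coin sequence of length `j` carries `2 ^ (d - j)` traversals to the point it leads to,
because up to layer `d` every halving is exact. -/
theorem sum_cnt_mul_eq (g : X → Bool → X) (hg : ∀ j b c, 𝒩.f j b c = g c b) {j : ℕ}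
    (hj : j ≤ 𝒩.d) (φ : X → ℕ) : ∑ c, 𝒩.cnt j c * φ c =
      2 ^ (𝒩.d - j) * ∑ r : Fin j → Bool, φ ((List.ofFn r).foldl g 𝒩.x₀) := by
  induction j generalizing φ with
  | zero => simp [cnt]
  | succ j ih =>
    have ih := fun φ => ih (by omega) φ
    have hpow : 2 ^ (𝒩.d - j) = 2 * 2 ^ (𝒩.d - (j + 1)) := by
      rw [← pow_succ']; congr 1; omega
    -- The induction hypothesis for the indicator of `c` shows that the count is a multiple of `2 ^
    -- (d - j)`, hence even.
    have hev : ∀ c, 𝒩.cnt j c = 2 * (𝒩.cnt j c / 2) := fun c => by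
      have := ih fun c' => if c' = c then 1 else 0
      simp only [mul_ite, mul_one, mul_zero, Finset.sum_ite_eq', Finset.mem_univ, if_true] at this
      rw [hpow, mul_assoc] at this
      omega
    have hhalf : ∀ φ : X → ℕ, ∑ c, 𝒩.cnt j c / 2 * φ c = 2 ^ (𝒩.d - (j + 1)) *
        ∑ r : Fin j → Bool, φ ((List.ofFn r).foldl g 𝒩.x₀) := fun φ => by
      refine Nat.eq_of_mul_eq_mul_left two_pos ?_
      rw [← mul_assoc, ← hpow, ← ih, Finset.mul_sum]
      refine Finset.sum_congr rfl fun c _ => ?_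
      rw [← mul_assoc, ← hev]
    have hsucc : ∀ c, (𝒩.cnt j c + 1) / 2 = 𝒩.cnt j c / 2 := fun c => by
      have := hev c; omega
    simp only [sum_cnt_mul, hsucc, Finset.sum_add_distrib, hg]
    rw [hhalf fun c => φ (g c false), hhalf fun c => φ (g c true), ← mul_add,
      ← Finset.sum_add_distrib, sum_bool_snoc fun l => φ (l.foldl g 𝒩.x₀)]
    simp

theorem acc_eq_card (g : X → Bool → X) (hg : ∀ j b c, 𝒩.f j b c = g c b) (hT : 𝒩.T ≤ 𝒩.d) :
    𝒩.acc = 2 ^ (𝒩.d - 𝒩.T) * (Finset.univ.filter fun r : Fin 𝒩.T → Bool =>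
      𝒩.F ((List.ofFn r).foldl g 𝒩.x₀) = true).card := by
  rw [Finset.card_filter, ← 𝒩.sum_cnt_mul_eq g hg hT fun c => if 𝒩.F c = true then 1 else 0, acc]
  exact Finset.sum_congr rfl fun c _ => by split_ifs <;> simp

end Network

/-! ### Configurations as points of a network of polynomial size -/

namespace Machine

variable {C : Type} {M : Machine C} (E : FinCode M.State M.start) (S : FinCode M.Symbol M.blank)

theorem lt_cells {c n k : ℕ} (h : k ≤ c * (Nat.log 2 n + 1)) : k < cells c n :=
  Nat.lt_succ_of_le h

/-- The step on codes, where codes that are too large are replaced by `0`. -/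
def capStep (e : ℕ) (d : C) (x : List Bool) (c : ℕ) : ℕ :=
  if stepCode E S d x c < (x.length + 2) ^ e then stepCode E S d x c else 0

theorem capStep_lt (e : ℕ) (d : C) (x : List Bool) (c : ℕ) :
    capStep E S e d x c < (x.length + 2) ^ e := by
  unfold capStep
  split_ifs with h
  · exact h
  · positivity

theorem ls_capStep {α : Type} [Ctx α] (e : ℕ) (d : C) {f : α → ℕ} (hf : LS f) :
    LS (fun a => capStep E S e d (Ctx.inp a) (f a)) := by
  have h := ls_stepCode E S d hf
  exact .ite (.lt h ((LS.length.add (.const 2)).pow e)) h .zero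

/-- The cap never acts on codes of actual runs; it only makes the step a map of a finite set into
itself. -/
theorem foldl_capStep {c e : ℕ} (hc : ∀ (x : List Bool) (r : List C) (i : Fin M.tapes),
      (M.run x r).workPos i ≤ c * (Nat.log 2 x.length + 1))
    (he : ∀ x r, cfgCode E S (cells c x.length) (M.run x r) < (x.length + 2) ^ e)
    (x : List Bool) (r : List C) :
    r.foldl (fun k d => capStep E S e d x k) (cfgCode E S (cells c x.length) M.init) =
      cfgCode E S (cells c x.length) (M.run x r) := by
  induction r using List.reverseRecOn with
  | nil => rfl
  | append_singleton r d ih =>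
    have := he x (r ++ [d])
    rw [run_append] at this ⊢
    rw [List.foldl_append, ih, List.foldl_cons, List.foldl_nil, capStep,
      stepCode_cfgCode E S d x (fun i => lt_cells (hc x r i)), if_pos this]

end Machine

open Machine in
theorem isHardFor_PL : IsHardFor PL arrival := by
  classical
  rintro K ⟨M, p, ⟨c, hc⟩, hM⟩
  have := M.finite_state
  have := M.finite_symbol
  obtain ⟨E⟩ := FinCode.exists M.State M.start
  obtain ⟨S⟩ := FinCode.exists M.Symbol M.blank
  obtain ⟨e, he⟩ := exists_cfgCode_lt E S hc
  let g : ∀ x : List Bool, Fin ((x.length + 2) ^ e) → Bool → Fin ((x.length + 2) ^ e) :=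
    fun x k b => ⟨capStep E S e b x k, capStep_lt E S e b x k⟩
  let 𝒩 : ∀ x : List Bool, Network (Fin ((x.length + 2) ^ e)) := fun x =>
    { f := fun _ b k => g x k b
      x₀ := ⟨cfgCode E S (cells c x.length) M.init, he x []⟩
      F := fun k => decide ((viewCode E S x k).1 ∈ M.accept)
      T := p.eval x.length
      d := p.eval x.length + 1
      e := false }
  have hT : LS fun x : List Bool => p.eval x.length :=
    (LS.length (α := List Bool)).polynomial_eval p
  refine Network.logSpaceReducible 𝒩 (fun _ => rfl) (fun _ => Nat.succ_pos _)
    ((LS.length.add (.const 2)).pow e) hT hT.succ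
    ((LS.const _).congr fun x => cfgCode_init E S _)
    (f := fun b q => capStep E S e b q.1.1 q.2) (fun b => ls_capStep E S e b .snd)
    (fun _ _ _ _ => rfl) (F := fun q => (viewCode E S q.1 q.2).1 ∈ M.accept)
    ((ls_viewCode E S (α := List Bool × ℕ) .snd).holds fun v => v.1 ∈ M.accept)
    (fun x k => decide_eq_true_iff) fun x => ?_
  have hfold : ∀ r : List Bool, ((r.foldl (g x) (𝒩 x).x₀ : Fin _) : ℕ) =
      cfgCode E S (cells c x.length) (M.run x r) := fun r => by
    rw [← foldl_capStep E S hc he x r]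
    exact (List.foldl_hom (g₁ := g x) (g₂ := fun k d => capStep E S e d x k)
      (Fin.val : Fin ((x.length + 2) ^ e) → ℕ) fun _ _ => rfl).symm
  have hacc : (𝒩 x).acc = 2 * Set.ncard {r : Fin (p.eval x.length) → Bool |
      M.Accepts x (List.ofFn r)} := by
    rw [(𝒩 x).acc_eq_card (g x) (fun _ _ _ => rfl) (Nat.le_succ _)]
    have h1 : (𝒩 x).d - (𝒩 x).T = 1 := Nat.add_sub_cancel_left _ _
    rw [h1, pow_one, ← Set.ncard_coe_finset]
    congr 2
    ext r
    simp only [Finset.coe_filter, Finset.mem_univ, true_and, Set.mem_ofPred_eq]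
    rw [show ∀ k, (𝒩 x).F k = decide ((viewCode E S x k).1 ∈ M.accept) from fun _ => rfl,
      decide_eq_true_iff, hfold, viewCode_cfgCode E S x fun i => lt_cells (hc x _ i)]
    -- After `p.eval x.length` steps the machine has halted whatever the coins are, so only the
    -- state matters.
    exact ⟨fun h => ⟨(hM x).1 _ List.length_ofFn, h⟩, fun h => h.2⟩
  rw [(hM x).2, hacc, acceptProb]
  have hex : (𝒩 x).extra = 2 ^ p.eval x.length - 1 := rfl
  have hd : (𝒩 x).d = p.eval x.length + 1 := rfl
  rw [hex, hd, pow_succ]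
  generalize Set.ncard {r : Fin (p.eval x.length) → Bool | M.Accepts x (List.ofFn r)} = A
  have hpos : 0 < 2 ^ p.eval x.length := by positivity
  rw [div_lt_div_iff₀ two_pos (by positivity), one_mul]
  have : ((2 : ℚ) ^ p.eval x.length < A * 2) ↔ 2 ^ p.eval x.length < A * 2 := by
    exact_mod_cast Iff.rfl
  rw [this]
  -- With `A` accepting sequences and `p` steps this is `2 ^ p * 2 ≤ 2 * A + (2 ^ p - 1)` iff `2 ^ p
  -- < A * 2`.
  omega


/-! ### The output of a log-space computation -/

namespace Machine

variable {M : Machine Unit}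

/-- The bit that a deterministic machine writes in the next step. -/
def emitOf (v : M.View) : Option Bool :=
  match M.trans v.1 v.2.1 v.2.2 with
  | none => none
  | some f => (f ()).emit

theorem output_step (x : List Bool) (q : M.Cfg) :
    (M.step x q ()).output = q.output ++ (emitOf (M.view x q)).toList := by
  unfold step next emitOf view
  dsimp only
  cases M.trans q.state (inputSymbol x q.inputPos) (fun i => q.work i (q.workPos i)) <;> simp

/-- The configuration of a deterministic machine at time `t`. -/
def atTime (M : Machine Unit) (x : List Bool) (t : ℕ) : M.Cfg := M.run x (List.replicate t ())

theorem atTime_succ (x : List Bool) (t : ℕ) :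
    M.atTime x (t + 1) = M.step x (M.atTime x t) () := by
  unfold atTime
  rw [List.replicate_succ', run_append]

theorem run_eq_atTime (x : List Bool) (r : List Unit) : M.run x r = M.atTime x r.length := by
  rw [atTime, ← List.eq_replicate_of_mem fun _ _ => rfl]

theorem atTime_add_of_halted {x : List Bool} {t : ℕ} (h : M.Halted x (M.atTime x t)) (k : ℕ) :
    M.atTime x (t + k) = M.atTime x t := by
  induction k with
  | zero => rfl
  | succ k ih => rw [← add_assoc, atTime_succ, ih, step, show M.next x _ = none from h]

theorem halted_iff_view {x : List Bool} {q : M.Cfg} :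
    M.Halted x q ↔ M.trans (M.view x q).1 (M.view x q).2.1 (M.view x q).2.2 = none := Iff.rfl

/-- The codes `k` ignore the output, so there are fewer than or exactly `N` of them although the
output is unbounded. A repetition among the times up to `N` makes the codes periodic; as the machine
halts eventually, the repeated code is already a halting one. -/
theorem output_atTime {x : List Bool} {t N : ℕ} (h : M.Halted x (M.atTime x t)) {k : M.Cfg → ℕ}
    {σ : ℕ → ℕ} (hk : ∀ s, k (M.atTime x (s + 1)) = σ (k (M.atTime x s)))
    (hH : ∀ s s', k (M.atTime x s) = k (M.atTime x s') → M.Halted x (M.atTime x s) →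
      M.Halted x (M.atTime x s')) (hN : ∀ s, k (M.atTime x s) < N) :
    (M.atTime x N).output = (M.atTime x t).output := by
  obtain ⟨a, ha, b, hb, hab, heq⟩ := Finset.exists_ne_map_eq_of_card_lt_of_maps_to
    (s := Finset.range (N + 1)) (t := Finset.range N) (by simp)
    (f := fun s => k (M.atTime x s)) (fun s _ => Finset.mem_coe.2 (Finset.mem_range.2 (hN s)))
  wlog hlt : a < b generalizing a b
  · exact this b hb a ha hab.symm heq.symm (by omega)
  have hper : ∀ n, k (M.atTime x (a + n * (b - a))) = k (M.atTime x a) := by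
    -- Equal codes have equal successors, so the collision propagates to all later times.
    have hshift : ∀ s, k (M.atTime x (b + s)) = k (M.atTime x (a + s)) := by
      intro s
      induction s with
      | zero => exact heq.symm
      | succ s ih => rw [← add_assoc, ← add_assoc, hk, hk, ih]
    intro n
    induction n with
    | zero => simp
    | succ n ih =>
      have := hshift (n * (b - a))
      rw [ih] at this
      rw [← this]
      congr 2
      rw [Nat.succ_mul]; omega
  have hge : t ≤ a + t * (b - a) :=
    (Nat.le_mul_of_pos_right t (by omega)).trans (Nat.le_add_left _ _)
  obtain ⟨u, hu⟩ := Nat.exists_eq_add_of_le hge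
  have h1 : M.Halted x (M.atTime x (a + t * (b - a))) := by
    rw [hu, atTime_add_of_halted h]; exact h
  have h2 : M.Halted x (M.atTime x a) := hH _ _ (hper t) h1
  have haN : a ≤ N := by have := Finset.mem_range.1 ha; omega
  obtain ⟨v, rfl⟩ := Nat.exists_eq_add_of_le haN
  rw [atTime_add_of_halted h2, ← atTime_add_of_halted h2 (t * (b - a)), hu, atTime_add_of_halted h]

theorem count_output (x : List Bool) (t : ℕ) : (M.atTime x t).output.count false =
    ∑ s ∈ Finset.range t, if emitOf (M.view x (M.atTime x s)) = some false then 1 else 0 := by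
  induction t with
  | zero => rfl
  | succ t ih =>
    rw [Finset.sum_range_succ, atTime_succ, output_step, List.count_append, ih]
    rcases emitOf (M.view x (M.atTime x t)) with _ | _ | _ <;> rfl

theorem num_output (x : List Bool) (t i : ℕ) : num (M.atTime x t).output i =
    ∑ s ∈ Finset.range t, if emitOf (M.view x (M.atTime x s)) = some true ∧
      (M.atTime x s).output.count false = i then 1 else 0 := by
  induction t with
  | zero => rfl
  | succ t ih =>
    rw [Finset.sum_range_succ, atTime_succ, output_step, ← ih]
    rcases emitOf (M.view x (M.atTime x t)) with _ | b
    · simp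
    · rw [Option.toList_some, num_append_singleton]
      simp

end Machine

open Machine in
-- The machine is run again for every question about its output. A bit belongs to block `i` if `i`
-- zeros were written before it, so the number `i` is the count of the steps that write a 1 at such
-- a moment.
theorem LogSpaceComputable.ls_count_num {f : List Bool → List Bool} (hf : LogSpaceComputable f) :
    LS (fun x => (f x).count false) ∧ LS (fun p : List Bool × ℕ => num (f p.1) p.2) := by
  classical
  obtain ⟨M, ⟨c, hc⟩, hM⟩ := hf
  have := M.finite_state
  have := M.finite_symbol
  obtain ⟨E⟩ := FinCode.exists M.State M.start
  obtain ⟨S⟩ := FinCode.exists M.Symbol M.blank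
  obtain ⟨e, he⟩ := exists_cfgCode_lt E S hc
  have hview : ∀ x t, viewCode E S x (cfgCode E S (cells c x.length) (M.atTime x t)) =
      M.view x (M.atTime x t) := fun x t => viewCode_cfgCode E S x fun i => lt_cells (hc x _ i)
  have hout : ∀ x, f x = (M.atTime x ((x.length + 2) ^ e)).output := fun x => by
    obtain ⟨r, hr, ho⟩ := hM x
    rw [run_eq_atTime] at hr ho
    rw [← ho]
    refine (output_atTime hr (k := cfgCode E S (cells c x.length))
      (σ := stepCode E S () x) (fun s => ?_) (fun s s' hs h => ?_) fun s => he x _).symm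
    · rw [atTime_succ, stepCode_cfgCode E S () x (q := M.atTime x s) fun i => lt_cells (hc x _ i)]
    · rw [halted_iff_view, ← hview] at h ⊢
      rwa [← hs]
  have hcode : LS fun p : List Bool × ℕ => cfgCode E S (cells c p.1.length) (M.atTime p.1 p.2) := by
    have hiter : ∀ (p : List Bool × ℕ) (t : ℕ), (capStep E S e () p.1)^[t]
        (cfgCode E S (cells c p.1.length) M.init) =
        cfgCode E S (cells c p.1.length) (M.atTime p.1 t) := fun p t => by
      rw [atTime, ← foldl_capStep E S hc he]
      induction t with
      | zero => rfl
      | succ t ih => rw [Function.iterate_succ_apply', ih, List.replicate_succ', List.foldl_append]; rfl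
    refine (LS.iterate (n := fun p => p.2)
      (g := fun p => cfgCode E S (cells c p.1.length) M.init)
      (B := fun p : List Bool × ℕ => (p.1.length + 2) ^ e)
      (h := fun p => capStep E S e () p.1) .snd ((LS.const _).congr fun p => cfgCode_init E S _)
      (ls_capStep E S (α := ((List Bool × ℕ) × ℕ) × ℕ) e () .snd)
      ((LS.length.add (.const 2)).pow e).fst.polyBdd fun p t _ => ?_).congr fun p => (hiter p _).symm
    rw [hiter]
    exact (he _ _).le
  have hem : ∀ b, LSP fun p : List Bool × ℕ => emitOf (M.view p.1 (M.atTime p.1 p.2)) = some b :=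
    fun b => ((ls_viewCode E S hcode).holds fun v => emitOf v = some b).congr fun p => by
      rw [← hview]; rfl
  have hcount : LS fun p : List Bool × ℕ => (M.atTime p.1 p.2).output.count false :=
    (LS.sum (f := fun q : (List Bool × ℕ) × ℕ =>
      if emitOf (M.view q.1.1 (M.atTime q.1.1 q.2)) = some false then 1 else 0) LS.snd
      (LS.ofInput₁ (α := (List Bool × ℕ) × ℕ) (LS.indicator (hem false)) LS.snd)).congr
        fun p => count_output _ _
  have hT : LS fun x : List Bool => (x.length + 2) ^ e := (LS.length.add (.const 2)).pow e
  refine ⟨(LS.comp hcount hT).congr fun x => by rw [hout], ?_⟩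
  refine (LS.sum (f := fun q : (List Bool × ℕ) × ℕ =>
    if emitOf (M.view q.1.1 (M.atTime q.1.1 q.2)) = some true ∧
      (M.atTime q.1.1 q.2).output.count false = q.1.2 then 1 else 0) hT.fst (.indicator (.and ?_
        (.eq (hcount.ofInput₁ LS.snd) LS.snd.fst)))).congr fun p => by rw [hout, num_output]
  exact LS.ofInput₁ (α := (List Bool × ℕ) × ℕ) (hem true) LS.snd


/-! ### Comparator circuits described by sequences of numbers -/

/-- The first wire of gate `i` of the circuit described by `a`. -/
def gateFst (a : ℕ → ℕ) (i : ℕ) : ℕ := a (2 + a 0 + 2 * i)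

/-- The second wire of gate `i` of the circuit described by `a`. -/
def gateSnd (a : ℕ → ℕ) (i : ℕ) : ℕ := a (2 + a 0 + 2 * i + 1)

/-- The value on wire `w` after `i` gates of the circuit described by `a`. -/
def wireVal (a : ℕ → ℕ) : ℕ → ℕ → Bool
  | 0, w => decide (a (2 + w) = 1)
  | i + 1, w =>
    if w = gateFst a i then wireVal a i (gateFst a i) && wireVal a i (gateSnd a i)
    else if w = gateSnd a i then wireVal a i (gateFst a i) || wireVal a i (gateSnd a i)
    else wireVal a i w

/-- The number of gates of the circuit described by the first `N` terms of `a`. -/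
def gateCount (a : ℕ → ℕ) (N : ℕ) : ℕ := (N - (2 + a 0)) / 2

/-- The first `N` terms of `a` describe a comparator circuit. -/
def IsCircuit (a : ℕ → ℕ) (N : ℕ) : Prop :=
  a 1 < a 0 ∧ 2 + a 0 ≤ N ∧ (N - (2 + a 0)) % 2 = 0 ∧ (∀ i < a 0, a (2 + i) < 2) ∧
    ∀ i < N - (2 + a 0), a (2 + a 0 + i) < a 0

namespace ComparatorCircuit

variable (K : ComparatorCircuit)

/-- The numbers that describe a circuit. -/
def code : List ℕ := [K.m, (K.out : ℕ)] ++ (List.ofFn K.input).map Bool.toNat ++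
  K.gates.flatMap fun g => [(g.1 : ℕ), (g.2 : ℕ)]

theorem encode_eq : K.encode = encodeNats K.code := rfl

theorem length_code : K.code.length = 2 + K.m + 2 * K.gates.length := by
  rw [code, List.length_append, length_flatMap_pair]; simp; omega

/-- The sequence `a` describes the circuit `K`. -/
structure Describes (a : ℕ → ℕ) : Prop where
  m : a 0 = K.m
  out : a 1 = K.out
  input : ∀ w : Fin K.m, a (2 + w) = (K.input w).toNat
  fst : ∀ i (h : i < K.gates.length), gateFst a i = (K.gates[i].1 : ℕ)
  snd : ∀ i (h : i < K.gates.length), gateSnd a i = (K.gates[i].2 : ℕ)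

theorem describes_code : K.Describes fun i => K.code.getD i 0 := by
  have hl : ([K.m, (K.out : ℕ)] ++ (List.ofFn K.input).map Bool.toNat).length = 2 + K.m := by
    simp; omega
  have hr : ∀ i, K.code.getD (2 + K.m + i) 0 =
      (K.gates.flatMap fun g => [(g.1 : ℕ), (g.2 : ℕ)]).getD i 0 := fun i => by
    rw [code, List.getD_append_right _ _ _ _ (by omega), hl, Nat.add_sub_cancel_left]
  refine ⟨rfl, rfl, fun w => ?_, fun i h => ?_, fun i h => ?_⟩
  · have := w.2
    rw [code, List.getD_append _ _ _ _ (by omega)]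
    simp [add_comm 2]
  · exact (hr _).trans (getD_flatMap_pair K.gates _ _ h).1
  · exact (hr _).trans (getD_flatMap_pair K.gates _ _ h).2

variable {K} {a : ℕ → ℕ}

theorem Describes.isCircuit (h : K.Describes a) :
    IsCircuit a (2 + K.m + 2 * K.gates.length) := by
  obtain ⟨hm, ho, hi, hf, hs⟩ := h
  refine ⟨by rw [hm, ho]; exact K.out.2, by omega, by omega, fun i h => ?_, fun i h => ?_⟩
  · rw [hi ⟨i, by omega⟩]; exact Bool.toNat_lt _
  · rcases Nat.even_or_odd' i with ⟨j, rfl | rfl⟩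
    · have := hf j (by omega)
      rw [gateFst] at this
      rw [this, hm]; exact Fin.is_lt _
    · have := hs j (by omega)
      rw [gateSnd] at this
      rw [← add_assoc, this, hm]; exact Fin.is_lt _

theorem Describes.code_eq (h : K.Describes a) :
    K.code = (List.range (2 + K.m + 2 * K.gates.length)).map a := by
  obtain ⟨hm, ho, hi, hf, hs⟩ := h
  obtain ⟨hm', ho', hi', hf', hs'⟩ := K.describes_code
  refine List.ext_getElem (by rw [length_code]; simp) fun i h1 _ => ?_
  rw [List.getElem_map, List.getElem_range, ← List.getD_eq_getElem _ 0 h1]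
  rw [length_code] at h1
  rcases Nat.lt_or_ge i (2 + K.m) with h2 | h2
  · rcases i with _ | _ | i
    · exact hm'.trans hm.symm
    · exact ho'.trans ho.symm
    · have e := (hi' ⟨i, by omega⟩).trans (hi ⟨i, by omega⟩).symm
      rwa [show 2 + i = i + 1 + 1 by omega] at e
  · obtain ⟨i, rfl⟩ := Nat.exists_eq_add_of_le h2
    rcases Nat.even_or_odd' i with ⟨j, rfl | rfl⟩
    · have e := (hf' j (by omega)).trans (hf j (by omega)).symm
      rwa [gateFst, gateFst, hm', hm] at e
    · have e := (hs' j (by omega)).trans (hs j (by omega)).symm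
      rwa [gateSnd, gateSnd, hm', hm] at e

theorem Describes.foldl_applyGate (h : K.Describes a) {i : ℕ} (hi : i ≤ K.gates.length)
    (w : Fin K.m) : (K.gates.take i).foldl applyGate K.input w = wireVal a i w := by
  induction i generalizing w with
  | zero =>
    rw [wireVal, h.input, List.take_zero, List.foldl_nil]
    cases K.input w <;> rfl
  | succ i ih =>
    have ih := ih (by omega)
    rw [List.take_succ_eq_append_getElem (by omega), List.foldl_append, List.foldl_cons,
      List.foldl_nil, applyGate, wireVal, h.fst i hi, h.snd i hi, ← ih, ← ih, ← ih]
    simp only [Fin.ext_iff]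

theorem Describes.value_eq (h : K.Describes a) :
    K.value = wireVal a K.gates.length (a 1) := by
  rw [h.out, ← h.foldl_applyGate le_rfl, List.take_length, value]

end ComparatorCircuit

theorem IsCircuit.exists_describes {a : ℕ → ℕ} {N : ℕ} (h : IsCircuit a N) :
    ∃ K : ComparatorCircuit, K.Describes a ∧ N = 2 + K.m + 2 * K.gates.length := by
  obtain ⟨ho, hN, hpar, hi, hg⟩ := h
  have hf : ∀ i : Fin (gateCount a N), gateFst a i < a 0 := fun i => by
    have := i.2
    unfold gateCount at this
    exact hg _ (by omega)
  have hs : ∀ i : Fin (gateCount a N), gateSnd a i < a 0 := fun i => by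
    have := i.2
    unfold gateCount at this
    exact hg (2 * i + 1) (by omega)
  refine ⟨⟨a 0, fun w => decide (a (2 + w) = 1), List.ofFn fun i => (⟨_, hf i⟩, ⟨_, hs i⟩),
    ⟨a 1, ho⟩⟩, ⟨rfl, rfl, fun w => ?_, fun i h => ?_, fun i h => ?_⟩, ?_⟩
  · have := hi w w.2
    change a (2 + w) = (decide (a (2 + w) = 1)).toNat
    rcases h : a (2 + w) with _ | _ | k
    · rfl
    · rfl
    · omega
  · simp
  · simp
  · simp only [List.length_ofFn]
    unfold gateCount
    omega

/-- Membership in terms of the numbers in `y` alone: no unfinished block, a valid description, and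
the value of the output wire. Validity thus becomes decidable in logarithmic space. -/
theorem mem_comparatorCircuitValue (y : List Bool) : y ∈ comparatorCircuitValue ↔
    (num y (y.count false) = 0 ∧ IsCircuit (num y) (y.count false)) ∧
      wireVal (num y) (gateCount (num y) (y.count false)) (num y 1) = true := by
  constructor
  · rintro ⟨K, rfl, hK⟩
    have hnum : num K.encode = fun i => K.code.getD i 0 :=
      funext fun i => num_encodeNats K.code i
    have hd : K.Describes (num K.encode) := hnum ▸ K.describes_code
    have hc : K.encode.count false = 2 + K.m + 2 * K.gates.length :=
      (count_encodeNats K.code).trans K.length_code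
    refine ⟨⟨?_, hc ▸ hd.isCircuit⟩, ?_⟩
    · rw [hc, hnum, ← K.length_code]; simp
    · rw [← hK, hd.value_eq, hc, gateCount, hd.m]
      congr 1; omega
  · rintro ⟨⟨h0, hy⟩, hv⟩
    obtain ⟨K, hK, hN⟩ := hy.exists_describes
    refine ⟨K, ?_, ?_⟩
    · have := eq_encodeNats_append y
      rw [h0, hN, ← hK.code_eq] at this
      rw [this, K.encode_eq]; simp
    · rw [hK.value_eq, ← hv, hN, gateCount, hK.m]
      congr 1; omega

/-! ### Comparator circuits as networks -/

namespace Network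

variable {X : Type} [Fintype X] [DecidableEq X] (𝒩 : Network X)

/-- A layer in which the points with `P` stay and the others go to `z`. -/
theorem cnt_succ_of_select {j : ℕ} {z : X} {P : X → Prop} [DecidablePred P]
    (h : ∀ b c, 𝒩.f j b c = if P c then c else z) {w : X} (hw : w ≠ z) :
    𝒩.cnt (j + 1) w = if P w then 𝒩.cnt j w else 0 := by
  rw [cnt, Finset.sum_eq_single w]
  · simp only [h]
    by_cases hP : P w
    · simp only [hP, if_true]; omega
    · simp [hP, hw.symm]
  · intro c _ hc
    have : ∀ b, 𝒩.f j b c ≠ w := fun b => by rw [h]; split_ifs; exacts [hc, hw.symm]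
    simp [this]
  · simp

/-- Two layers that act like a comparator gate. -/
theorem cnt_add_two_of_gate {j : ℕ} {A B : X} (h1 : ∀ b c, 𝒩.f j b c = if c = A then B else c)
    (h2 : ∀ b c, 𝒩.f (j + 1) b c = if c = B then if b = true then A else B else c) (w : X) :
    𝒩.cnt (j + 2) w = if w = A then (𝒩.cnt j A + 𝒩.cnt j B) / 2
      else if w = B then (𝒩.cnt j A + 𝒩.cnt j B + 1) / 2 else 𝒩.cnt j w := by
  -- For a gate on twice the same wire both layers are the identity, in accordance with the formula.
  rcases eq_or_ne A B with rfl | hAB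
  · have s1 : ∀ w, 𝒩.cnt (j + 1) w = 𝒩.cnt j w := fun w => by
      rw [cnt, Finset.sum_eq_single w]
      · simp only [h1]; grind
      · intro c _ hc; simp only [h1]; grind
      · simp
    have s2 : ∀ w, 𝒩.cnt (j + 2) w = 𝒩.cnt (j + 1) w := fun w => by
      rw [cnt, Finset.sum_eq_single w]
      · simp only [h2]; grind
      · intro c _ hc; simp only [h2]; grind
      · simp
    rw [s2, s1]
    split_ifs with h
    · subst h; omega
    · rfl
  · have s1 : ∀ w, 𝒩.cnt (j + 1) w =
        if w = A then 0 else if w = B then 𝒩.cnt j A + 𝒩.cnt j B else 𝒩.cnt j w := fun w => by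
      have : ∀ c, ((if 𝒩.f j false c = w then (𝒩.cnt j c + 1) / 2 else 0) +
          (if 𝒩.f j true c = w then 𝒩.cnt j c / 2 else 0)) =
          (if c = A then if w = B then 𝒩.cnt j A else 0 else 0) +
          (if c = w then if w = A then 0 else 𝒩.cnt j w else 0) := fun c => by
        rw [h1, h1]
        grind
      rw [cnt, Finset.sum_congr rfl fun c _ => this c, Finset.sum_add_distrib,
        Finset.sum_ite_eq', Finset.sum_ite_eq']
      simp only [Finset.mem_univ, if_true]
      grind
    have : ∀ c, ((if 𝒩.f (j + 1) false c = w then (𝒩.cnt (j + 1) c + 1) / 2 else 0) +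
        (if 𝒩.f (j + 1) true c = w then 𝒩.cnt (j + 1) c / 2 else 0)) =
        (if c = B then if w = A then 𝒩.cnt (j + 1) B / 2 else 0 else 0) +
        (if c = w then if w = B then (𝒩.cnt (j + 1) B + 1) / 2 else 𝒩.cnt (j + 1) w else 0) :=
      fun c => by
        rw [h2, h2]
        grind
    rw [cnt, Finset.sum_congr rfl fun c _ => this c, Finset.sum_add_distrib,
      Finset.sum_ite_eq', Finset.sum_ite_eq']
    simp only [Finset.mem_univ, if_true, s1]
    grind

/-- In the first layers, the traversals are spread evenly. -/
theorem cnt_of_double {d : ℕ} (𝒩 : Network (Fin (2 ^ d))) (hd : 𝒩.d = d)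
    (h0 : (𝒩.x₀ : ℕ) = 0) (h : ∀ j < d, ∀ b c, (𝒩.f j b c : ℕ) =
      if 2 * (c : ℕ) + b.toNat < 2 ^ d then 2 * (c : ℕ) + b.toNat else 0) {j : ℕ} (hj : j ≤ d)
    (c : Fin (2 ^ d)) : 𝒩.cnt j c = if (c : ℕ) < 2 ^ j then 2 ^ (d - j) else 0 := by
  induction j generalizing c with
  | zero =>
    rw [cnt, hd, Nat.sub_zero]
    exact if_congr (by rw [Fin.ext_iff, h0, pow_zero]; omega) rfl rfl
  | succ j ih =>
    have ih := ih (by omega)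
    have h := h j (by omega)
    have hp : 2 ^ (d - j) = 2 * 2 ^ (d - (j + 1)) := by rw [← pow_succ']; congr 1; omega
    have hq : 2 ^ (j + 1) ≤ 2 ^ d := Nat.pow_le_pow_right two_pos hj
    rw [pow_succ] at hq ⊢
    have hf : ∀ c' : Fin (2 ^ d), (c' : ℕ) < 2 ^ j →
        (𝒩.f j false c' = c ↔ 2 * (c' : ℕ) = c) ∧ (𝒩.f j true c' = c ↔ 2 * (c' : ℕ) + 1 = c) :=
      fun c' hc' => by
        rw [Fin.ext_iff, Fin.ext_iff, h, h, Bool.toNat_false, Bool.toNat_true,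
          if_pos (by omega), if_pos (by omega), add_zero]
        exact ⟨Iff.rfl, Iff.rfl⟩
    -- Among the occupied points, those below `2 ^ j`, only `c / 2` leads to `c`; the cap is
    -- inactive there.
    have hne : ∀ c' : Fin (2 ^ d), ((c' : ℕ) ≠ c / 2 ∨ 2 ^ j ≤ (c' : ℕ)) →
        ((if 𝒩.f j false c' = c then (𝒩.cnt j c' + 1) / 2 else 0) +
          (if 𝒩.f j true c' = c then 𝒩.cnt j c' / 2 else 0)) = 0 := fun c' hc' => by
      rw [ih]
      rcases Nat.lt_or_ge c' (2 ^ j) with h3 | h3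
      · rw [if_neg fun e => by have := (hf c' h3).1.1 e; omega,
          if_neg fun e => by have := (hf c' h3).2.1 e; omega]
      · rw [if_neg (not_lt.2 h3)]; simp
    rw [cnt, Finset.sum_eq_single ⟨c / 2, (Nat.div_le_self _ _).trans_lt c.2⟩]
    · rcases Nat.lt_or_ge (c / 2) (2 ^ j) with h3 | h3
      · simp only [hf ⟨c / 2, (Nat.div_le_self _ _).trans_lt c.2⟩ h3]
        rw [ih, if_pos h3, if_pos (show (c : ℕ) < 2 ^ j * 2 by omega), hp]
        rcases Nat.mod_two_eq_zero_or_one c with h5 | h5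
        · rw [if_pos (by omega), if_neg (by omega)]; omega
        · rw [if_neg (by omega), if_pos (by omega)]; omega
      · rw [hne _ (Or.inr h3), if_neg (by omega)]
    · intro c' _ hc'
      exact hne c' (Or.inl fun h' => hc' (Fin.ext h'))
    · simp

end Network


/-- The number of layers in which the traversals are spread over `m` wires. -/
def spreadDepth (m : ℕ) : ℕ := Nat.log 2 m + 1

theorem lt_two_pow_spreadDepth (m : ℕ) : m < 2 ^ spreadDepth m :=
  Nat.lt_pow_succ_log_self one_lt_two m

theorem two_pow_spreadDepth_le (m : ℕ) : 2 ^ spreadDepth m ≤ 2 * m + 2 := by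
  rcases Nat.eq_zero_or_pos m with rfl | h
  · simp [spreadDepth]
  · have := Nat.pow_log_le_self 2 h.ne'
    rw [spreadDepth, pow_succ]; omega

/-! ### Powers of two with logarithmic exponents -/

section

variable {α : Type} [Ctx α]

/-- The power itself may be exponentially large, so the doubling is capped in every round. -/
theorem LS.min_two_pow {n B : α → ℕ} (hn : LS n) (hB : LS B) :
    LS (fun a => min (2 ^ n a) (B a)) := by
  have key : ∀ a i, (fun v => min (2 * v) (B a))^[i] (min 1 (B a)) = min (2 ^ i) (B a) := by
    intro a i
    induction i with
    | zero => rfl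
    | succ i ih =>
      rw [Function.iterate_succ_apply', ih, pow_succ]
      omega
  refine (iterate (h := fun a v => min (2 * v) (B a)) hn ((const 1).natMin hB)
    (((const 2).mul snd).natMin hB.fst.fst) hB.polyBdd fun a i _ => ?_).congr
      fun a => (key a _).symm
  rw [key]; exact min_le_right _ _

theorem LS.spreadDepth {m : α → ℕ} (hm : LS m) : LS (fun a => spreadDepth (m a)) := by
  classical
  refine (sum (f := fun p => if min (2 ^ (p.2 + 1)) (m p.1 + 1) ≤ m p.1 then 1 else 0) hm
    (indicator (LSP.le (min_two_pow snd.succ hm.fst.succ) hm.fst))).succ.congr fun a => ?_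
  rw [LogSpace.spreadDepth, ← Finset.card_filter, ← Finset.card_range (Nat.log 2 (m a))]
  congr 2
  ext i
  simp only [Finset.mem_range, Finset.mem_filter]
  rcases Nat.eq_zero_or_pos (m a) with h | h
  · simp [h]
  · rw [← Nat.succ_le_iff, Nat.le_log_iff_pow_le one_lt_two h.ne']
    -- The logarithm is the number of `i < m` with `2 ^ (i + 1) ≤ m`, and here the second condition
    -- implies the first. The cap `m + 1` is large enough to decide it.
    have : i < 2 ^ (i + 1) := (Nat.lt_two_pow_self).trans_le
      (Nat.pow_le_pow_right two_pos (Nat.le_succ i))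
    omega

theorem LS.two_pow_spreadDepth {m : α → ℕ} (hm : LS m) :
    LS (fun a => 2 ^ LogSpace.spreadDepth (m a)) :=
  (min_two_pow hm.spreadDepth (((const 2).mul hm).add (const 2))).congr
    fun _ => (min_eq_left (two_pow_spreadDepth_le _)).symm

end

/-- The transitions of the network of the comparator circuit described by `a`. -/
def circuitStep (a : ℕ → ℕ) (d : ℕ) (b : Bool) (j c : ℕ) : ℕ :=
  if j < d then 2 * c + b.toNat
  else if j = d then if c < a 0 ∧ a (2 + c) = 1 then c else a 0
  else if (j - (d + 1)) % 2 = 0 then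
    if c = gateFst a ((j - (d + 1)) / 2) then gateSnd a ((j - (d + 1)) / 2) else c
  else if c = gateSnd a ((j - (d + 1)) / 2) then
    if b = true then gateFst a ((j - (d + 1)) / 2) else gateSnd a ((j - (d + 1)) / 2)
  else c

theorem circuitStep_spread (a : ℕ → ℕ) {d j : ℕ} (h : j < d) (b : Bool) (c : ℕ) :
    circuitStep a d b j c = 2 * c + b.toNat := if_pos h

theorem circuitStep_input (a : ℕ → ℕ) (d : ℕ) (b : Bool) (c : ℕ) :
    circuitStep a d b d c = if c < a 0 ∧ a (2 + c) = 1 then c else a 0 := by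
  rw [circuitStep, if_neg (lt_irrefl _), if_pos rfl]

theorem circuitStep_gateFst (a : ℕ → ℕ) (d i : ℕ) (b : Bool) (c : ℕ) :
    circuitStep a d b (d + 1 + 2 * i) c = if c = gateFst a i then gateSnd a i else c := by
  rw [circuitStep, if_neg (by omega), if_neg (by omega), Nat.add_sub_cancel_left,
    Nat.mul_mod_right, if_pos rfl, Nat.mul_div_cancel_left i two_pos]

theorem circuitStep_gateSnd (a : ℕ → ℕ) (d i : ℕ) (b : Bool) (c : ℕ) :
    circuitStep a d b (d + 1 + 2 * i + 1) c =
      if c = gateSnd a i then if b = true then gateFst a i else gateSnd a i else c := by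
  have e : d + 1 + 2 * i + 1 - (d + 1) = 2 * i + 1 := by omega
  have e' : (2 * i + 1) / 2 = i := by omega
  rw [circuitStep, if_neg (by omega), if_neg (by omega), e, if_neg (by omega), e']

/-- The network of the comparator circuit with `G` gates described by `a`. -/
def circuitNetwork (a : ℕ → ℕ) (G : ℕ) (F : ℕ → Bool) : Network (Fin (2 ^ spreadDepth (a 0))) where
  f j b c := ⟨if circuitStep a (spreadDepth (a 0)) b j c < 2 ^ spreadDepth (a 0) then
    circuitStep a (spreadDepth (a 0)) b j c else 0, by split_ifs; assumption; positivity⟩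
  x₀ := ⟨0, by positivity⟩
  F c := F c
  T := spreadDepth (a 0) + 1 + 2 * G
  d := spreadDepth (a 0)
  e := true

theorem val_circuitNetwork_f (a : ℕ → ℕ) (G : ℕ) (F : ℕ → Bool) (j : ℕ) (b : Bool)
    (c : Fin (2 ^ spreadDepth (a 0))) : ((circuitNetwork a G F).f j b c : ℕ) =
      if circuitStep a (spreadDepth (a 0)) b j c < 2 ^ spreadDepth (a 0) then
        circuitStep a (spreadDepth (a 0)) b j c else 0 := rfl

/-- The spreading layers put one traversal on each point, and the selecting layer sends those
without an input 1 to the point `a 0`, which is not a wire. From then on the counts on the wires are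
0 or 1 and follow the gates. -/
theorem cnt_circuitNetwork {a : ℕ → ℕ} {G : ℕ} (F : ℕ → Bool)
    (hg : ∀ i < G, gateFst a i < a 0 ∧ gateSnd a i < a 0) {i : ℕ} (hi : i ≤ G)
    (w : Fin (2 ^ spreadDepth (a 0))) (hw : (w : ℕ) < a 0) :
    (circuitNetwork a G F).cnt (spreadDepth (a 0) + 1 + 2 * i) w = (wireVal a i w).toNat := by
  have hm := lt_two_pow_spreadDepth (a 0)
  induction i generalizing w with
  | zero =>
    rw [mul_zero, add_zero, (circuitNetwork a G F).cnt_succ_of_select (z := ⟨a 0, hm⟩)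
      (P := fun c => (c : ℕ) < a 0 ∧ a (2 + c) = 1) (fun b c => Fin.ext ?_)
      (fun h => hw.ne (congrArg Fin.val h)),
      Network.cnt_of_double _ rfl rfl (fun j hj b c => ?_) le_rfl, if_pos w.2, Nat.sub_self,
      pow_zero, wireVal]
    · by_cases h : a (2 + w) = 1 <;> simp [h, hw]
    · rw [val_circuitNetwork_f, circuitStep_spread a hj]
    · rw [val_circuitNetwork_f, circuitStep_input]
      have := c.2
      split_ifs <;> rfl
  | succ i ih =>
    have ih := ih (by omega)
    obtain ⟨hA, hB⟩ := hg i hi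
    rw [show spreadDepth (a 0) + 1 + 2 * (i + 1) = spreadDepth (a 0) + 1 + 2 * i + 2 by ring,
      (circuitNetwork a G F).cnt_add_two_of_gate (A := ⟨gateFst a i, hA.trans hm⟩)
        (B := ⟨gateSnd a i, hB.trans hm⟩) (fun b c => Fin.ext ?_) (fun b c => Fin.ext ?_),
      ih _ hA, ih _ hB, ih _ hw, wireVal]
    · simp only [Fin.ext_iff]
      cases wireVal a i (gateFst a i) <;> cases wireVal a i (gateSnd a i) <;>
        split_ifs <;> rfl
    · rw [val_circuitNetwork_f, circuitStep_gateFst]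
      have := c.2
      simp only [Fin.ext_iff]
      split_ifs <;> first | rfl | omega
    · rw [val_circuitNetwork_f, circuitStep_gateSnd]
      have := c.2
      simp only [Fin.ext_iff]
      split_ifs <;> first | rfl | omega

/-- The reduction of `K` to circuit evaluation is composed with the network construction by
recomputing the numbers of `f x` on demand. -/
theorem isHardFor_CC : IsHardFor CC arrival := by
  classical
  rintro K ⟨f, hf, hK⟩
  obtain ⟨hN, ha⟩ := hf.ls_count_num
  let a : List Bool → ℕ → ℕ := fun x => num (f x)
  let N : List Bool → ℕ := fun x => (f x).count false
  -- `f x` need not be an encoding. Validity is built into the accepting points, so that an invalid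
  -- description yields a network with no accepting traversal.
  let V : List Bool → Prop := fun x => a x (N x) = 0 ∧ IsCircuit (a x) (N x)
  have hN : LS N := hN
  have ha : ∀ {α : Type} [Ctx α] {g : α → ℕ}, LS g → LS fun q => a (Ctx.inp q) (g q) :=
    fun hg => ha.ofInput₁ hg
  have hm : LS fun x => a x 0 := ha (.const 0)
  have hd : LS fun x => spreadDepth (a x 0) := hm.spreadDepth
  have hV : LSP V := by
    have h2 : LS fun x => 2 + a x 0 := (LS.const 2).add hm
    have h3 : LS fun x => N x - (2 + a x 0) := hN.sub h2
    refine (LSP.eq_zero (ha hN)).and ((LSP.lt (ha (.const 1)) hm).and ((LSP.le h2 hN).and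
      ((LSP.eq_zero (h3.mod (.const 2))).and ((LSP.forall_lt hm (p := fun q => a q.1 (2 + q.2) < 2)
        (.lt (ha (α := List Bool × ℕ) ((LS.const 2).add .snd)) (.const 2))).and
      (LSP.forall_lt h3 (p := fun q => a q.1 (2 + a q.1 0 + q.2) < a q.1 0)
        (.lt (ha (α := List Bool × ℕ) (h2.fst.add .snd)) hm.fst))))))
  refine Network.logSpaceReducible (fun x => circuitNetwork (a x) (gateCount (a x) (N x))
      fun c => decide (V x ∧ c = a x 1)) (fun _ => rfl) (fun _ => Nat.succ_pos _)
    hm.two_pow_spreadDepth ((hd.add (.const 1)).add ((LS.const 2).mul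
      ((hN.sub ((LS.const 2).add hm)).div (.const 2)))) hd .zero
    (f := fun b q => if circuitStep (a q.1.1) (spreadDepth (a q.1.1 0)) b q.1.2 q.2 <
      2 ^ spreadDepth (a q.1.1 0) then circuitStep (a q.1.1) (spreadDepth (a q.1.1 0)) b q.1.2 q.2
      else 0) (fun b => ?_) (fun _ _ _ _ => rfl) (F := fun q => V q.1 ∧ q.2 = a q.1 1)
    (hV.fst.and (.eq .snd (ha (α := List Bool × ℕ) (.const 1))))
    (fun x c => decide_eq_true_iff) fun x => ?_
  · have hj : LS fun q : (List Bool × ℕ) × ℕ => q.1.2 := LS.snd.fst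
    have hc : LS fun q : (List Bool × ℕ) × ℕ => q.2 := .snd
    have hk : LS fun q : (List Bool × ℕ) × ℕ => q.1.2 - (spreadDepth (a q.1.1 0) + 1) :=
      hj.sub hd.fst.fst.succ
    have hm' : LS fun q : (List Bool × ℕ) × ℕ => a q.1.1 0 := hm.fst.fst
    have hA : LS fun q : (List Bool × ℕ) × ℕ =>
        gateFst (a q.1.1) ((q.1.2 - (spreadDepth (a q.1.1 0) + 1)) / 2) :=
      ha (α := (List Bool × ℕ) × ℕ) (((LS.const 2).add hm').add
        ((LS.const 2).mul (hk.div (.const 2))))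
    have hB : LS fun q : (List Bool × ℕ) × ℕ =>
        gateSnd (a q.1.1) ((q.1.2 - (spreadDepth (a q.1.1 0) + 1)) / 2) :=
      ha (α := (List Bool × ℕ) × ℕ) (((LS.const 2).add hm').add
        ((LS.const 2).mul (hk.div (.const 2)))).succ
    have hstep : LS fun q : (List Bool × ℕ) × ℕ =>
        circuitStep (a q.1.1) (spreadDepth (a q.1.1 0)) b q.1.2 q.2 :=
      .ite (.lt hj hd.fst.fst) (((LS.const 2).mul hc).add (.const _)) (.ite (.eq hj hd.fst.fst)
        (.ite ((LSP.lt hc hm').and (.eq (ha (α := (List Bool × ℕ) × ℕ) ((LS.const 2).add hc))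
          (.const 1))) hc hm') (.ite (.eq_zero (hk.mod (.const 2))) (.ite (.eq hc hA) hB hc)
        (.ite (.eq hc hB) (.ite (.of_const _) hA hB) hc)))
    exact .ite (.lt hstep hm.two_pow_spreadDepth.fst.fst) hstep .zero
  · rw [hK, mem_comparatorCircuitValue]
    change V x ∧ wireVal (a x) (gateCount (a x) (N x)) (a x 1) = true ↔ _
    have hpos : 0 < 2 ^ spreadDepth (a x 0) := by positivity
    have hlt := lt_two_pow_spreadDepth (a x 0)
    -- All but one of the required trains are supplied by the launching chain, so the condition is
    -- that `acc` is positive.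
    change _ ↔ 2 ^ spreadDepth (a x 0) ≤ _ + (2 ^ spreadDepth (a x 0) - 1)
    by_cases h : V x
    · obtain ⟨-, h1, -, -, -, h5⟩ := id h
      have hacc : (circuitNetwork (a x) (gateCount (a x) (N x))
          fun c => decide (V x ∧ c = a x 1)).acc =
          (wireVal (a x) (gateCount (a x) (N x)) (a x 1)).toNat := by
        rw [Network.acc, Finset.sum_eq_single ⟨a x 1, h1.trans hlt⟩]
        · refine (if_pos (decide_eq_true (p := V x ∧ a x 1 = a x 1) ⟨h, rfl⟩)).trans ?_
          refine cnt_circuitNetwork _ (fun i hi => ?_) le_rfl _ h1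
          unfold gateCount at hi
          exact ⟨h5 (2 * i) (by omega), h5 (2 * i + 1) (by omega)⟩
        · intro c _ hc
          rw [if_neg]
          intro h'
          exact hc (Fin.ext (of_decide_eq_true h').2)
        · simp
      rw [hacc]
      cases wireVal (a x) (gateCount (a x) (N x)) (a x 1)
      · simp
      · simp [h]; omega
    · have hacc : (circuitNetwork (a x) (gateCount (a x) (N x))
          fun c => decide (V x ∧ c = a x 1)).acc = 0 :=
        Finset.sum_eq_zero fun c _ => if_neg fun h' => h (of_decide_eq_true h').1
      rw [hacc]
      constructor
      · exact fun h' => absurd h'.1 h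
      · intro h'; omega

end LogSpace

theorem mainTheorem3 :
    LogSpace.IsHardFor LogSpace.CC LogSpace.arrival ∧
      LogSpace.IsHardFor LogSpace.PL LogSpace.arrival :=
  ⟨LogSpace.isHardFor_CC, LogSpace.isHardFor_PL⟩
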